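/- Let $\mathcal Q$ be a set of words on the alphabet $\{\bullet,\blacklozenge,\blacktriangle\}$. A word $w_1\cdots w_k\in\mathcal Q$ is identified with a clockwise oriented necklace that carries one $\square$-pearl followed by the pearls $w_1,\dots,w_k$. Put $Q(v,w,u)=\sum_{s\in\mathcal Q}v^{|s|_\bullet}w^{|s|_\blacklozenge}u^{|s|_\blacktriangle}$. All trees below are finite plane trees whose vertices are copies of necklaces of $\mathcal Q$ and whose edges join pearls, each pearl being incident to at most one edge; they are considered up to isomorphism. A pearl incident to no edge is *free*, and the size $|\tau|$ is the number of vertices. * A *rooted $\mathcal Q$-tree* is such a tree with a distinguished root $\square$-pearl, in which every edge joins a $\bullet$- or a $\blacklozenge$-pearl to a $\square$-pearl, and whose free pearls are exactly the root and the $\blacktriangle$-pearls. The subtree $\tau_x$ at a pearl $x$ consists of $x$ and everything on the other side of $x$ with respect to the root; the excess of $x$ is $|\tau_x|_\blacktriangle-|\tau_x|_\blacklozenge$. The tree is *non-negative* if the excess of every pearl is non-negative; its excess is that of its root. Let $\mathcal F_0$ be the class of non-negative $\mathcal Q$-trees with excess $0$, $\mathcal F_0^{\circ}$ the class of such trees with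 a marked necklace (vertex), and $f=\sum_{\tau\in\mathcal F_0}t^{|\tau|}$. * A *rooted $\mathcal Q$-companion tree* is such a tree with a distinguished root pearl (of any kind), in which every edge joins a $\bullet$- to a $\square$-pearl or a $\blacklozenge$- to a $\blacktriangle$-pearl, the root is free, and no non-root $\bullet$- or $\blacklozenge$-pearl is free. An *unrooted $\mathcal Q$-companion tree* is such a tree with the same two types of edges, without root pearl and without free $\bullet$- or $\blacklozenge$-pearl. *Defects* are free non-root $\blacktriangle$-pearls. For $x\in\{\square,\bullet,\blacklozenge,\blacktriangle\}$ let $\mathbf C_x$ be the class of rooted $\mathcal Q$-companion trees without defects with root pearl of kind $x$, and $C_x=\sum_{\tau\in\mathbf C_x}t^{|\tau|}$. Let $\mathbf C^{\circ}$ be the class of unrooted $\mathcal Q$-companion trees without defects with a marked necklace. * $(\square+\square\!-\!\mathbf C_\bullet)\times\mathcal Q(\bullet\!-\!\mathbf C_\square,\blacklozenge\!-\!\mathbf C_\blacktriangle,\blacktriangle\!-\!\mathbf C_\blacklozenge)$ denotes the class of pairs consisting of (i) a $\square$-pearl carrying either nothing or a tree of $\mathbf C_\bullet$, and (ii) a necklace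 $s\in\mathcal Q$ with a tree of $\mathbf C_\square$, $\mathbf C_\blacktriangle$, $\mathbf C_\blacklozenge$ attached to each of its $\bullet$-, $\blacklozenge$-, $\blacktriangle$-pearls respectively; the marked necklace of the pair is $s$. Then there are bijections $$\mathcal F_0^{\circ}\equiv\mathbf C^{\circ}\equiv(\square+\square\!-\!\mathbf C_\bullet)\times\mathcal Q(\bullet\!-\!\mathbf C_\square,\blacklozenge\!-\!\mathbf C_\blacktriangle,\blacktriangle\!-\!\mathbf C_\blacklozenge)$$ that preserve the multiset of necklaces and the type of the marked necklace. Moreover, $\mathcal F_0$, $\mathcal F_0^\circ$ and the classes $\mathbf C_x$ have finitely many elements of each size, the substitution of $C_\square,C_\blacktriangle,C_\blacklozenge$ into $Q$ is well defined, and the derivative of $f$, which satisfies $t\frac{df}{dt}=\sum_{\tau\in\mathcal F_0^\circ}t^{|\tau|}$, is given by $$\frac{df}{dt}=(1+C_\bullet)\cdot Q(C_\square,C_\blacktriangle,C_\blacklozenge).$$ -/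

import Mathlib

namespace Necklace

/-- The letters of the words that encode necklaces: `bullet` is `●`, `diamond` is `♦`,
`triangle` is `▲`. -/
inductive Letter
  | bullet
  | diamond
  | triangle
  deriving DecidableEq

/-- The four kinds of pearls: `none` is the square pearl `□`, `some x` is a letter. -/
abbrev Kind := Option Letter

/-- The pearls carried by a family of necklaces indexed by `V`. The necklace of the word
`w₁ ⋯ w_k` carries one `□`-pearl (position `none`), followed clockwise by the pearls
`w₁, …, w_k`. -/
abbrev Pearl {V : Type} (word : V → List Letter) : Type :=
  Σ v : V, Option (Fin (word v).length)

/-- A graph whose vertices are copies of necklaces, and whose edges join pearls, each pearl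
being incident to at most one edge. `mate p` is the other endpoint of the edge at `p`, and
`mate p = p` means that `p` is free. For a tree, the cyclic orders of the pearls on the
necklaces are precisely the plane structure. -/
structure Graph (V : Type) where
  word : V → List Letter
  mate : Pearl word → Pearl word
  mate_mate : ∀ p, mate (mate p) = p

namespace Graph

variable {V : Type} (G : Graph V)

/-- The kind (`□`, `●`, `♦` or `▲`) of a pearl. -/
def kind (p : Pearl G.word) : Kind := p.2.map (G.word p.1).get

/-- The pearl `p` is incident to no edge. -/
def Free (p : Pearl G.word) : Prop := G.mate p = p

/-- The simple graph whose nodes are the necklaces and the pearls, in which each necklace is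
joined to its pearls and each pearl to its mate. It is a tree exactly when the multigraph that
has the necklaces as vertices is connected and without cycle (loops and multiple edges
included). -/
def incidence : SimpleGraph (V ⊕ Pearl G.word) :=
  SimpleGraph.fromRel fun a b =>
    match a, b with
    | .inl v, .inr p => p.1 = v
    | .inr p, .inr q => G.mate p = q
    | _, _ => False

/-- Every edge joins a pearl of kind `a` to a pearl of kind `b`, for some pair `(a, b)` in the
list `l`, in one of the two directions. -/
def EdgesOfType (l : List (Kind × Kind)) : Prop :=
  ∀ p, ¬ G.Free p →
    (G.kind p, G.kind (G.mate p)) ∈ l ∨ (G.kind (G.mate p), G.kind p) ∈ l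

/-- Rooted `Q`-tree with root pearl `r`: a `□`-rooted tree with edges `●–□` (black) and `♦–□`
(red), in which exactly the root and the `▲`-pearls are free. -/
structure IsQTree (Q : Set (List Letter)) (r : Pearl G.word) : Prop where
  tree : G.incidence.IsTree
  word_mem : ∀ v, G.word v ∈ Q
  edges : G.EdgesOfType [(some .bullet, none), (some .diamond, none)]
  root_kind : G.kind r = none
  free_iff : ∀ p, G.Free p ↔ (p = r ∨ G.kind p = some .triangle)

/-- The set of pearls of the subtree at the pearl `x` of a tree rooted at the pearl `r`: those
on the other side of `x` with respect to the root, `x` included. -/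
def subtree (r x : Pearl G.word) : Set (Pearl G.word) :=
  {y | ∀ w : G.incidence.Walk (.inr r) (.inr y), .inr x ∈ w.support}

/-- The excess of the pearl `x` in the tree rooted at `r`: the number of `▲`-pearls minus the
number of `♦`-pearls in the subtree at `x`. -/
noncomputable def excess (r x : Pearl G.word) : ℤ :=
  ({y ∈ G.subtree r x | G.kind y = some .triangle}.ncard : ℤ) -
    ({y ∈ G.subtree r x | G.kind y = some .diamond}.ncard : ℤ)

/-- Non-negative `Q`-tree: the excess is non-negative at each pearl. -/
def IsNonnegQTree (Q : Set (List Letter)) (r : Pearl G.word) : Prop :=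
  G.IsQTree Q r ∧ ∀ x, 0 ≤ G.excess r x

/-- The conditions on vertices and edges shared by all `Q`-companion trees: a tree with
necklaces in `Q` and edges `●–□` (black) and `♦–▲` (blue). -/
structure IsCompanion (Q : Set (List Letter)) : Prop where
  tree : G.incidence.IsTree
  word_mem : ∀ v, G.word v ∈ Q
  edges : G.EdgesOfType [(some .bullet, none), (some .diamond, some .triangle)]

/-- Rooted `Q`-companion tree with root pearl `r`: the root is free, and no other `●`- or
`♦`-pearl is free. -/
structure IsRootedCompanion (Q : Set (List Letter)) (r : Pearl G.word) : Prop
    extends G.IsCompanion Q where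
  root_free : G.Free r
  free_kind : ∀ p, G.Free p → p ≠ r →
    G.kind p ≠ some .bullet ∧ G.kind p ≠ some .diamond

/-- Unrooted `Q`-companion tree: no `●`- or `♦`-pearl is free. -/
structure IsUnrootedCompanion (Q : Set (List Letter)) : Prop
    extends G.IsCompanion Q where
  free_kind : ∀ p, G.Free p → G.kind p ≠ some .bullet ∧ G.kind p ≠ some .diamond

/-- A defect is a free `▲`-pearl other than the root pearl (if there is one). -/
def IsDefect (root : Option (Pearl G.word)) (p : Pearl G.word) : Prop :=
  G.Free p ∧ G.kind p = some .triangle ∧ root ≠ some p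

variable {G}
variable {W : Type} {H : Graph W}

/-- The map on pearls induced by a map of necklaces that preserves words. -/
def mapPearl (σ : V → W) (hσ : ∀ v, H.word (σ v) = G.word v) (p : Pearl G.word) :
    Pearl H.word :=
  ⟨σ p.1, p.2.map (Fin.cast (congrArg List.length (hσ p.1).symm))⟩

theorem mapPearl_id (h : ∀ v, G.word (id v) = G.word v) (p : Pearl G.word) :
    mapPearl (H := G) id h p = p := by
  rcases p with ⟨v, _ | i⟩ <;> rfl

theorem mapPearl_comp {U : Type} {K : Graph U} (σ : V → W) (τ : W → U)
    (hσ : ∀ v, H.word (σ v) = G.word v) (hτ : ∀ v, K.word (τ v) = H.word v)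
    (hc : ∀ v, K.word ((τ ∘ σ) v) = G.word v) (p : Pearl G.word) :
    mapPearl (τ ∘ σ) hc p = mapPearl τ hτ (mapPearl σ hσ p) := by
  rcases p with ⟨v, _ | i⟩ <;> rfl

end Graph

/-- A finite necklace graph with possibly a root pearl and possibly a marked necklace. -/
structure Decorated where
  size : ℕ
  graph : Graph (Fin size)
  root : Option (Pearl graph.word)
  mark : Option (Fin size)

namespace Decorated

/-- Two decorated necklace graphs are isomorphic if a bijection between their necklaces preserves
the words, the edges between pearls, the root pearl and the marked necklace. -/
def Iso (A B : Decorated) : Prop :=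
  ∃ (σ : Fin A.size ≃ Fin B.size) (hσ : ∀ v, B.graph.word (σ v) = A.graph.word v),
    (∀ p, Graph.mapPearl σ hσ (A.graph.mate p) = B.graph.mate (Graph.mapPearl σ hσ p)) ∧
    A.root.map (Graph.mapPearl σ hσ) = B.root ∧
    A.mark.map σ = B.mark

theorem Iso.refl (A : Decorated) : A.Iso A := by
  have h : Graph.mapPearl (G := A.graph) (H := A.graph) id (fun _ => rfl) = id :=
    funext (Graph.mapPearl_id _)
  refine ⟨Equiv.refl _, fun _ => rfl, fun p => ?_, ?_, ?_⟩
  · exact (congrFun h _).trans (congrArg A.graph.mate (congrFun h p).symm)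
  · exact (congrArg (fun f => A.root.map f) h).trans (Option.map_id_fun' ▸ rfl)
  · exact congrFun Option.map_id A.mark

theorem Iso.symm {A B : Decorated} (h : A.Iso B) : B.Iso A := by
  obtain ⟨σ, hσ, hm, hr, hk⟩ := h
  have hτ : ∀ v, A.graph.word (σ.symm v) = B.graph.word v := fun v => by
    rw [← hσ, Equiv.apply_symm_apply]
  have h1 : ∀ p, Graph.mapPearl σ.symm hτ (Graph.mapPearl σ hσ p) = p := fun p => by
    have e : (σ.symm ∘ σ : Fin A.size → Fin A.size) = id := by ext; simp
    have hc : ∀ v, A.graph.word ((σ.symm ∘ σ) v) = A.graph.word v := fun v => by simp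
    rw [← Graph.mapPearl_comp σ σ.symm hσ hτ hc]
    generalize (σ.symm ∘ σ : Fin A.size → Fin A.size) = f at e hc
    subst e
    exact Graph.mapPearl_id _ p
  have h2 : ∀ p, Graph.mapPearl σ hσ (Graph.mapPearl σ.symm hτ p) = p := fun p => by
    have e : (σ ∘ σ.symm : Fin B.size → Fin B.size) = id := by ext; simp
    have hc : ∀ v, B.graph.word ((σ ∘ σ.symm) v) = B.graph.word v := fun v => by simp
    rw [← Graph.mapPearl_comp σ.symm σ hτ hσ hc]
    generalize (σ ∘ σ.symm : Fin B.size → Fin B.size) = f at e hc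
    subst e
    exact Graph.mapPearl_id _ p
  refine ⟨σ.symm, hτ, fun p => ?_, ?_, ?_⟩
  · rw [← h1 (A.graph.mate _), hm, h2]
  · rw [← hr, Option.map_map]
    have : Graph.mapPearl σ.symm hτ ∘ Graph.mapPearl σ hσ = id := funext h1
    rw [this, Option.map_id, id]
  · rw [← hk, Option.map_map]
    simp

theorem Iso.trans {A B C : Decorated} (h : A.Iso B) (h' : B.Iso C) : A.Iso C := by
  obtain ⟨σ, hσ, hm, hr, hk⟩ := h
  obtain ⟨τ, hτ, hm', hr', hk'⟩ := h'
  have hc : ∀ v, C.graph.word ((τ ∘ σ) v) = A.graph.word v := fun v => by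
    rw [Function.comp, hτ, hσ]
  have key : ∀ p, Graph.mapPearl (τ ∘ σ) hc p =
      Graph.mapPearl τ hτ (Graph.mapPearl σ hσ p) :=
    Graph.mapPearl_comp σ τ hσ hτ hc
  refine ⟨σ.trans τ, hc, fun p => ?_, ?_, ?_⟩
  · exact (key _).trans (((congrArg _ (hm p)).trans (hm' _)).trans
      (congrArg _ (key p).symm))
  · rw [← hr', ← hr, Option.map_map]
    exact congrArg (fun f => A.root.map f) (funext key)
  · rw [← hk', ← hk, Option.map_map]
    rfl

instance setoid : Setoid Decorated where
  r := Iso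
  iseqv := ⟨Iso.refl, Iso.symm, Iso.trans⟩

/-- The multiset of the necklaces of a decorated necklace graph. -/
def necklaces (A : Decorated) : Multiset (List Letter) :=
  Finset.univ.val.map A.graph.word

/-- The type of the marked necklace, if there is one. -/
def markedNecklace (A : Decorated) : Option (List Letter) := A.mark.map A.graph.word

theorem Iso.size_eq {A B : Decorated} (h : A.Iso B) : A.size = B.size := by
  obtain ⟨σ, -⟩ := h
  simpa using Fintype.card_congr σ

theorem Iso.necklaces_eq {A B : Decorated} (h : A.Iso B) : A.necklaces = B.necklaces := by
  obtain ⟨σ, hσ, -⟩ := h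
  have e : A.graph.word = B.graph.word ∘ σ := funext fun v => (hσ v).symm
  rw [necklaces, necklaces, e, ← Multiset.map_map]
  congr 1
  simp

theorem Iso.markedNecklace_eq {A B : Decorated} (h : A.Iso B) :
    A.markedNecklace = B.markedNecklace := by
  obtain ⟨σ, hσ, -, -, hk⟩ := h
  have e : A.graph.word = B.graph.word ∘ σ := funext fun v => (hσ v).symm
  rw [markedNecklace, markedNecklace, ← hk, Option.map_map, e]

end Decorated

/-- The isomorphism classes of the decorated necklace graphs that satisfy `P`. -/
def IsoClass (P : Decorated → Prop) : Type :=
  Quotient (Decorated.setoid.comap (Subtype.val : {A : Decorated // P A} → Decorated))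

namespace IsoClass

variable {P : Decorated → Prop}

/-- The number of necklaces. -/
def size (c : IsoClass P) : ℕ :=
  Quotient.lift (fun A : {A : Decorated // P A} => A.1.size)
    (fun _ _ h => Decorated.Iso.size_eq h) c

/-- The multiset of necklaces. -/
def necklaces (c : IsoClass P) : Multiset (List Letter) :=
  Quotient.lift (fun A : {A : Decorated // P A} => A.1.necklaces)
    (fun _ _ h => Decorated.Iso.necklaces_eq h) c

/-- The type of the marked necklace, if there is one. -/
def markedNecklace (c : IsoClass P) : Option (List Letter) :=
  Quotient.lift (fun A : {A : Decorated // P A} => A.1.markedNecklace)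
    (fun _ _ h => Decorated.Iso.markedNecklace_eq h) c

/-- The generating function by the number of necklaces. -/
noncomputable def gf (P : Decorated → Prop) : PowerSeries ℤ :=
  PowerSeries.mk fun n => (Nat.card {c : IsoClass P // c.size = n} : ℤ)

end IsoClass

/-- Non-negative `Q`-trees with excess `0`. -/
def IsF0 (Q : Set (List Letter)) (A : Decorated) : Prop :=
  A.mark = none ∧ ∃ r, A.root = some r ∧ A.graph.IsNonnegQTree Q r ∧ A.graph.excess r r = 0

/-- Non-negative `Q`-trees with excess `0` and with a marked necklace. -/
def IsMarkedF0 (Q : Set (List Letter)) (A : Decorated) : Prop :=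
  A.mark ≠ none ∧ ∃ r, A.root = some r ∧ A.graph.IsNonnegQTree Q r ∧ A.graph.excess r r = 0

/-- Rooted `Q`-companion trees without defects, with a root pearl of kind `x`. -/
def IsC (Q : Set (List Letter)) (x : Kind) (A : Decorated) : Prop :=
  A.mark = none ∧ (∀ p, ¬ A.graph.IsDefect A.root p) ∧
    ∃ r, A.root = some r ∧ A.graph.kind r = x ∧ A.graph.IsRootedCompanion Q r

/-- Unrooted `Q`-companion trees without defects and with a marked necklace. -/
def IsMarkedC (Q : Set (List Letter)) (A : Decorated) : Prop :=
  A.mark ≠ none ∧ A.root = none ∧ (∀ p, ¬ A.graph.IsDefect none p) ∧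
    A.graph.IsUnrootedCompanion Q

/-- The class of rooted `Q`-companion trees without defects whose root has kind `x`. -/
abbrev C (Q : Set (List Letter)) (x : Kind) : Type := IsoClass (IsC Q x)

/-- The kind of pearl to which a pearl is attached by an edge `●–□`, `♦–▲` or `▲–♦`. -/
def Letter.partner : Letter → Kind
  | .bullet => none
  | .diamond => some .triangle
  | .triangle => some .diamond

/-- The class `Q(●–C_□, ♦–C_▲, ▲–C_♦)`: a necklace `s` of `Q`, together with a tree of `C_□`
attached to each `●`-pearl of `s`, a tree of `C_▲` attached to each `♦`-pearl, and a tree of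
`C_♦` attached to each `▲`-pearl. -/
def Attached (Q : Set (List Letter)) : Type :=
  Σ s : Q, ∀ i : Fin s.1.length, C Q (s.1.get i).partner

/-- The class `(□ + □–C_●) × Q(●–C_□, ♦–C_▲, ▲–C_♦)`, where `none` is the bare `□`-pearl and
`some τ` is a `□`-pearl that carries the tree `τ`. -/
abbrev Pairs (Q : Set (List Letter)) : Type := Option (C Q (some .bullet)) × Attached Q

/-- The multiset of all the necklaces of an element of `Pairs Q`: those of the tree carried by
the `□`-pearl, the necklace `s`, and those of the trees attached to the letters of `s`. -/
def Pairs.necklaces {Q : Set (List Letter)} (x : Pairs Q) : Multiset (List Letter) :=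
  x.1.elim 0 IsoClass.necklaces + (x.2.1.1 ::ₘ ∑ i, (x.2.2 i).necklaces)

/-- The generating function `Q(v, w, u) = ∑_{s ∈ Q} v^{|s|_●} w^{|s|_♦} u^{|s|_▲}`, the
variables `v, w, u` being indexed by the letters `●, ♦, ▲`. -/
noncomputable def vertexGF (Q : Set (List Letter)) : MvPowerSeries Letter ℤ :=
  fun m => (Nat.card {s : Q // ∀ x, s.1.count x = m x} : ℤ)

/-- The series `(v, w, u) = (C_□, C_▲, C_♦)`. -/
noncomputable def companionSeries (Q : Set (List Letter)) (x : Letter) : PowerSeries ℤ :=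
  IsoClass.gf (IsC Q x.partner)

end Necklace

/-! Give every necklace `s` its own weight `x s`. Let `F(u)` be the weighted series of non-negative
trees, `u` recording the excess. Cutting a tree at its root necklace gives `F = Q(F, ΔF, u)` with
`ΔF = (F - F(0)) / u` (`nonnegGF_eq`): a `●` carries any non-negative tree, a `▲` contributes `u`,
and a `♦` lowers the excess by one, hence needs a tree of positive excess. Cutting companion trees
at their root necklace gives an algebraic system without `Δ` for `P = 1 + C_●`, `V = C_□`, `W =
C_▲`, `U = C_♦` (`IsSystem`, `isSystem_comp`).

The two are linked by the kernel method. A derivation `∂` applied to the equation of `F` gives `(1 -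
Q_v) ∂F = ∑ (∂x_s) F^a (ΔF)^b u^c + Q_w ∂(ΔF) + Q_u ∂u`, while `∂F = ∂F(0) + u ∂(ΔF) + ΔF ∂u`. At
the value of `u` with `u = Q_w + u Q_v` the unknown `∂(ΔF)` cancels. For `∂ = d/du` what is left
says that `1 / (1 - Q_v)`, `F(u)`, `ΔF(u)` and `u` solve the companion system, so by uniqueness they
are the companion series. For a `∂` that kills every weight except `x s` what is left is `∂F(0) = P
V^a W^b U^c ∂x_s` (`derivation_coeff_zero`).

With the Euler operator of `x s` as `∂`, the left side counts trees of excess `0` with a marked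
necklace of type `s`, and the right side counts companion trees marked at such a necklace
(`markedGF`). Coefficient extraction gives `ncard_mul_count`, an equality of cardinalities for each
multiset of necklaces and each marked type. These fibres are finite, so the first bijection follows,
without an explicit construction; the second cuts a companion tree at its marked necklace. Since `Q`
may be infinite, the computation for a multiset `M` is made with polynomials truncated above degree
`M.card`, with nonzero weights on the members of `M` only: all sums are finite and all fixed point
iterations stop.

Isomorphism classes of graphs are replaced throughout by the inductive type `Tree`: a tree with a
free root pearl or a marked necklace has exactly one recursive description
(`IsoClass.exists_equiv_tree`). A rooted tree has no nontrivial automorphism, so a tree of size `n`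
has `n` markings, which gives `t df/dt`. The products of classes then become products of series. -/

section

open Polynomial

namespace Necklace

/-! ### The kernel method over a ring with a nilpotent ideal. -/

section Kernel

variable {ι R : Type*} [CommRing R]

/-- The polynomial `∑ x_s v^{a_s} w^{b_s} u^{c_s}` evaluated at a point. -/
def mono (S : Finset ι) (a b c : ι → ℕ) {B : Type*} [CommRing B] (x : ι → B) (v w u : B) : B :=
  ∑ s ∈ S, x s * (v ^ a s * w ^ b s * u ^ c s)

/-- The partial derivative of `mono` in its first variable. -/
def monoV (S : Finset ι) (a b c : ι → ℕ) {B : Type*} [CommRing B] (x : ι → B) (v w u : B) : B :=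
  ∑ s ∈ S, x s * (a s * v ^ (a s - 1) * w ^ b s * u ^ c s)

/-- The partial derivative of `mono` in its second variable. -/
def monoW (S : Finset ι) (a b c : ι → ℕ) {B : Type*} [CommRing B] (x : ι → B) (v w u : B) : B :=
  ∑ s ∈ S, x s * (v ^ a s * (b s * w ^ (b s - 1)) * u ^ c s)

/-- The partial derivative of `mono` in its third variable. -/
def monoU (S : Finset ι) (a b c : ι → ℕ) {B : Type*} [CommRing B] (x : ι → B) (v w u : B) : B :=
  ∑ s ∈ S, x s * (v ^ a s * w ^ b s * (c s * u ^ (c s - 1)))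

variable {S : Finset ι} {a b c : ι → ℕ}

section map
variable {B B' : Type*} [CommRing B] [CommRing B'] (g : B →+* B') (x : ι → B) (v w u : B)

theorem map_mono : g (mono S a b c x v w u) = mono S a b c (g ∘ x) (g v) (g w) (g u) := by
  simp [mono]
theorem map_monoV : g (monoV S a b c x v w u) = monoV S a b c (g ∘ x) (g v) (g w) (g u) := by
  simp [monoV]
theorem map_monoW : g (monoW S a b c x v w u) = monoW S a b c (g ∘ x) (g v) (g w) (g u) := by
  simp [monoW]
theorem map_monoU : g (monoU S a b c x v w u) = monoU S a b c (g ∘ x) (g v) (g w) (g u) := by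
  simp [monoU]
end map

/-- Stated for an arbitrary derivation because the kernel argument uses two of them: differentiation
in the catalytic variable and a derivation of the coefficients. -/
theorem derivation_mono {A B M : Type*} [CommRing A] [CommRing B] [Algebra A B] [AddCommGroup M]
    [Module A M] [Module B M] (D : Derivation A B M) (x : ι → B) (v w u : B) :
    D (mono S a b c x v w u) = ∑ s ∈ S, (v ^ a s * w ^ b s * u ^ c s) • D (x s)
      + monoV S a b c x v w u • D v + monoW S a b c x v w u • D w
      + monoU S a b c x v w u • D u := by
  simp only [mono, monoV, monoW, monoU, map_sum, Finset.sum_smul, ← Finset.sum_add_distrib]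
  refine Finset.sum_congr rfl fun s _ => ?_
  simp only [Derivation.leibniz, Derivation.leibniz_pow, ← Nat.cast_smul_eq_nsmul B]
  module

/-- Sums whose coefficients lie in `I` contract the `J`-adic distance. -/
theorem sum_contract (I J : Ideal R) (x : ι → R) (hx : ∀ s ∈ S, x s ∈ I) (f g : ι → R)
    (h : ∀ s ∈ S, f s - g s ∈ J) : ∑ s ∈ S, x s * f s - ∑ s ∈ S, x s * g s ∈ I * J := by
  rw [← Finset.sum_sub_distrib]
  refine Ideal.sum_mem _ fun s hs => ?_
  rw [← mul_sub]
  exact Ideal.mul_mem_mul (hx s hs) (h s hs)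

variable {I : Ideal R} {N : ℕ}

/-- Successive iterates of a contraction agree modulo growing powers of `I`, and `I ^ N = ⊥` makes
the iteration stationary after `N` steps. -/
theorem exists_fixed_point (hI : I ^ N = ⊥) (Φ : R → R)
    (h : ∀ n y z, y - z ∈ I ^ n → Φ y - Φ z ∈ I ^ (n + 1)) : ∃ y, Φ y = y := by
  have key : ∀ n, Φ (Φ^[n] 0) - Φ^[n] 0 ∈ I ^ n := by
    intro n
    induction n with
    | zero => simp
    | succ n ih =>
      rw [Function.iterate_succ_apply']
      exact h n _ _ ih
  refine ⟨Φ^[N] 0, ?_⟩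
  have := key N
  rw [hI, Ideal.mem_bot] at this
  exact sub_eq_zero.1 this

/-- The system of equations satisfied by the series of companion trees. -/
structure IsSystem (S : Finset ι) (a b c : ι → ℕ) (x : ι → R) (P V W U : R) : Prop where
  eqV : V = mono S a b c x V W U
  eqP : P = 1 + P * monoV S a b c x V W U
  eqU : U = P * monoW S a b c x V W U
  eqW : W = P * monoU S a b c x V W U

/-- Up to the constant `1`, every right-hand side is a combination of weights `x s ∈ I`. Agreement
of two solutions modulo `I ^ n` therefore improves to agreement modulo `I ^ (n + 1)`. -/
theorem IsSystem.unique {x : ι → R} (hI : I ^ N = ⊥) (hx : ∀ s ∈ S, x s ∈ I) {P V W U P' V' W' U' : R}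
    (h : IsSystem S a b c x P V W U) (h' : IsSystem S a b c x P' V' W' U') :
    P = P' ∧ V = V' ∧ W = W' ∧ U = U' := by
  have key : ∀ n, P - P' ∈ I ^ n ∧ V - V' ∈ I ^ n ∧ W - W' ∈ I ^ n ∧ U - U' ∈ I ^ n := by
    intro n
    induction n with
    | zero => simp
    | succ n ih =>
      have e : ∀ {y z : R}, y - z ∈ I ^ n ↔ Ideal.Quotient.mk (I ^ n) y = Ideal.Quotient.mk (I ^ n) z :=
        fun {y z} => Ideal.Quotient.eq.symm
      simp only [e] at ih
      obtain ⟨hP, hV, hW, hU⟩ := ih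
      have con : ∀ f g : ι → R, (∀ s ∈ S, f s - g s ∈ I ^ n) →
          ∑ s ∈ S, x s * f s - ∑ s ∈ S, x s * g s ∈ I ^ (n + 1) := fun f g hfg => by
        rw [pow_succ']
        exact sum_contract I _ x hx f g hfg
      have mulP : ∀ f g : ι → R, (∀ s ∈ S, f s - g s ∈ I ^ n) →
          P * ∑ s ∈ S, x s * f s - P' * ∑ s ∈ S, x s * g s ∈ I ^ (n + 1) := fun f g hfg => by
        -- The factors `P` and `P'` are moved inside the sums, so that the weights still supply the
        -- extra power of `I`.
        have := con (fun s => P * f s) (fun s => P' * g s) (fun s hs => by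
          rw [e, map_mul, map_mul, hP, e.1 (hfg s hs)])
        simpa [Finset.mul_sum, mul_left_comm] using this
      refine ⟨?_, ?_, ?_, ?_⟩
      · rw [h.eqP, h'.eqP, add_sub_add_left_eq_sub]
        exact mulP _ _ fun s _ => by rw [e]; simp [hV, hW, hU]
      · rw [h.eqV, h'.eqV]
        exact con _ _ fun s _ => by rw [e]; simp [hV, hW, hU]
      · rw [h.eqW, h'.eqW]
        exact mulP _ _ fun s _ => by rw [e]; simp [hV, hW, hU]
      · rw [h.eqU, h'.eqU]
        exact mulP _ _ fun s _ => by rw [e]; simp [hV, hW, hU]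
  have := key N
  simpa only [hI, Ideal.mem_bot, sub_eq_zero] using this

/-- The derivation `D` applied to the coefficients of polynomials. -/
noncomputable def coeffDerivation (D : Derivation ℤ R R) : Derivation ℤ R[X] R[X] :=
  (PolynomialModule.equivPolynomialSelf (R := R)).toLinearMap.compDer D.mapCoeffs

@[simp]
theorem coeff_coeffDerivation (D : Derivation ℤ R R) (p : R[X]) (i : ℕ) :
    (coeffDerivation D p).coeff i = D (p.coeff i) := rfl

/-- If `F(u) = ∑ x_s F^a (ΔF)^b u^c`, then the solution `(P, V, W, U)` of the system consists of values at
`U` of series built from `F`, and it gives the derivatives of `F(0)`. -/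
theorem derivation_coeff_zero {x : ι → R} (hI : I ^ N = ⊥) (hx : ∀ s ∈ S, x s ∈ I) {P V W U : R}
    (h : IsSystem S a b c x P V W U) (F : R[X])
    (hF : F = mono S a b c (Polynomial.C ∘ x) F (divX F) X) (D : Derivation ℤ R R) (s₀ : ι) (hs₀ : s₀ ∈ S)
    (hD : ∀ s ∈ S, s ≠ s₀ → D (x s) = 0) :
    D (F.coeff 0) = P * (V ^ a s₀ * W ^ b s₀ * U ^ c s₀) * D (x s₀) := by
  have hdiv : divX F * X + Polynomial.C (F.coeff 0) = F := divX_mul_X_add F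
  -- the value of `u` that cancels the kernel
  obtain ⟨u, hu⟩ : ∃ u : R, (monoW S a b c (Polynomial.C ∘ x) F (divX F) X
      + X * monoV S a b c (Polynomial.C ∘ x) F (divX F) X).eval u = u := by
    refine exists_fixed_point hI _ fun n y z hyz => ?_
    have key : ∀ f : ι → R[X], (∑ s ∈ S, Polynomial.C (x s) * f s).eval y - (∑ s ∈ S, Polynomial.C (x s) * f s).eval z
        ∈ I ^ (n + 1) := fun f => by
      simp only [eval_finsetSum, eval_mul, eval_C]
      rw [pow_succ']
      refine sum_contract I _ x hx _ _ fun s _ => ?_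
      exact Ideal.mem_of_dvd _ (sub_dvd_eval_sub y z (f s)) hyz
    have := key (fun s => (F ^ a s * ((b s : R[X]) * divX F ^ (b s - 1)) * X ^ c s)
      + X * ((a s : R[X]) * F ^ (a s - 1) * divX F ^ b s * X ^ c s))
    simpa only [monoV, monoW, Finset.mul_sum, ← Finset.sum_add_distrib, mul_add, Function.comp,
      mul_left_comm X] using this
  set E : R[X] →+* R := evalRingHom u with hE
  have hEx : ⇑E ∘ Polynomial.C ∘ x = x := by ext s; simp [hE]
  have hEX : E X = u := by simp [hE]
  have hEC : ∀ r, E (Polynomial.C r) = r := fun r => by simp [hE]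
  change E _ = u at hu
  rw [map_add, map_mul, map_monoV, map_monoW, hEX, hEx] at hu
  have hV : E F = mono S a b c x (E F) (E (divX F)) u := by
    conv_lhs => rw [hF, map_mono, hEX, hEx]
  set V' := E F with hV'
  set W' := E (divX F) with hW'
  -- The weights make `Q_v` nilpotent, so `1 - Q_v` is invertible and its inverse `P'` is the
  -- candidate for `P`.
  have hQv : monoV S a b c x V' W' u ∈ I :=
    Ideal.sum_mem _ fun s hs => Ideal.mul_mem_right _ _ (hx s hs)
  have hnil : IsNilpotent (monoV S a b c x V' W' u) :=
    ⟨N, by simpa [hI] using Ideal.pow_mem_pow hQv N⟩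
  obtain ⟨P', hP'⟩ := hnil.isUnit_one_sub.exists_left_inv
  -- The kernel equation `u (1 - Q_v) = Q_w`, divided by `1 - Q_v`, is the third equation of the
  -- system.
  have hPU : u = P' * monoW S a b c x V' W' u := by
    linear_combination (-P') * hu - u * hP'
  -- the equation obtained from a derivation of polynomials, multiplied by `P'`
  have hder : ∀ (Δ : Derivation ℤ R[X] R[X]),
      E (Δ F) = P' * (∑ s ∈ S, (V' ^ a s * W' ^ b s * u ^ c s) * E (Δ (Polynomial.C (x s))))
        + u * E (Δ (divX F)) + P' * monoU S a b c x V' W' u * E (Δ X) := fun Δ => by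
    have e : E (Δ F) = E (Δ (mono S a b c (Polynomial.C ∘ x) F (divX F) X)) := by rw [← hF]
    rw [derivation_mono] at e
    simp only [ map_add, smul_eq_mul, map_mul, map_sum, map_pow, map_monoV, map_monoW,
      map_monoU, hEX, hEx, ← hV', ← hW', Function.comp] at e
    linear_combination P' * e - E (Δ F) * hP' - E (Δ (divX F)) * hPU
  have hsys : IsSystem S a b c x P' V' W' u := by
    refine ⟨hV, by linear_combination hP', hPU, ?_⟩
    -- Differentiation in the variable kills the weights. Compared with the derivative of `F = F(0)
    -- + X * divX F`, the two terms `u * (divX F)'` cancel and `W' = P' * Q_u` remains.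
    have e := hder (derivative'.restrictScalars ℤ)
    have e2 := congrArg (fun p => E (derivative p)) hdiv
    simp only [Derivation.restrictScalars_apply, derivative'_apply, derivative_C, map_zero, mul_zero,
      Finset.sum_const_zero, derivative_X, map_one, map_add, derivative_mul, map_mul, mul_one, add_zero,
      hEX, ← hW'] at e e2
    linear_combination e2 + e
  obtain ⟨rfl, rfl, rfl, rfl⟩ := h.unique hI hx hsys
  -- The same cancellation for the coefficientwise derivation, which kills `X`, leaves `D (F.coeff
  -- 0)` alone on one side and only the term of `s₀` on the other.
  have e := hder (coeffDerivation D)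
  have hX : coeffDerivation D X = 0 := by
    ext i; simp [coeff_X, apply_ite D]
  have hC : ∀ r, coeffDerivation D (Polynomial.C r) = Polynomial.C (D r) := fun r => by
    ext i; simp [coeff_C, apply_ite D]
  have e2 := congrArg (fun p => E (coeffDerivation D p)) hdiv
  simp only [map_add, Derivation.leibniz, hX, hC, smul_eq_mul, zero_add, map_mul, hEX,
    hEC, map_zero, mul_zero, add_zero] at e e2
  rw [Finset.sum_eq_single_of_mem s₀ hs₀ (fun s hs hne => by rw [hD s hs hne, mul_zero])] at e
  linear_combination e2 + e

end Kernel
end Necklace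

end

/-! ### Recursive descriptions of trees of necklaces. -/

namespace Necklace

/-- Positions of the pearls on the necklace of a word. -/
abbrev Pos (s : List Letter) : Type := Option (Fin s.length)

/-- The kind of the pearl at a position. -/
def posKind (s : List Letter) (q : Pos s) : Kind := q.map s.get

/-- Recursive description of a tree of necklaces. `leaf` stands for nothing attached, and
`node s p ch` for a necklace `s` with the root pearl at position `p` (no root pearl if `p = none`), and the
tree `ch q` attached to the pearl at `q`. -/
inductive Tree : Type
  | leaf
  | node (s : List Letter) (p : Option (Pos s)) (ch : Pos s → Tree)

namespace Tree

/-- The necklaces of a tree. -/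
def Vtx : Tree → Type
  | leaf => Empty
  | node s _ ch => Option (Σ q : Pos s, (ch q).Vtx)

/-- The word of a necklace of a tree. -/
def word : ∀ t : Tree, t.Vtx → List Letter
  | leaf, x => x.elim
  | node s _ _, none => s
  | node _ _ ch, some x => (ch x.1).word x.2

/-- The root pearl of a tree. -/
def root : ∀ t : Tree, Option (Pearl t.word)
  | leaf => none
  | node _ p _ => p.map fun q => ⟨none, q⟩

/-- A pearl of the tree attached at position `q` as a pearl of the whole tree. -/
def lift {s : List Letter} {p : Option (Pos s)} {ch : Pos s → Tree} (q : Pos s)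
    (y : Pearl (ch q).word) : Pearl (node s p ch).word := ⟨some ⟨q, y.1⟩, y.2⟩

/-- A pearl of the necklace at the top of a tree. -/
def top {s : List Letter} {p : Option (Pos s)} {ch : Pos s → Tree} (q : Pos s) :
    Pearl (node s p ch).word := ⟨none, q⟩

open Classical in
/-- The other endpoint of the edge at a pearl of the tree `node s p ch`. -/
noncomputable def nodeMate {s : List Letter} {p : Option (Pos s)} {ch : Pos s → Tree}
    (m : ∀ q, Pearl (ch q).word → Pearl (ch q).word) :
    Pearl (node s p ch).word → Pearl (node s p ch).word
  | ⟨none, q⟩ => (ch q).root.elim (top q) (lift q)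
  | ⟨some ⟨q, v⟩, i⟩ =>
    if (ch q).root = some ⟨v, i⟩ then top q else lift q (m q ⟨v, i⟩)

/-- The other endpoint of the edge at a pearl of a tree. -/
noncomputable def mate : ∀ t : Tree, Pearl t.word → Pearl t.word
  | leaf => id
  | node _ _ ch => nodeMate fun q => (ch q).mate

/-- Trees in which nothing is attached to root pearls, and everything attached has a root pearl. -/
def WF : Tree → Prop
  | leaf => True
  | node _ p ch => (∀ q, p = some q → ch q = leaf) ∧
      ∀ q, ch q = leaf ∨ (ch q).root ≠ none ∧ (ch q).WF

section
variable {s : List Letter} {p : Option (Pos s)} {ch : Pos s → Tree}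

theorem lift_injective (q : Pos s) : Function.Injective (lift (p := p) (ch := ch) q) := by
  rintro ⟨v, i⟩ ⟨w, j⟩ h
  obtain ⟨h1, h2⟩ := Sigma.mk.inj_iff.1 h
  cases h1
  cases h2
  rfl

theorem lift_ne_top (q q' : Pos s) (y) : lift (p := p) (ch := ch) q y ≠ top q' := by
  intro h
  injection h with h1 _
  cases h1

theorem top_inj {q q' : Pos s} : top (p := p) (ch := ch) q = top q' ↔ q = q' := by
  constructor
  · intro h
    injection h
  · rintro rfl; rfl

theorem pearl_cases (P : Pearl (node s p ch).word → Prop) (h1 : ∀ q, P (top q))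
    (h2 : ∀ q y, P (lift q y)) : ∀ y, P y
  | ⟨none, q⟩ => h1 q
  | ⟨some ⟨q, v⟩, i⟩ => h2 q ⟨v, i⟩

theorem mate_top (q : Pos s) :
    (node s p ch).mate (top q) = (ch q).root.elim (top q) (lift q) := rfl

theorem mate_top_none {q : Pos s} (h : (ch q).root = none) :
    (node s p ch).mate (top q) = top q := by
  rw [mate_top, h]; rfl

theorem mate_top_some {q : Pos s} {y} (h : (ch q).root = some y) :
    (node s p ch).mate (top q) = lift q y := by
  rw [mate_top, h]; rfl

theorem mate_lift_root {q : Pos s} {y} (h : (ch q).root = some y) :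
    (node s p ch).mate (lift q y) = top q := by
  obtain ⟨v, i⟩ := y
  exact if_pos h

theorem mate_lift {q : Pos s} {y} (h : (ch q).root ≠ some y) :
    (node s p ch).mate (lift q y) = lift q ((ch q).mate y) := by
  obtain ⟨v, i⟩ := y
  exact if_neg h
end

/-- Freeness of the root pearl inside its own tree is what leaves room for the edge to a parent;
with it `mate` is an involution after grafting. -/
theorem root_free : ∀ {t : Tree}, t.WF → ∀ {y}, t.root = some y → t.mate y = y
  | node s p ch, h, y, hy => by
    cases p with
    | none => cases hy
    | some q =>
      cases hy
      exact mate_top_none (by rw [h.1 q rfl]; rfl)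

theorem mate_ne_root {t : Tree} (h : t.WF) (hm : ∀ y, t.mate (t.mate y) = y) {y}
    (hy : t.root ≠ some y) : t.root ≠ some (t.mate y) := fun h' => by
  have := root_free h h'
  rw [hm] at this
  exact hy (by rw [h', ← this])

theorem mate_mate : ∀ {t : Tree}, t.WF → ∀ y, t.mate (t.mate y) = y
  | leaf, _, y => rfl
  | node s p ch, h, y => by
    have hch : ∀ q, (ch q).WF := fun q => by
      rcases h.2 q with h | h
      · rw [h]; trivial
      · exact h.2
    induction y using pearl_cases with
    | h1 q =>
      cases hr : (ch q).root with
      | none => rw [mate_top_none hr, mate_top_none hr]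
      | some y => rw [mate_top_some hr, mate_lift_root hr]
    | h2 q y =>
      by_cases hr : (ch q).root = some y
      · rw [mate_lift_root hr, mate_top_some hr]
      · have := mate_mate (hch q)
        rw [mate_lift hr, mate_lift (mate_ne_root (hch q) this hr), this]

/-- The necklace graph of a tree. -/
noncomputable abbrev graph (t : Tree) (h : t.WF) : Graph t.Vtx where
  word := t.word
  mate := t.mate
  mate_mate := mate_mate h

instance fintypeVtx : ∀ t : Tree, Finite t.Vtx
  | leaf => inferInstanceAs (Finite Empty)
  | node s _ ch =>
    have := fun q => fintypeVtx (ch q)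
    inferInstanceAs (Finite (Option (Σ q : Pos s, (ch q).Vtx)))

/-- The multiset of the necklaces of a tree. -/
def necklaces : Tree → Multiset (List Letter)
  | leaf => 0
  | node s _ ch => s ::ₘ ∑ q, (ch q).necklaces

end Tree
end Necklace

/-! ### The incidence graph of a recursive description is a tree. -/

namespace Necklace

namespace Graph
variable {V : Type} (G : Graph V)

@[simp]
theorem incidence_inl_inl (v w : V) : ¬ G.incidence.Adj (.inl v) (.inl w) := by
  simp [incidence]

@[simp]
theorem incidence_inl_inr {v : V} {p : Pearl G.word} :
    G.incidence.Adj (.inl v) (.inr p) ↔ p.1 = v := by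
  simp [incidence]

@[simp]
theorem incidence_inr_inl {v : V} {p : Pearl G.word} :
    G.incidence.Adj (.inr p) (.inl v) ↔ p.1 = v := by
  simp [incidence]

@[simp]
theorem incidence_inr_inr {p q : Pearl G.word} :
    G.incidence.Adj (.inr p) (.inr q) ↔ p ≠ q ∧ G.mate p = q := by
  simp only [incidence, SimpleGraph.fromRel_adj, ne_eq, Sum.inr.injEq, and_congr_right_iff]
  refine fun _ => ⟨?_, Or.inl⟩
  rintro (h | h)
  · exact h
  · rw [← h, G.mate_mate]

end Graph

namespace Tree

section
variable {s : List Letter} {p : Option (Pos s)} {ch : Pos s → Tree}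

theorem WF.child (h : (node s p ch).WF) (q : Pos s) : (ch q).WF := by
  rcases h.2 q with h | h
  · rw [h]; trivial
  · exact h.2

theorem WF.root_ne_none (h : (node s p ch).WF) (q : Pos s) (hq : ch q ≠ leaf) :
    (ch q).root ≠ none := ((h.2 q).resolve_left hq).1

theorem WF.exists_root (h : (node s p ch).WF) (q : Pos s) (v : (ch q).Vtx) :
    ∃ y, (ch q).root = some y := by
  rw [← Option.ne_none_iff_exists']
  refine h.root_ne_none q fun e => ?_
  rw [e] at v
  exact v.elim

/-- The inclusion of the incidence graph of an attached tree. -/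
def liftHom (h : (node s p ch).WF) (q : Pos s) :
    ((ch q).graph (h.child q)).incidence →g ((node s p ch).graph h).incidence where
  toFun := Sum.map (fun v => some ⟨q, v⟩) (lift q)
  map_rel' := by
    rintro (v | y) (w | z) hyz
    · exact absurd hyz (Graph.incidence_inl_inl _ _ _)
    · rw [Graph.incidence_inl_inr] at hyz
      exact (Graph.incidence_inl_inr _).2 (by rw [← hyz]; rfl)
    · rw [Graph.incidence_inr_inl] at hyz
      exact (Graph.incidence_inr_inl _).2 (by rw [← hyz]; rfl)
    · rw [Graph.incidence_inr_inr] at hyz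
      refine (Graph.incidence_inr_inr _).2 ⟨fun e => hyz.1 (lift_injective q e), ?_⟩
      have hr : (ch q).root ≠ some y := fun hr => hyz.1 (by
        rw [← hyz.2]; exact (root_free (h.child q) hr).symm)
      exact (mate_lift hr).trans (congrArg _ hyz.2)

theorem adj_top (h : (node s p ch).WF) (q : Pos s) :
    ((node s p ch).graph h).incidence.Adj (.inl none) (.inr (top q)) :=
  (Graph.incidence_inl_inr _).2 rfl

theorem adj_top_lift (h : (node s p ch).WF) {q : Pos s} {y} (hy : (ch q).root = some y) :
    ((node s p ch).graph h).incidence.Adj (.inr (top q)) (.inr (lift q y)) :=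
  (Graph.incidence_inr_inr _).2 ⟨(lift_ne_top _ _ _).symm, mate_top_some hy⟩

theorem node_cases (P : (node s p ch).Vtx ⊕ Pearl (node s p ch).word → Prop) (h0 : P (.inl none))
    (h1 : ∀ q, P (.inr (top q))) (h2 : ∀ q x, P (Sum.map (fun v => some ⟨q, v⟩) (lift q) x)) :
    ∀ x, P x
  | .inl none => h0
  | .inl (some ⟨q, v⟩) => h2 q (.inl v)
  | .inr ⟨none, q⟩ => h1 q
  | .inr ⟨some ⟨q, v⟩, i⟩ => h2 q (.inr ⟨v, i⟩)

/-- The edges of the incidence graph of `node s p ch`. -/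
theorem edge_cases (h : (node s p ch).WF)
    (P : (node s p ch).Vtx ⊕ Pearl (node s p ch).word → (node s p ch).Vtx ⊕ Pearl (node s p ch).word → Prop)
    (hs : ∀ x y, P x y → P y x)
    (h1 : ∀ q, P (.inl none) (.inr (top q)))
    (h2 : ∀ q y, (ch q).root = some y → P (.inr (top q)) (.inr (lift q y)))
    (h3 : ∀ q x y, ((ch q).graph (h.child q)).incidence.Adj x y →
      P (liftHom h q x) (liftHom h q y)) :
    ∀ x y, ((node s p ch).graph h).incidence.Adj x y → P x y := by
  have key1 : ∀ v (y : Pearl (node s p ch).word), y.1 = v → P (.inl v) (.inr y) := by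
    rintro _ y rfl
    induction y using pearl_cases with
    | h1 q => exact h1 q
    | h2 q y => exact h3 q (.inl y.1) (.inr y) ((Graph.incidence_inl_inr _).2 rfl)
  rintro (v | y) (w | z) hyz
  · exact absurd hyz (Graph.incidence_inl_inl _ _ _)
  · exact key1 _ _ ((Graph.incidence_inl_inr _).1 hyz)
  · exact hs _ _ (key1 _ _ ((Graph.incidence_inr_inl _).1 hyz))
  · obtain ⟨hne, hm⟩ := (Graph.incidence_inr_inr _).1 hyz
    change (node s p ch).mate y = z at hm
    induction y using pearl_cases with
    | h1 q =>
      cases hr : (ch q).root with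
      | none => exact absurd (by rw [← hm, mate_top_none hr]) hne
      | some y =>
        rw [mate_top_some hr] at hm
        subst hm
        exact h2 q y hr
    | h2 q y =>
      by_cases hr : (ch q).root = some y
      · rw [mate_lift_root hr] at hm
        subst hm
        exact hs _ _ (h2 q y hr)
      · rw [mate_lift hr] at hm
        subst hm
        exact h3 q (.inr y) (.inr ((ch q).mate y)) ((Graph.incidence_inr_inr _).2
          ⟨fun e => hne (congrArg _ e), rfl⟩)

end

theorem preconnected : ∀ {t : Tree} (h : t.WF), (t.graph h).incidence.Preconnected
  | leaf, _ => fun x => x.elim (fun v => v.elim) fun y => y.1.elim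
  | node s p ch, h => by
    have key : ∀ x, ((node s p ch).graph h).incidence.Reachable (.inl none) x := by
      intro x
      induction x using node_cases with
      | h0 => rfl
      | h1 q => exact (adj_top h q).reachable
      | h2 q x =>
        obtain ⟨y, hy⟩ := h.exists_root q (x.elim id fun y => y.1)
        refine ((adj_top h q).reachable.trans (adj_top_lift h hy).reachable).trans ?_
        exact (preconnected (h.child q) (.inr y) x).map (liftHom h q)
    exact fun x y => (key x).symm.trans (key y)

/-- The root of the incidence graph: the root pearl, or the necklace at the top. -/
def rootNode : ∀ t : Tree, Option (t.Vtx ⊕ Pearl t.word)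
  | leaf => none
  | node _ p _ => some (p.elim (.inl none) fun q => .inr (top q))

theorem rootNode_eq {t : Tree} {y} (h : t.root = some y) : t.rootNode = some (.inr y) := by
  cases t with
  | leaf => cases h
  | node s p ch =>
    cases p with
    | none => cases h
    | some q => cases h; rfl

/-- The map sends each node other than the root node to the edge towards its parent. That every edge
arises in this way bounds the number of edges by the number of nodes minus one. -/
theorem exists_edge_map : ∀ {t : Tree} (h : t.WF),
    ∃ f : t.Vtx ⊕ Pearl t.word → Sym2 (t.Vtx ⊕ Pearl t.word),
      ∀ x y, (t.graph h).incidence.Adj x y → ∃ z, t.rootNode ≠ some z ∧ f z = s(x, y)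
  | leaf, _ => ⟨fun x => s(x, x), fun x => x.elim (fun v => v.elim) fun y => y.1.elim⟩
  | node s p ch, h => by
    classical
    choose f hf using fun q => exists_edge_map (h.child q)
    let f' : (node s p ch).Vtx ⊕ Pearl (node s p ch).word →
        Sym2 ((node s p ch).Vtx ⊕ Pearl (node s p ch).word)
      | .inl none => s(.inl none, p.elim (.inl none) fun q => .inr (top q))
      | .inl (some ⟨q, v⟩) => (f q (.inl v)).map (liftHom h q)
      | .inr ⟨none, q⟩ => s(.inl none, .inr (top q))
      | .inr ⟨some ⟨q, v⟩, i⟩ => if (ch q).root = some ⟨v, i⟩ then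
          s(.inr (top q), .inr (lift q ⟨v, i⟩)) else (f q (.inr ⟨v, i⟩)).map (liftHom h q)
    refine ⟨f', edge_cases h _ (fun x y hxy => by rwa [Sym2.eq_swap (a := y)]) (fun q => ?_) ?_ ?_⟩
    -- If `top q` is the root node, then it is the parent of the top necklace, and the edge between
    -- them is assigned to the necklace. Otherwise that edge belongs to the pearl.
    · by_cases hp : p = some q
      · subst hp
        exact ⟨.inl none, by simp [rootNode], rfl⟩
      · refine ⟨.inr (top q), ?_, rfl⟩
        cases p with
        | none => simp [rootNode]
        | some q' =>
          simp only [rootNode, Option.elim_some, ne_eq, Option.some.injEq, Sum.inr.injEq, top_inj]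
          exact fun e => hp (by rw [e])
    · intro q y hy
      refine ⟨.inr (lift q y), ?_, if_pos hy⟩
      cases p with
      | none => simp [rootNode]
      | some q' =>
        simp only [rootNode, Option.elim_some, ne_eq, Option.some.injEq, Sum.inr.injEq]
        exact (lift_ne_top _ _ _).symm
    · intro q x y hxy
      obtain ⟨z, hz, e⟩ := hf q x y hxy
      refine ⟨liftHom h q z, ?_, ?_⟩
      · cases p with
        | none =>
          rcases z with v | z
          · exact fun e => nomatch Sum.inl.inj (Option.some.inj e)
          · exact fun e => nomatch Option.some.inj e
        | some q' =>
          rcases z with v | z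
          · exact fun e => nomatch Option.some.inj e
          · exact fun e => lift_ne_top _ _ _ (Sum.inr.inj (Option.some.inj e)).symm
      · rcases z with v | z
        · exact congrArg _ e
        · refine Eq.trans (if_neg fun hr => hz (rootNode_eq hr)) (congrArg _ e)

/-- Acyclicity comes from counting: the graph is connected, and `exists_edge_map` leaves it no more
edges than a spanning tree has. -/
theorem isTree {s : List Letter} {p : Option (Pos s)} {ch : Pos s → Tree} (h : (node s p ch).WF) :
    ((node s p ch).graph h).incidence.IsTree := by
  have : Nonempty ((node s p ch).Vtx ⊕ Pearl (node s p ch).word) := ⟨.inl none⟩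
  have hc : ((node s p ch).graph h).incidence.Connected := ⟨preconnected h⟩
  rw [SimpleGraph.isTree_iff_connected_and_card]
  refine ⟨hc, le_antisymm ?_ hc.card_vert_le_card_edgeSet_add_one⟩
  obtain ⟨f, hf⟩ := exists_edge_map h
  set r := p.elim (Sum.inl none) fun q => Sum.inr (top (p := p) (ch := ch) q) with hr
  have hsub : ((node s p ch).graph h).incidence.edgeSet ⊆ f '' {r}ᶜ := by
    intro e
    induction e with
    | h x y =>
      intro hxy
      obtain ⟨z, hz, e⟩ := hf x y hxy
      exact ⟨z, fun hzr => hz (by rw [hzr]; rfl), e⟩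
  have h1 := Set.ncard_le_ncard hsub (Set.toFinite _)
  have h2 := Set.ncard_image_le (f := f) (Set.toFinite {r}ᶜ)
  have h3 := Set.ncard_add_ncard_compl {r}
  rw [Set.ncard_singleton] at h3
  rw [← Nat.card_coe_set_eq] at h1
  exact (Nat.add_le_add_right (h1.trans h2) 1).trans ((add_comm _ _).trans h3).le

end Tree
end Necklace

/-! ### Invariance of the defining properties under isomorphism of necklace graphs. -/

namespace Necklace

namespace Graph

variable {V W : Type} {G : Graph V} {H : Graph W}

theorem kind_mapPearl (σ : V → W) (hσ : ∀ v, H.word (σ v) = G.word v) (p : Pearl G.word) :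
    H.kind (mapPearl σ hσ p) = G.kind p := by
  rcases p with ⟨v, _ | i⟩
  · rfl
  · simp only [kind, mapPearl, Option.map_some, Option.some.injEq, List.get_eq_getElem, Fin.val_cast]
    exact List.getElem_of_eq (hσ v) _

theorem mapPearl_inj (σ : V → W) (hσ : ∀ v, H.word (σ v) = G.word v) {p q : Pearl G.word}
    (h : σ p.1 = σ q.1 → p.1 = q.1) (hpq : mapPearl (H := H) σ hσ p = mapPearl σ hσ q) : p = q := by
  obtain ⟨v, i⟩ := p
  obtain ⟨w, j⟩ := q
  obtain ⟨h1, h2⟩ := Sigma.mk.inj_iff.1 hpq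
  cases h h1
  exact Sigma.ext rfl (heq_of_eq (Option.map_injective (Fin.cast_injective _) (eq_of_heq h2)))

theorem mapPearl_injective {σ : V → W} (h : Function.Injective σ)
    (hσ : ∀ v, H.word (σ v) = G.word v) : Function.Injective (mapPearl (H := H) σ hσ) :=
  fun _ _ => mapPearl_inj σ hσ (fun e => h e)

theorem exists_mapPearl (σ : V → W) (hσ : ∀ v, H.word (σ v) = G.word v) (v : V)
    (j : Pos (H.word (σ v))) : ∃ i, mapPearl (H := H) σ hσ ⟨v, i⟩ = ⟨σ v, j⟩ := by
  refine ⟨j.map (Fin.cast (congrArg List.length (hσ v))), ?_⟩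
  cases j <;> rfl

theorem mapPearl_surjective {σ : V → W} (h : Function.Surjective σ)
    (hσ : ∀ v, H.word (σ v) = G.word v) : Function.Surjective (mapPearl (H := H) σ hσ) := by
  rintro ⟨w, j⟩
  obtain ⟨v, rfl⟩ := h w
  obtain ⟨i, hi⟩ := exists_mapPearl σ hσ v j
  exact ⟨_, hi⟩

/-- An isomorphism of necklace graphs. -/
structure Iso (G : Graph V) (H : Graph W) where
  toEquiv : V ≃ W
  word_eq : ∀ v, H.word (toEquiv v) = G.word v
  map_mate : ∀ p, mapPearl toEquiv word_eq (G.mate p) = H.mate (mapPearl toEquiv word_eq p)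

namespace Iso

/-- The bijection between pearls induced by an isomorphism. -/
noncomputable def pearl (f : G.Iso H) : Pearl G.word ≃ Pearl H.word :=
  Equiv.ofBijective (mapPearl f.toEquiv f.word_eq)
    ⟨mapPearl_injective f.toEquiv.injective _, mapPearl_surjective f.toEquiv.surjective _⟩

@[simp] theorem fst_pearl (f : G.Iso H) (p : Pearl G.word) : (f.pearl p).1 = f.toEquiv p.1 := rfl

@[simp] theorem mate_pearl (f : G.Iso H) (p : Pearl G.word) : H.mate (f.pearl p) = f.pearl (G.mate p) :=
  (f.map_mate p).symm

@[simp] theorem kind_pearl (f : G.Iso H) (p : Pearl G.word) : H.kind (f.pearl p) = G.kind p :=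
  kind_mapPearl _ f.word_eq _

@[simp] theorem free_pearl (f : G.Iso H) (p : Pearl G.word) : H.Free (f.pearl p) ↔ G.Free p := by
  simp [Free]

/-- The induced isomorphism of incidence graphs. -/
noncomputable def incidence (f : G.Iso H) : G.incidence ≃g H.incidence where
  toEquiv := Equiv.sumCongr f.toEquiv f.pearl
  map_rel_iff' := by
    rintro (v | p) (w | q) <;> simp

theorem isTree_iff (f : G.Iso H) : G.incidence.IsTree ↔ H.incidence.IsTree := f.incidence.isTree_iff

theorem word_mem_iff (f : G.Iso H) (Q : Set (List Letter)) : (∀ w, H.word w ∈ Q) ↔ ∀ v, G.word v ∈ Q := by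
  simp [f.toEquiv.surjective.forall, f.word_eq]

/-- Subtrees are defined by walks, and an isomorphism transports walks in both directions. -/
theorem mem_subtree (f : G.Iso H) (r x y : Pearl G.word) :
    f.pearl y ∈ H.subtree (f.pearl r) (f.pearl x) ↔ y ∈ G.subtree r x := by
  constructor
  · intro h w
    obtain ⟨z, hz, e⟩ := List.mem_map.1
      ((congrArg (Sum.inr (f.pearl x) ∈ ·)
        (SimpleGraph.Walk.support_map f.incidence.toHom w)).mp (h (w.map f.incidence.toHom)))
    have : z = .inr x := f.incidence.injective e
    rwa [← this]
  · intro h w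
    have h2 := h ((w.map f.incidence.symm.toHom).copy
      (f.incidence.symm_apply_apply (.inr r)) (f.incidence.symm_apply_apply (.inr y)))
    obtain ⟨z, hz, e⟩ := List.mem_map.1 ((congrArg (Sum.inr x ∈ ·)
      ((SimpleGraph.Walk.support_copy _ _ _).trans
        (SimpleGraph.Walk.support_map f.incidence.symm.toHom w))).mp h2)
    have : z = .inr (f.pearl x) := f.incidence.symm.injective
      (e.trans (f.incidence.symm_apply_apply (.inr x)).symm)
    rwa [← this]

theorem excess_eq (f : G.Iso H) (r x : Pearl G.word) : H.excess (f.pearl r) (f.pearl x) = G.excess r x := by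
  have key : ∀ k, {y ∈ H.subtree (f.pearl r) (f.pearl x) | H.kind y = k}.ncard =
      {y ∈ G.subtree r x | G.kind y = k}.ncard := fun k => by
    rw [← Set.ncard_image_of_injective _ f.pearl.injective]
    congr 1
    ext y
    obtain ⟨y, rfl⟩ := f.pearl.surjective y
    simp [mem_subtree]
  simp only [excess, key]

theorem edgesOfType_iff (f : G.Iso H) (l : List (Kind × Kind)) : H.EdgesOfType l ↔ G.EdgesOfType l := by
  simp [EdgesOfType, f.pearl.surjective.forall]

theorem isQTree_iff (f : G.Iso H) (Q : Set (List Letter)) (r : Pearl G.word) :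
    H.IsQTree Q (f.pearl r) ↔ G.IsQTree Q r := by
  constructor
  · rintro ⟨h1, h2, h3, h4, h5⟩
    refine ⟨f.isTree_iff.2 h1, (f.word_mem_iff Q).1 h2, (f.edgesOfType_iff _).1 h3, by simpa using h4,
      fun p => by simpa using h5 (f.pearl p)⟩
  · rintro ⟨h1, h2, h3, h4, h5⟩
    refine ⟨f.isTree_iff.1 h1, (f.word_mem_iff Q).2 h2, (f.edgesOfType_iff _).2 h3, by simpa using h4,
      f.pearl.surjective.forall.2 fun p => by simpa using h5 p⟩

theorem isNonnegQTree_iff (f : G.Iso H) (Q : Set (List Letter)) (r : Pearl G.word) :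
    H.IsNonnegQTree Q (f.pearl r) ↔ G.IsNonnegQTree Q r := by
  simp [IsNonnegQTree, f.isQTree_iff, f.pearl.surjective.forall, f.excess_eq]

theorem isCompanion_iff (f : G.Iso H) (Q : Set (List Letter)) : H.IsCompanion Q ↔ G.IsCompanion Q :=
  ⟨fun ⟨h1, h2, h3⟩ => ⟨f.isTree_iff.2 h1, (f.word_mem_iff Q).1 h2, (f.edgesOfType_iff _).1 h3⟩,
    fun ⟨h1, h2, h3⟩ => ⟨f.isTree_iff.1 h1, (f.word_mem_iff Q).2 h2, (f.edgesOfType_iff _).2 h3⟩⟩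

theorem isRootedCompanion_iff (f : G.Iso H) (Q : Set (List Letter)) (r : Pearl G.word) :
    H.IsRootedCompanion Q (f.pearl r) ↔ G.IsRootedCompanion Q r := by
  constructor
  · rintro ⟨h1, h2, h3⟩
    exact ⟨(f.isCompanion_iff Q).1 h1, by simpa using h2, fun p => by simpa using h3 (f.pearl p)⟩
  · rintro ⟨h1, h2, h3⟩
    exact ⟨(f.isCompanion_iff Q).2 h1, by simpa using h2,
      f.pearl.surjective.forall.2 fun p => by simpa using h3 p⟩

theorem isUnrootedCompanion_iff (f : G.Iso H) (Q : Set (List Letter)) :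
    H.IsUnrootedCompanion Q ↔ G.IsUnrootedCompanion Q := by
  constructor
  · rintro ⟨h1, h3⟩
    exact ⟨(f.isCompanion_iff Q).1 h1, fun p => by simpa using h3 (f.pearl p)⟩
  · rintro ⟨h1, h3⟩
    exact ⟨(f.isCompanion_iff Q).2 h1, f.pearl.surjective.forall.2 fun p => by simpa using h3 p⟩

theorem isDefect_iff (f : G.Iso H) (r : Option (Pearl G.word)) (p : Pearl G.word) :
    H.IsDefect (r.map f.pearl) (f.pearl p) ↔ G.IsDefect r p := by
  cases r <;> simp [IsDefect]

end Iso

end Graph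

end Necklace

/-! ### Distances and branches in a tree of necklaces. -/

namespace Necklace

/-- Uniqueness of parents: a neighbour of `x` closer to `o` must be the penultimate vertex of the
path from `o` to `x`. -/
theorem eq_of_adj_of_dist_lt {X : Type*} {Γ : SimpleGraph X} (hΓ : Γ.IsTree) (o : X) {x a b : X}
    (ha : Γ.Adj x a) (hb : Γ.Adj x b) (da : Γ.dist o a < Γ.dist o x) (db : Γ.dist o b < Γ.dist o x) :
    a = b := by
  obtain ⟨p, hp, hp'⟩ := hΓ.connected.exists_path_of_dist o x
  have key : ∀ c, Γ.Adj x c → Γ.dist o c < Γ.dist o x → c = p.penultimate := by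
    intro c hc dc
    refine hΓ.isAcyclic.eq_penultimate_of_adj_end hp hc ?_
    obtain ⟨q, hq, hq'⟩ := hΓ.connected.exists_path_of_dist o c
    refine hΓ.isAcyclic.mem_support_of_ne_mem_support_of_adj_of_isPath hp hq hc fun hx => ?_
    have := congrArg SimpleGraph.Walk.length (hΓ.isAcyclic.path_concat hp hq hc hx)
    rw [SimpleGraph.Walk.length_concat] at this
    omega
  rw [key a ha da, key b hb db]

namespace Graph

variable {V W : Type} {G : Graph V} {H : Graph W}

/-- A map that preserves words and edges is surjective onto a connected graph. -/
theorem surjective_of_map_mate [Nonempty V] (hH : H.incidence.Preconnected) (φ : V → W)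
    (hφ : ∀ v, H.word (φ v) = G.word v)
    (hm : ∀ p, mapPearl φ hφ (G.mate p) = H.mate (mapPearl φ hφ p)) : Function.Surjective φ := by
  intro w
  obtain ⟨v₀⟩ := ‹Nonempty V›
  let P : W ⊕ Pearl H.word → Prop := Sum.elim (· ∈ Set.range φ) (·.1 ∈ Set.range φ)
  have key : ∀ x y, H.incidence.Adj x y → P x → P y := by
    rintro (v | ⟨v, i⟩) (w | ⟨w, j⟩) hxy hx
    · exact absurd hxy (Graph.incidence_inl_inl _ _ _)
    · rw [incidence_inl_inr] at hxy
      cases hxy; exact hx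
    · rw [incidence_inr_inl] at hxy
      cases hxy; exact hx
    · rw [incidence_inr_inr] at hxy
      obtain ⟨v, rfl⟩ := hx
      obtain ⟨i, hi⟩ := exists_mapPearl φ hφ v i
      rw [← hi, ← hm] at hxy
      exact ⟨_, congrArg Sigma.fst hxy.2⟩
  obtain ⟨p⟩ := hH (.inl (φ v₀)) (.inl w)
  have : ∀ x y, H.incidence.Walk x y → P x → P y := fun x y p => by
    induction p with
    | nil => exact id
    | cons h _ ih => exact fun hx => ih (key _ _ h hx)
  exact this _ _ p ⟨v₀, rfl⟩

variable (G) in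
/-- The pearl is farther from the necklace `o` than its own necklace. -/
def Down (o : V) (y : Pearl G.word) : Prop :=
  G.incidence.dist (.inl o) (.inl y.1) < G.incidence.dist (.inl o) (.inr y)

variable (G) in
/-- The necklaces that are reached by moving away from `o` through the edge at a pearl. -/
inductive Below (o : V) : Pearl G.word → V → Prop
  | base {y} : ¬ G.Free y → Below o y (G.mate y).1
  | step {y z} : Below o y z.1 → G.Down o z → ¬ G.Free z → Below o y (G.mate z).1

section
variable (hG : G.incidence.IsTree) {o : V}
include hG

/-- In a tree, adjacent nodes never lie at the same distance from `o`, so one of the two strict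
inequalities holds. -/
theorem dist_lt_of_not_down {y : Pearl G.word} (h : ¬ G.Down o y) :
    G.incidence.dist (.inl o) (.inr y) < G.incidence.dist (.inl o) (.inl y.1) := by
  have := hG.dist_ne_of_adj (.inl o) ((incidence_inl_inr G (p := y)).2 rfl)
  simp only [Down] at h
  omega

theorem down_self (q) : G.Down o ⟨o, q⟩ := by
  have := hG.dist_ne_of_adj (.inl o) ((incidence_inl_inr G (p := ⟨o, q⟩)).2 rfl)
  rw [SimpleGraph.dist_self] at this
  simp only [Down, SimpleGraph.dist_self]
  omega

/-- The parent of a `Down` pearl is its own necklace. By uniqueness of parents its mate is farther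
from `o`, and then so is the necklace of the mate. -/
theorem Down.mate {y : Pearl G.word} (h : G.Down o y) (hy : ¬ G.Free y) :
    ¬ G.Down o (G.mate y) ∧
      G.incidence.dist (.inl o) (.inl y.1) < G.incidence.dist (.inl o) (.inl (G.mate y).1) := by
  have a1 : G.incidence.Adj (.inr y) (.inl y.1) := (incidence_inr_inl G).2 rfl
  have a2 : G.incidence.Adj (.inr y) (.inr (G.mate y)) :=
    (incidence_inr_inr G).2 ⟨fun e => hy e.symm, rfl⟩
  have a3 : G.incidence.Adj (.inr (G.mate y)) (.inl (G.mate y).1) := (incidence_inr_inl G).2 rfl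
  have d2 := hG.dist_ne_of_adj (.inl o) a2
  have l2 : G.incidence.dist (.inl o) (.inr y) < G.incidence.dist (.inl o) (.inr (G.mate y)) := by
    by_contra hl
    exact Sum.inl_ne_inr (eq_of_adj_of_dist_lt hG (.inl o) a1 a2 h (by omega))
  have h3 : ¬ G.Down o (G.mate y) := fun h3 =>
    Sum.inl_ne_inr (eq_of_adj_of_dist_lt hG (.inl o) a3 a2.symm h3 l2)
  have := dist_lt_of_not_down hG h3
  simp only [Down] at h
  exact ⟨h3, by omega⟩

/-- A pearl that is not `Down` is the parent of its necklace, and a necklace has only one parent. -/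
theorem eq_of_not_down {y z : Pearl G.word} (hy : ¬ G.Down o y) (hz : ¬ G.Down o z) (h : y.1 = z.1) :
    y = z := by
  refine Sum.inr_injective (eq_of_adj_of_dist_lt hG (.inl o) (x := .inl y.1)
    ((incidence_inl_inr G).2 rfl) ((incidence_inl_inr G).2 h.symm) (dist_lt_of_not_down hG hy) ?_)
  rw [h]
  exact dist_lt_of_not_down hG hz

theorem eq_of_mate_fst_eq {y z : Pearl G.word} (hy : G.Down o y) (hz : G.Down o z) (fy : ¬ G.Free y)
    (fz : ¬ G.Free z) (h : (G.mate y).1 = (G.mate z).1) : y = z := by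
  rw [← G.mate_mate y, ← G.mate_mate z,
    eq_of_not_down hG (hy.mate hG fy).1 (hz.mate hG fz).1 h]

theorem Below.dist_lt {y : Pearl G.word} {w : V} (h : G.Below o y w) (hy : G.Down o y) :
    G.incidence.dist (.inl o) (.inl y.1) < G.incidence.dist (.inl o) (.inl w) := by
  induction h with
  | base f => exact (hy.mate hG f).2
  | step _ hz f ih => exact ih.trans (hz.mate hG f).2

omit hG in
theorem Below.cases_last {y : Pearl G.word} {w : V} (h : G.Below o y w) (hy : G.Down o y) :
    ∃ z, G.Down o z ∧ ¬ G.Free z ∧ w = (G.mate z).1 ∧ (z = y ∨ G.Below o y z.1) := by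
  cases h with
  | base f => exact ⟨y, hy, f, rfl, .inl rfl⟩
  | step h hz f => exact ⟨_, hz, f, rfl, .inr h⟩

/-- Branches hanging from different pearls of one necklace are disjoint. The last edge leading to
`w` is unique, so it can be peeled off both chains; if one chain ends before the other, a necklace
would be strictly farther from `o` than itself. -/
theorem Below.eq {y z : Pearl G.word} {w : V} (h : G.Below o y w) (h' : G.Below o z w)
    (hy : G.Down o y) (hz : G.Down o z) (hyz : y.1 = z.1) : y = z := by
  induction h with
  | base f =>
    obtain ⟨x, hx, fx, e, hxz⟩ := h'.cases_last hz
    obtain rfl := eq_of_mate_fst_eq hG hy hx f fx e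
    rcases hxz with rfl | hb
    · rfl
    · have := hb.dist_lt hG hz
      rw [hyz] at this
      exact absurd this (lt_irrefl _)
  | step hb hz' f ih =>
    obtain ⟨x, hx, fx, e, hxz⟩ := h'.cases_last hz
    obtain rfl := eq_of_mate_fst_eq hG hz' hx f fx e
    rcases hxz with rfl | hb'
    · have := hb.dist_lt hG hy
      rw [hyz] at this
      exact absurd this (lt_irrefl _)
    · exact ih hb'

end

theorem Below.trans {o : V} {y z : Pearl G.word} {w : V} (h : G.Below o y z.1) (hz : G.Down o z)
    (h' : G.Below o z w) : G.Below o y w := by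
  induction h' with
  | base f => exact h.step hz f
  | step _ hz' f ih => exact ih.step hz' f

end Graph
end Necklace

/-! ### Unfolding a finite tree of necklaces into a recursive description, and its uniqueness. -/

namespace Necklace

open Necklace.Graph

namespace Tree

variable {V : Type} {G : Graph V}

section
variable {s : List Letter} {p : Option (Pos s)} {ch : Pos s → Tree}

/-- The map on the necklaces of a tree that is given by maps on the attached trees. -/
def glue (v : V) (φ : ∀ q, (ch q).Vtx → V) : (node s p ch).Vtx → V
  | none => v
  | some x => φ x.1 x.2

theorem word_glue {v : V} {φ : ∀ q, (ch q).Vtx → V} (hv : G.word v = s)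
    (hφ : ∀ q y, G.word (φ q y) = (ch q).word y) :
    ∀ x, G.word (glue (p := p) v φ x) = (node s p ch).word x
  | none => hv
  | some x => hφ x.1 x.2

theorem injective_glue {v : V} {φ : ∀ q, (ch q).Vtx → V} (h1 : ∀ q x, φ q x ≠ v)
    (h2 : ∀ q q' x x', φ q x = φ q' x' → q = q') (h3 : ∀ q, Function.Injective (φ q)) :
    Function.Injective (glue (p := p) v φ)
  | none, none, _ => rfl
  | none, some _, e => absurd e.symm (h1 _ _)
  | some _, none, e => absurd e (h1 _ _)
  | some ⟨q, x⟩, some ⟨q', x'⟩, e => by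
    obtain rfl := h2 _ _ _ _ e
    exact congrArg (fun x => some (Sigma.mk q x)) (h3 q e)

theorem mapPearl_lift (h : (node s p ch).WF) (φ : (node s p ch).Vtx → V)
    (hφ : ∀ x, G.word (φ x) = (node s p ch).word x) (q : Pos s) (y : Pearl (ch q).word) :
    mapPearl (G := (node s p ch).graph h) φ hφ (lift q y) =
      mapPearl (G := (ch q).graph (h.child q)) (fun x => φ (some ⟨q, x⟩)) (fun _ => hφ _) y := by
  rcases y with ⟨v, _ | i⟩ <;> rfl

end

/-- A map from the tree `t` to `G` that preserves words, and edges except at the root pearl. -/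
structure Immersion (t : Tree) (h : t.WF) (G : Graph V) where
  toFun : t.Vtx → V
  word_eq : ∀ x, G.word (toFun x) = t.word x
  map_mate : ∀ y, t.root ≠ some y →
    mapPearl (G := t.graph h) toFun word_eq (t.mate y) =
      G.mate (mapPearl (G := t.graph h) toFun word_eq y)

/-- The image of a pearl. -/
noncomputable def Immersion.pearl {t : Tree} {h : t.WF} (f : t.Immersion h G) (y : Pearl t.word) : Pearl G.word :=
  mapPearl (G := t.graph h) f.toFun f.word_eq y

theorem heq_map_cast {m n : ℕ} (e : m = n) (q : Option (Fin m)) : q.map (Fin.cast e) ≍ q := by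
  subst e
  cases q <;> rfl

theorem Immersion.pearl_top {v : V} {p : Option (Pos (G.word v))} {ch : Pos (G.word v) → Tree}
    {h : (node (G.word v) p ch).WF} (f : (node (G.word v) p ch).Immersion h G) (hf : f.toFun none = v)
    (q : Pos (G.word v)) : f.pearl (top q) = ⟨v, q⟩ :=
  Sigma.ext hf (heq_map_cast _ q)

/-- The empty immersion. -/
noncomputable def Immersion.leaf : Tree.leaf.Immersion trivial G := ⟨Empty.elim, Empty.rec, fun y => y.1.elim⟩

/-- Grafts the descriptions of the branches at `v`. The glued map is injective because necklaces in
a branch are strictly farther from `o` than `v`, and different branches are disjoint by `Below.eq`.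
-/
theorem exists_immersion_step (hG : G.incidence.IsTree) (o v : V) (p : Option (Pos (G.word v)))
    (hp : ∀ q, some q ≠ p → G.Down o ⟨v, q⟩)
    (H : ∀ q, ∃ t : Tree, ∃ (h : t.WF) (f : t.Immersion h G), Function.Injective f.toFun ∧
      (∀ x, G.Below o ⟨v, q⟩ (f.toFun x)) ∧
      ((t = leaf ∧ (some q = p ∨ G.Free ⟨v, q⟩)) ∨
        (some q ≠ p ∧ ∃ r, t.root = some r ∧ f.pearl r = G.mate ⟨v, q⟩))) :
    ∃ (ch : Pos (G.word v) → Tree) (h : (node (G.word v) p ch).WF)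
      (f : (node (G.word v) p ch).Immersion h G),
      Function.Injective f.toFun ∧ f.toFun none = v ∧
      ∀ x, ∃ q, some q ≠ p ∧ G.Below o ⟨v, q⟩ (f.toFun (some x)) := by
  choose ch hch f hinj hbel hcase using H
  have hne : ∀ q (x : (ch q).Vtx), some q ≠ p := fun q x => by
    rcases hcase q with ⟨h, -⟩ | h
    · rw [h] at x; exact x.elim
    · exact h.1
  have hwf : (node (G.word v) p ch).WF := by
    refine ⟨fun q hq => ?_, fun q => ?_⟩
    · rcases hcase q with h | h
      · exact h.1
      · exact absurd hq.symm h.1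
    · rcases hcase q with h | ⟨_, r, h, _⟩
      · exact .inl h.1
      · exact .inr ⟨by simp [h], hch q⟩
  have hword : ∀ x, G.word (glue (p := p) v (fun q => (f q).toFun) x) = (node (G.word v) p ch).word x :=
    word_glue rfl fun q x => (f q).word_eq x
  have htop : ∀ q, mapPearl (G := (node (G.word v) p ch).graph hwf) (H := G) _ hword (top q) = ⟨v, q⟩ := by
    rintro (_ | i) <;> rfl
  have hlift : ∀ q y, mapPearl (G := (node (G.word v) p ch).graph hwf) (H := G) _ hword (lift q y) =
      (f q).pearl y := fun q y => mapPearl_lift _ _ _ _ _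
  refine ⟨ch, hwf, ⟨glue v fun q => (f q).toFun, hword, fun y hy => ?_⟩, ?_, rfl, ?_⟩
  · induction y using pearl_cases with
    | h1 q =>
      rw [htop]
      have hq : some q ≠ p := by
        rintro rfl; exact hy rfl
      rcases hcase q with ⟨h, h'⟩ | ⟨_, r, h, h'⟩
      · rw [mate_top_none (by rw [h]; rfl), htop]
        exact (h'.resolve_left hq).symm
      · rw [mate_top_some h, hlift, h']
    | h2 q y =>
      by_cases hr : (ch q).root = some y
      · rw [mate_lift_root hr, htop, hlift]
        rcases hcase q with ⟨h, -⟩ | ⟨_, r, h, h'⟩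
        · exact absurd (hr.symm.trans (by rw [h]; rfl)) (Option.some_ne_none y)
        · cases h.symm.trans hr
          rw [h', G.mate_mate]
      · rw [mate_lift hr, hlift, hlift]
        exact (f q).map_mate y hr
  · refine injective_glue (fun q x e => ?_) (fun q q' x x' e => ?_) hinj
    · have := (hbel q x).dist_lt hG (hp q (hne q x))
      rw [e] at this
      exact lt_irrefl _ this
    · have h1 := hbel q x
      rw [e] at h1
      have := h1.eq hG (hbel q' x') (hp q (hne q x)) (hp q' (hne q' x')) rfl
      injection this
  · rintro ⟨q, x⟩
    exact ⟨q, hne q x, hbel q x⟩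

theorem down_of_ne (hG : G.incidence.IsTree) {o : V} {m : Pearl G.word} (hm : ¬ G.Down o m)
    {q : Pos (G.word m.1)} (hq : q ≠ m.2) : G.Down o ⟨m.1, q⟩ := by
  obtain ⟨w, i⟩ := m
  by_contra hnd
  cases eq_of_not_down hG hm hnd rfl
  exact hq rfl

/-- Induction from the farthest necklaces towards `o`; finiteness of `V` makes the reversed distance
well founded. The necklace across an edge is described with the mate as its root pearl, and this is
the only pearl there that points back to `o`. -/
theorem exists_immersion [Finite V] (hG : G.incidence.IsTree) (o : V) (v : V) :
    ∀ (p : Option (Pos (G.word v))), (∀ q, some q ≠ p → G.Down o ⟨v, q⟩) →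
    ∃ (ch : Pos (G.word v) → Tree) (h : (node (G.word v) p ch).WF)
      (f : (node (G.word v) p ch).Immersion h G),
      Function.Injective f.toFun ∧ f.toFun none = v ∧
      ∀ x, ∃ q, some q ≠ p ∧ G.Below o ⟨v, q⟩ (f.toFun (some x)) := by
  let d := fun v => G.incidence.dist (.inl o) (.inl v)
  have wf : WellFounded fun w v => d v < d w := by
    have : IsTrans V fun w v => d v < d w := ⟨fun a b c h1 h2 => lt_trans h2 h1⟩
    have : Std.Irrefl fun w v => d v < d w := ⟨fun a => lt_irrefl _⟩
    exact Finite.wellFounded_of_trans_of_irrefl _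
  induction v using wf.induction with
  | _ v ih =>
  intro p hp
  refine exists_immersion_step hG o v p hp fun q => ?_
  by_cases hq : some q = p ∨ G.Free ⟨v, q⟩
  · exact ⟨leaf, trivial, Immersion.leaf, fun x => x.elim, fun x => x.elim, .inl ⟨rfl, hq⟩⟩
  · push Not at hq
    have hd := hp q hq.1
    obtain ⟨h1, h2⟩ := hd.mate hG hq.2
    obtain ⟨ch, h, f, hinj, hnone, hbel⟩ := ih (G.mate ⟨v, q⟩).1 h2 (some (G.mate ⟨v, q⟩).2)
      fun q' hq' => by
        exact down_of_ne hG h1 fun e => hq' (congrArg some e)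
    refine ⟨_, h, f, hinj, ?_, .inr ⟨hq.1, top _, rfl, ?_⟩⟩
    · rintro (_ | x)
      · rw [hnone]
        exact .base hq.2
      · obtain ⟨q', hq', hb⟩ := hbel x
        refine Below.trans (z := ⟨(G.mate ⟨v, q⟩).1, q'⟩) (.base hq.2) ?_ hb
        exact down_of_ne hG h1 fun e => hq' (congrArg some e)
    · exact f.pearl_top hnone _

/-- Every finite tree of necklaces is isomorphic to the graph of a `Tree`, with a given necklace at the top
and at most one given free root pearl on it. -/
theorem exists_iso [Finite V] (hG : G.incidence.IsTree) (v : V) (p : Option (Pos (G.word v)))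
    (hp : ∀ q, p = some q → G.Free ⟨v, q⟩) :
    ∃ (ch : Pos (G.word v) → Tree) (h : (node (G.word v) p ch).WF)
      (f : ((node (G.word v) p ch).graph h).Iso G),
      f.toEquiv none = v ∧ ∀ q, f.pearl (top q) = ⟨v, q⟩ := by
  obtain ⟨ch, h, f, hinj, hnone, -⟩ := exists_immersion hG v v p fun q _ => down_self hG q
  have hm : ∀ y, mapPearl (G := (node (G.word v) p ch).graph h) f.toFun f.word_eq
      ((node (G.word v) p ch).mate y) = G.mate (f.pearl y) := by
    intro y
    -- An immersion says nothing about the edge at the root pearl; there both sides are free, by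
    -- `root_free` and `hp`.
    by_cases hy : (node (G.word v) p ch).root = some y
    · rw [root_free h hy]
      cases p with
      | none => cases hy
      | some q =>
        cases hy
        exact (f.pearl_top hnone q).trans ((hp q rfl).symm.trans
          (congrArg G.mate (f.pearl_top hnone q).symm))
    · exact f.map_mate y hy
  have : Nonempty (node (G.word v) p ch).Vtx := ⟨none⟩
  have hsurj := surjective_of_map_mate (G := (node (G.word v) p ch).graph h)
    hG.connected.preconnected f.toFun f.word_eq hm
  exact ⟨ch, h, ⟨Equiv.ofBijective _ ⟨hinj, hsurj⟩, f.word_eq, hm⟩, hnone, fun q => f.pearl_top hnone q⟩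

section
variable {s : List Letter} {p p' : Option (Pos s)} {ch ch' : Pos s → Tree}

theorem Immersion.pearl_injective {t : Tree} {h : t.WF} {f : t.Immersion h G}
    (hf : Function.Injective f.toFun) : Function.Injective f.pearl :=
  mapPearl_injective (G := t.graph h) hf f.word_eq

theorem Immersion.pearl_top_eq {h : (node s p ch).WF} {h' : (node s p' ch').WF}
    (f : (node s p ch).Immersion h G) (f' : (node s p' ch').Immersion h' G)
    (e : f.toFun none = f'.toFun none) (q : Pos s) : f.pearl (top q) = f'.pearl (top q) :=
  Sigma.ext e ((heq_map_cast _ q).trans (heq_map_cast _ q).symm)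

/-- The restriction of an immersion to an attached tree. -/
noncomputable def Immersion.child {h : (node s p ch).WF} (f : (node s p ch).Immersion h G) (q : Pos s) :
    (ch q).Immersion (h.child q) G where
  toFun x := f.toFun (some ⟨q, x⟩)
  word_eq x := f.word_eq (some ⟨q, x⟩)
  map_mate y hy := by
    have := f.map_mate (lift q y) (by
      cases p with
      | none => exact nofun
      | some q' => exact fun e => lift_ne_top _ _ _ (Option.some.inj e).symm)
    rwa [mate_lift hy, mapPearl_lift, mapPearl_lift] at this

theorem Immersion.pearl_lift {h : (node s p ch).WF} (f : (node s p ch).Immersion h G) (q : Pos s)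
    (y : Pearl (ch q).word) : f.pearl (lift q y) = (f.child q).pearl y := mapPearl_lift _ _ _ _ _

theorem Immersion.child_injective {h : (node s p ch).WF} {f : (node s p ch).Immersion h G}
    (hf : Function.Injective f.toFun) (q : Pos s) : Function.Injective (f.child q).toFun := by
  intro x y e
  have := hf e
  injection this with this
  injection this

/-- With nothing attached at `q`, the corresponding pearl of `G` is free. A tree attached there in
the other description would put an edge of `G` at this free pearl. -/
theorem Immersion.not_root_of_leaf {h : (node s p ch).WF} {h' : (node s p' ch').WF}
    (f : (node s p ch).Immersion h G) (f' : (node s p' ch').Immersion h' G)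
    (hf' : Function.Injective f'.toFun) (e : f.toFun none = f'.toFun none) {q : Pos s}
    (hp : p ≠ some q) (hp' : p' ≠ some q) (hl : (ch q).root = none) (y) : (ch' q).root ≠ some y := by
  intro hy
  have h1 := f.map_mate (top q) (by cases p with
    | none => exact nofun
    | some q' => exact fun e => hp (congrArg some (top_inj.1 (Option.some.inj e))))
  have h2 := f'.map_mate (top q) (by cases p' with
    | none => exact nofun
    | some q' => exact fun e => hp' (congrArg some (top_inj.1 (Option.some.inj e))))
  rw [mate_top_none hl] at h1
  rw [mate_top_some hy] at h2
  change f.pearl _ = G.mate (f.pearl _) at h1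
  change f'.pearl _ = G.mate (f'.pearl _) at h2
  rw [← f.pearl_top_eq f' e, ← h1, f.pearl_top_eq f' e] at h2
  exact lift_ne_top _ _ _ (pearl_injective hf' h2)

end

/-- Two trees that are immersed in the same graph with the same top and root pearl are equal. -/
theorem eq_of_immersion : ∀ {t t' : Tree} {h : t.WF} {h' : t'.WF} (f : t.Immersion h G)
    (f' : t'.Immersion h' G), Function.Injective f.toFun → Function.Injective f'.toFun →
    t.rootNode.map (Sum.map f.toFun f.pearl) = t'.rootNode.map (Sum.map f'.toFun f'.pearl) →
    t = t'
  | leaf, leaf, _, _, _, _, _, _, _ => rfl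
  | leaf, node _ _ _, _, _, _, _, _, _, e => nomatch e
  | node _ _ _, leaf, _, _, _, _, _, _, e => nomatch e
  | node s p ch, node s' p' ch', h, h', f, f', hf, hf', e => by
    have hv : f.toFun none = f'.toFun none := by
      cases p <;> cases p'
      · exact Sum.inl.inj (Option.some.inj e)
      · exact nomatch Option.some.inj e
      · exact nomatch Option.some.inj e
      · exact congrArg Sigma.fst (Sum.inr.inj (Option.some.inj e))
    obtain rfl : s = s' := by
      have h1 := f.word_eq none
      rw [hv] at h1
      exact h1.symm.trans (f'.word_eq none)
    obtain rfl : p = p' := by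
      cases p <;> cases p'
      · rfl
      · exact nomatch Option.some.inj e
      · exact nomatch Option.some.inj e
      · have := Sum.inr.inj (Option.some.inj e)
        rw [f.pearl_top_eq f' hv] at this
        exact congrArg some (top_inj.1 (Immersion.pearl_injective hf' this))
    congr 1
    funext q
    by_cases hp : p = some q
    · rw [h.1 q hp, h'.1 q hp]
    cases hr : (ch q).root with
    | none =>
      have hl : ch q = leaf := by_contra fun hl => h.root_ne_none q hl hr
      have hl' : ch' q = leaf := by_contra fun hl' => by
        obtain ⟨y, hy⟩ := Option.ne_none_iff_exists'.1 (h'.root_ne_none q hl')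
        exact f.not_root_of_leaf f' hf' hv hp hp hr y hy
      rw [hl, hl']
    | some y =>
      cases hr' : (ch' q).root with
      | none => exact absurd hr (f'.not_root_of_leaf f hf hv.symm hp hp hr' y)
      | some y' =>
        refine eq_of_immersion (f.child q) (f'.child q) (Immersion.child_injective hf q)
          (Immersion.child_injective hf' q) ?_
        rw [rootNode_eq hr, rootNode_eq hr', Option.map_some, Option.map_some, Sum.map_inr, Sum.map_inr,
          ← f.pearl_lift, ← f'.pearl_lift]
        have hne : ∀ {ch : Pos s → Tree}, (node s p ch).root ≠ some (top q) := fun {ch} => by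
          cases p with
          | none => exact nofun
          | some q' => exact fun e => hp (congrArg some (top_inj.1 (Option.some.inj e)))
        have h1 := f.map_mate (top q) hne
        have h2 := f'.map_mate (top q) hne
        rw [mate_top_some hr] at h1
        rw [mate_top_some hr'] at h2
        change f.pearl _ = G.mate (f.pearl _) at h1
        change f'.pearl _ = G.mate (f'.pearl _) at h2
        rw [h1, h2, f.pearl_top_eq f' hv]

end Tree
end Necklace

/-! ### Decorated graphs modelled by recursive descriptions. -/

namespace Necklace

open Necklace.Graph

namespace Graph

variable {V W U : Type} {G : Graph V} {H : Graph W} {K : Graph U}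

theorem mapPearl_ext {σ : V → W} {hσ : ∀ v, H.word (σ v) = G.word v} {p : Pearl G.word}
    {q : Pearl H.word} (h1 : σ p.1 = q.1) (h2 : p.2 ≍ q.2) : mapPearl σ hσ p = q :=
  Sigma.ext h1 ((Tree.heq_map_cast _ _).trans h2)

namespace Iso

theorem symm_word_eq (f : G.Iso H) (w : W) : G.word (f.toEquiv.symm w) = H.word w := by
  rw [← f.word_eq, Equiv.apply_symm_apply]

theorem mapPearl_symm (f : G.Iso H) (p : Pearl H.word) :
    mapPearl f.toEquiv.symm f.symm_word_eq p = f.pearl.symm p := by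
  rw [Equiv.eq_symm_apply]
  exact mapPearl_ext (hσ := f.word_eq) (f.toEquiv.apply_symm_apply p.1) (Tree.heq_map_cast _ _)

/-- The inverse isomorphism. -/
noncomputable def symm (f : G.Iso H) : H.Iso G where
  toEquiv := f.toEquiv.symm
  word_eq := f.symm_word_eq
  map_mate p := by
    rw [mapPearl_symm, mapPearl_symm, Equiv.symm_apply_eq, ← f.mate_pearl, Equiv.apply_symm_apply]

theorem pearl_symm (f : G.Iso H) (p : Pearl H.word) : f.symm.pearl p = f.pearl.symm p :=
  f.mapPearl_symm p

/-- The composition of isomorphisms. -/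
noncomputable def trans (f : G.Iso H) (g : H.Iso K) : G.Iso K where
  toEquiv := f.toEquiv.trans g.toEquiv
  word_eq v := (g.word_eq _).trans (f.word_eq v)
  map_mate p := by
    have : ∀ p, mapPearl (f.toEquiv.trans g.toEquiv) (fun v => (g.word_eq _).trans (f.word_eq v)) p =
        g.pearl (f.pearl p) := fun p =>
      mapPearl_ext rfl (((Tree.heq_map_cast _ _).trans (Tree.heq_map_cast _ _)).symm)
    rw [this, this, mate_pearl, mate_pearl]

theorem pearl_trans (f : G.Iso H) (g : H.Iso K) (p : Pearl G.word) :
    (f.trans g).pearl p = g.pearl (f.pearl p) :=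
  mapPearl_ext (hσ := (f.trans g).word_eq) rfl (((Tree.heq_map_cast _ _).trans (Tree.heq_map_cast _ _)).symm)

end Iso

/-- The pearls of the graph transported along a bijection of its necklaces. -/
def transportPearl (G : Graph V) (e : W ≃ V) : Pearl (fun w => G.word (e w)) ≃ Pearl G.word :=
  Equiv.sigmaCongrLeft (β := fun v => Pos (G.word v)) e

/-- The graph transported along a bijection of its necklaces. -/
def transport (G : Graph V) (e : W ≃ V) : Graph W where
  word w := G.word (e w)
  mate p := (G.transportPearl e).symm (G.mate (G.transportPearl e p))
  mate_mate p := by simp [G.mate_mate]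

/-- The isomorphism between a graph and a transported graph. -/
def transportIso (G : Graph V) (e : W ≃ V) : (G.transport e).Iso G where
  toEquiv := e
  word_eq _ := rfl
  map_mate p := by
    have : ∀ p, mapPearl (G := G.transport e) (H := G) e (fun _ => rfl) p = G.transportPearl e p :=
      fun p => mapPearl_ext rfl HEq.rfl
    rw [this, this]
    exact Equiv.apply_symm_apply _ _

end Graph

theorem Decorated.iso_iff {A B : Decorated} : A.Iso B ↔
    ∃ f : A.graph.Iso B.graph, A.root.map f.pearl = B.root ∧ A.mark.map f.toEquiv = B.mark :=
  ⟨fun ⟨σ, h1, h2, h3, h4⟩ => ⟨⟨σ, h1, h2⟩, h3, h4⟩,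
    fun ⟨f, h3, h4⟩ => ⟨f.toEquiv, f.word_eq, f.map_mate, h3, h4⟩⟩

namespace Tree

/-- The necklace at the top, for a tree without root pearl. -/
def mark : ∀ t : Tree, Option t.Vtx
  | leaf => none
  | node _ none _ => some none
  | node _ (some _) _ => none

/-- The word of the necklace at the top, for a tree without root pearl. -/
def markWord : Tree → Option (List Letter)
  | leaf => none
  | node s none _ => some s
  | node _ (some _) _ => none

theorem map_mark_word (t : Tree) : t.mark.map t.word = t.markWord := by
  rcases t with _ | ⟨s, _ | p, ch⟩ <;> rfl

theorem sum_word : ∀ (t : Tree) [Fintype t.Vtx],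
    ∑ x, ({t.word x} : Multiset (List Letter)) = t.necklaces
  | leaf, _ => Finset.sum_eq_zero fun x => x.elim
  | node s p ch, I => by
    have : ∀ q, Fintype (ch q).Vtx := fun q => Fintype.ofFinite _
    rw [Subsingleton.elim I (inferInstanceAs (Fintype (Option (Σ q : Pos s, (ch q).Vtx))))]
    refine (Fintype.sum_option (α := Σ q : Pos s, (ch q).Vtx) _).trans ?_
    rw [Fintype.sum_sigma]
    exact congrArg _ (Finset.sum_congr rfl fun q _ => sum_word (ch q))

/-- The decorated graph described by a tree. -/
noncomputable def model (t : Tree) (h : t.WF) : Decorated where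
  size := Nat.card t.Vtx
  graph := (t.graph h).transport (Finite.equivFin t.Vtx).symm
  root := t.root.map ((t.graph h).transportIso (Finite.equivFin t.Vtx).symm).pearl.symm
  mark := t.mark.map (Finite.equivFin t.Vtx)

/-- The isomorphism between the graph of a tree and its model. -/
noncomputable def modelIso (t : Tree) (h : t.WF) : (t.model h).graph.Iso (t.graph h) :=
  (t.graph h).transportIso (Finite.equivFin t.Vtx).symm

theorem modelIso_root (t : Tree) (h : t.WF) : (t.model h).root.map (t.modelIso h).pearl = t.root := by
  change (t.root.map (t.modelIso h).pearl.symm).map (t.modelIso h).pearl = t.root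
  rw [Option.map_map, Equiv.self_comp_symm, Option.map_id]
  rfl

theorem modelIso_mark (t : Tree) (h : t.WF) : (t.model h).mark.map (t.modelIso h).toEquiv = t.mark := by
  change (t.mark.map (Finite.equivFin t.Vtx)).map (Finite.equivFin t.Vtx).symm = t.mark
  rw [Option.map_map, Equiv.symm_comp_self, Option.map_id]
  rfl

theorem necklaces_model (t : Tree) (h : t.WF) : (t.model h).necklaces = t.necklaces := by
  have := Fintype.ofFinite t.Vtx
  have e : ∀ x, (t.model h).graph.word x = t.word ((t.modelIso h).toEquiv x) :=
    fun x => ((t.modelIso h).word_eq x).symm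
  rw [Decorated.necklaces, ← sum_word, ← Equiv.sum_comp (t.modelIso h).toEquiv,
    ← Multiset.sum_map_singleton (Multiset.map _ _), Multiset.map_map]
  exact Finset.sum_congr rfl fun x _ => by rw [← e]; rfl

theorem markedNecklace_model (t : Tree) (h : t.WF) : (t.model h).markedNecklace = t.markWord := by
  rw [← map_mark_word, ← t.modelIso_mark h, Option.map_map, Decorated.markedNecklace]
  exact congrArg (fun f => Option.map f _) (funext fun x => ((t.modelIso h).word_eq x).symm)

theorem model_iso {t : Tree} {h : t.WF} {A : Decorated} (f : (t.graph h).Iso A.graph)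
    (h1 : t.root.map f.pearl = A.root) (h2 : t.mark.map f.toEquiv = A.mark) : (t.model h).Iso A := by
  refine Decorated.iso_iff.2 ⟨(t.modelIso h).trans f, ?_, ?_⟩
  · rw [← h1, ← t.modelIso_root h, Option.map_map]
    exact congrArg (fun f => Option.map f _) (funext fun x => Iso.pearl_trans _ _ _)
  · rw [← h2, ← t.modelIso_mark h, Option.map_map]
    rfl

/-- A tree with a free root pearl or with a marked necklace. -/
def _root_.Necklace.Decorated.Anchored (A : Decorated) : Prop :=
  A.graph.incidence.IsTree ∧ ((A.mark = none ∧ ∃ r, A.root = some r ∧ A.graph.Free r) ∨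
    A.root = none ∧ A.mark ≠ none)

/-- The anchor selects the top of the description: the necklace of the root pearl, or the marked
necklace. -/
theorem exists_model {A : Decorated} (hA : A.Anchored) :
    ∃ (t : Tree) (h : t.WF), t ≠ leaf ∧ (t.model h).Iso A := by
  obtain ⟨hT, ⟨hm, ⟨v, q⟩, hr, hf⟩ | ⟨hr, hm⟩⟩ := hA
  · obtain ⟨ch, h, f, hf1, hf2⟩ := exists_iso hT v (some q) (by rintro _ ⟨⟩; exact hf)
    refine ⟨_, h, nofun, model_iso f ?_ ?_⟩
    · rw [hr, ← hf2 q]; rfl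
    · rw [hm]; rfl
  · obtain ⟨v, hv⟩ := Option.ne_none_iff_exists'.1 hm
    obtain ⟨ch, h, f, hf1, hf2⟩ := exists_iso hT v none nofun
    refine ⟨_, h, nofun, model_iso f ?_ ?_⟩
    · rw [hr]; rfl
    · exact (congrArg some hf1).trans hv.symm

/-- An isomorphism onto the graph of a tree as an immersion. -/
noncomputable def immersionOfIso {V : Type} {G : Graph V} {t : Tree} {h : t.WF} (f : (t.graph h).Iso G) :
    t.Immersion h G := ⟨f.toEquiv, f.word_eq, fun y _ => f.map_mate y⟩

/-- An isomorphism of the models immerses both trees in one graph. Since it respects the root pearl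
and the mark, the two root nodes have the same image, and `eq_of_immersion` applies. -/
theorem eq_of_model_iso {t t' : Tree} {h : t.WF} {h' : t'.WF} (ht : t ≠ leaf) (ht' : t' ≠ leaf)
    (hi : (t.model h).Iso (t'.model h')) : t = t' := by
  obtain ⟨f, hr, hm⟩ := Decorated.iso_iff.1 hi
  refine eq_of_immersion (immersionOfIso ((t.modelIso h).symm.trans f))
    (immersionOfIso (t'.modelIso h').symm) (Equiv.injective _) (Equiv.injective _) ?_
  have hr1 : t.root.map ((t.modelIso h).symm.trans f).pearl = t'.root.map (t'.modelIso h').symm.pearl := by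
    rw [← t.modelIso_root h, ← t'.modelIso_root h', Option.map_map, Option.map_map, ← hr, Option.map_map]
    refine congrArg (fun f => Option.map f _) (funext fun x => ?_)
    simp [Iso.pearl_trans, Iso.pearl_symm]
  have hm1 : t.mark.map ((t.modelIso h).symm.trans f).toEquiv =
      t'.mark.map (t'.modelIso h').symm.toEquiv := by
    rw [← t.modelIso_mark h, ← t'.modelIso_mark h', Option.map_map, Option.map_map, ← hm, Option.map_map]
    refine congrArg (fun f => Option.map f _) (funext fun x => ?_)
    simp [Iso.trans, Iso.symm]
  rcases t with _ | ⟨s, _ | p, ch⟩ <;> rcases t' with _ | ⟨s', _ | p', ch'⟩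
  all_goals first | exact absurd rfl ht | exact absurd rfl ht' | skip
  · exact congrArg some (congrArg Sum.inl (Option.some.inj hm1))
  · exact nomatch hr1
  · exact nomatch hr1
  · exact congrArg some (congrArg Sum.inr (Option.some.inj hr1))

end Tree
end Necklace

/-! ### Subtrees computed along the recursive description. -/

namespace Necklace

open Necklace.Graph

theorem mem_support_of_crossing {X : Type*} {Γ : SimpleGraph X} {S : Set X} {x : X}
    (h : ∀ a b, Γ.Adj a b → a ∉ S → b ∈ S → b = x) {a b : X} (w : Γ.Walk a b) (ha : a ∉ S)
    (hb : b ∈ S) : x ∈ w.support := by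
  induction w with
  | nil => exact absurd hb ha
  | @cons a c b hac w ih =>
    rw [SimpleGraph.Walk.support_cons]
    by_cases hc : c ∈ S
    · rw [← h a c hac ha hc]
      exact List.mem_cons_of_mem _ w.start_mem_support
    · exact List.mem_cons_of_mem _ (ih hc hb)

namespace Tree

section
variable {s : List Letter} {p : Pos s} {ch : Pos s → Tree} (h : (node s (some p) ch).WF)

theorem adj_top' (q : Pos s) :
    ((node s (some p) ch).graph h).incidence.Adj (.inr (top q)) (.inl none) :=
  (adj_top h q).symm

theorem exists_walk_top (q : Pos s) :
    ∃ w : ((node s (some p) ch).graph h).incidence.Walk (.inr (top p)) (.inr (top q)),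
      ∀ z ∈ w.support, z = .inr (top p) ∨ z = .inl none ∨ z = .inr (top q) := by
  refine ⟨.cons (adj_top' h p) (.cons (adj_top h q) .nil), ?_⟩
  intro z hz
  simpa [SimpleGraph.Walk.support_cons] using hz

theorem exists_walk_lift {q : Pos s} {r y : Pearl (ch q).word} (hr : (ch q).root = some r)
    (w : ((ch q).graph (h.child q)).incidence.Walk (.inr r) (.inr y)) :
    ∃ w' : ((node s (some p) ch).graph h).incidence.Walk (.inr (top p)) (.inr (lift q y)),
      ∀ z ∈ w'.support, z = .inr (top p) ∨ z = .inl none ∨ z = .inr (top q) ∨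
        ∃ z' ∈ w.support, z = liftHom h q z' := by
  obtain ⟨w₀, hw₀⟩ := exists_walk_top h q
  refine ⟨w₀.append (.cons (adj_top_lift h hr) (w.map (liftHom h q))), fun z hz => ?_⟩
  rw [SimpleGraph.Walk.mem_support_append_iff] at hz
  rcases hz with hz | hz
  · rcases hw₀ z hz with h | h | h
    · exact .inl h
    · exact .inr (.inl h)
    · exact .inr (.inr (.inl h))
  · rcases List.mem_cons.1 hz with hz | hz
    · exact .inr (.inr (.inl hz))
    · obtain ⟨z', hz', e⟩ := List.mem_map.1 ((congrArg (z ∈ ·)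
        (SimpleGraph.Walk.support_map (liftHom h q) w)).mp hz)
      exact .inr (.inr (.inr ⟨z', hz', e.symm⟩))

theorem liftHom_ne_top (q q' : Pos s) (x) : liftHom h q x ≠ .inr (top q') := by
  rcases x with v | y
  · exact nofun
  · exact fun e => lift_ne_top _ _ _ (Sum.inr.inj e)

theorem liftHom_ne_none (q : Pos s) (x) : liftHom h q x ≠ .inl none := by
  rcases x with v | y
  · exact fun e => nomatch Sum.inl.inj e
  · exact nofun

theorem lift_eq_lift {q q' : Pos s} {y : Pearl (ch q).word} {z : (ch q').Vtx ⊕ Pearl (ch q').word}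
    (e : Sum.inr (lift q y) = liftHom h q' z) : q = q' := by
  rcases z with v | z
  · exact nomatch e
  · have := congrArg Sigma.fst (Sum.inr.inj e)
    injection this with this
    injection this

theorem lift_eq_liftHom {q : Pos s} {y : Pearl (ch q).word} {z : (ch q).Vtx ⊕ Pearl (ch q).word}
    (e : Sum.inr (lift q y) = liftHom h q z) : z = .inr y := by
  rcases z with v | z
  · exact nomatch e
  · exact congrArg Sum.inr (lift_injective q (Sum.inr.inj e)).symm

theorem liftHom_injective (q : Pos s) : Function.Injective (liftHom h q) := by
  rintro (v | y) (w | z) e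
  · have := Sum.inl.inj e
    injection this with this
    injection this with _ this
    rw [this]
  · exact nomatch e
  · exact nomatch e
  · exact congrArg Sum.inr (lift_injective q (Sum.inr.inj e))

/-- The attached tree together with `top q` can be entered only through `top q`, which forces every
walk through it. Conversely, a pearl elsewhere is reached by an explicit walk that avoids `top q`.
-/
theorem mem_subtree_top {q : Pos s} (hq : q ≠ p) (y : Pearl (node s (some p) ch).word) :
    y ∈ ((node s (some p) ch).graph h).subtree (top p) (top q) ↔ y = top q ∨ ∃ y', y = lift q y' := by
  constructor
  · intro hy
    have top_ne : ∀ {q'}, top (p := some p) (ch := ch) q' = top q → q' = q := top_inj.1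
    induction y using pearl_cases with
    | h1 q' =>
      left
      obtain ⟨w, hw⟩ := exists_walk_top h q'
      rcases hw _ (hy w) with e | e | e
      · exact absurd (top_ne (Sum.inr.inj e).symm) hq.symm
      · exact nomatch e
      · exact (Sum.inr.inj e).symm
    | h2 q' y =>
      right
      obtain ⟨r, hr⟩ := h.exists_root q' y.1
      obtain ⟨w⟩ := preconnected (h.child q') (.inr r) (.inr y)
      obtain ⟨w, hw⟩ := exists_walk_lift h hr w
      rcases hw _ (hy w) with e | e | e | ⟨z, _, e⟩
      · exact absurd (top_ne (Sum.inr.inj e).symm) hq.symm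
      · exact nomatch e
      · obtain rfl := top_ne (Sum.inr.inj e).symm
        exact ⟨y, rfl⟩
      · exact absurd e.symm (liftHom_ne_top h _ _ _)
  · intro hy w
    refine mem_support_of_crossing (S := insert (.inr (top q)) (Set.range (liftHom h q))) ?_ w ?_ ?_
    · intro a b hab ha hb
      revert ha hb
      refine (edge_cases h (fun a b => (a ∉ insert (.inr (top q)) (Set.range (liftHom h q)) →
        b ∈ insert (.inr (top q)) (Set.range (liftHom h q)) → b = .inr (top q)) ∧
        (b ∉ insert (.inr (top q)) (Set.range (liftHom h q)) →
        a ∈ insert (.inr (top q)) (Set.range (liftHom h q)) → a = .inr (top q)))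
        (fun _ _ => And.symm) ?_ ?_ ?_ a b hab).1
      · intro q'
        refine ⟨fun _ hb => ?_, fun _ hb => ?_⟩
        · rcases hb with hb | ⟨z, hz⟩
          · exact hb
          · exact absurd hz (liftHom_ne_top h _ _ _)
        · rcases hb with hb | ⟨z, hz⟩
          · exact hb
          · exact absurd hz (liftHom_ne_none h _ _)
      · intro q' y hy
        refine ⟨fun ha hb => ?_, fun _ hb => ?_⟩
        · rcases hb with hb | ⟨z, hz⟩
          · exact hb
          · obtain rfl := lift_eq_lift h hz.symm
            exact absurd (.inl rfl) ha
        · rcases hb with hb | ⟨z, hz⟩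
          · exact hb
          · exact absurd hz (liftHom_ne_top h _ _ _)
      · intro q' x y _
        have key : ∀ x y, liftHom h q' x ∉ insert (.inr (top q)) (Set.range (liftHom h q)) →
            liftHom h q' y ∈ insert (.inr (top q)) (Set.range (liftHom h q)) →
            liftHom h q' y = .inr (top q) := by
          intro x y hx hy
          rcases hy with hy | ⟨z, hz⟩
          · exact hy
          · have : q' = q := by
              rcases y with y | y <;> rcases z with z | z
              · have := Sum.inl.inj hz
                injection this with this
                injection this with this
                exact this.symm
              · exact nomatch hz
              · exact nomatch hz
              · exact lift_eq_lift h hz.symm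
            subst this
            exact absurd (.inr ⟨x, rfl⟩) hx
        exact ⟨key x y, key y x⟩
    · rintro (e | ⟨z, hz⟩)
      · exact hq.symm (top_inj.1 (Sum.inr.inj e))
      · exact liftHom_ne_top h _ _ _ hz
    · rcases hy with rfl | ⟨y, rfl⟩
      · exact .inl rfl
      · exact .inr ⟨.inr y, rfl⟩

/-- Walks from `top p` enter the attached tree through its root `r`, so separation by `x` can be
tested inside that tree. -/
theorem mem_subtree_lift {q : Pos s} {r : Pearl (ch q).word} (hr : (ch q).root = some r)
    (x : Pearl (ch q).word) (y : Pearl (node s (some p) ch).word) :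
    y ∈ ((node s (some p) ch).graph h).subtree (top p) (lift q x) ↔
      ∃ y', y = lift q y' ∧ y' ∈ ((ch q).graph (h.child q)).subtree r x := by
  constructor
  · intro hy
    induction y using pearl_cases with
    | h1 q' =>
      obtain ⟨w, hw⟩ := exists_walk_top h q'
      rcases hw _ (hy w) with e | e | e
      · exact absurd (Sum.inr.inj e) (lift_ne_top _ _ _)
      · exact nomatch e
      · exact absurd (Sum.inr.inj e) (lift_ne_top _ _ _)
    | h2 q' y =>
      have key : ∀ r', (ch q').root = some r' →
          ∀ w : ((ch q').graph (h.child q')).incidence.Walk (.inr r') (.inr y),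
          ∃ z' ∈ w.support, Sum.inr (lift q x) = liftHom h q' z' := by
        intro r' hr' w
        obtain ⟨w', hw⟩ := exists_walk_lift h hr' w
        rcases hw _ (hy w') with e | e | e | h
        · exact absurd (Sum.inr.inj e) (lift_ne_top _ _ _)
        · exact nomatch e
        · exact absurd (Sum.inr.inj e) (lift_ne_top _ _ _)
        · exact h
      obtain ⟨r', hr'⟩ := h.exists_root q' y.1
      obtain ⟨w⟩ := preconnected (h.child q') (.inr r') (.inr y)
      obtain ⟨z, hz, e⟩ := key r' hr' w
      obtain rfl := lift_eq_lift h e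
      refine ⟨y, rfl, fun w => ?_⟩
      obtain ⟨z, hz, e⟩ := key r hr w
      rwa [← lift_eq_liftHom h e]
  · rintro ⟨y, rfl, hy⟩ w
    set S : Set ((ch q).Vtx ⊕ Pearl (ch q).word) :=
      {z | ∀ w : ((ch q).graph (h.child q)).incidence.Walk (.inr r) z, .inr x ∈ w.support} with hS
    refine mem_support_of_crossing (S := liftHom h q '' S) ?_ w ?_ ⟨.inr y, hy, rfl⟩
    · intro a b hab ha hb
      revert ha hb
      refine (edge_cases h (fun a b => (a ∉ liftHom h q '' S → b ∈ liftHom h q '' S → b = .inr (lift q x)) ∧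
        (b ∉ liftHom h q '' S → a ∈ liftHom h q '' S → a = .inr (lift q x)))
        (fun _ _ => And.symm) ?_ ?_ ?_ a b hab).1
      · intro q'
        refine ⟨?_, ?_⟩
        · rintro _ ⟨z, _, e⟩
          exact absurd e (liftHom_ne_top h _ _ _)
        · rintro _ ⟨z, _, e⟩
          exact absurd e (liftHom_ne_none h _ _)
      · intro q' y₁ hy₁
        refine ⟨?_, ?_⟩
        · rintro _ ⟨z, hz, e⟩
          obtain rfl := lift_eq_lift h e.symm
          obtain rfl := lift_eq_liftHom h e.symm
          cases hr.symm.trans hy₁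
          -- Membership of `r` itself in `S`, tested on the trivial walk, gives `x = r`.
          have := hz .nil
          rw [SimpleGraph.Walk.support_nil, List.mem_singleton] at this
          rw [Sum.inr.inj this]
        · rintro _ ⟨z, _, e⟩
          exact absurd e (liftHom_ne_top h _ _ _)
      · intro q' a b hab
        have key : ∀ a b, ((ch q').graph (h.child q')).incidence.Adj a b →
            liftHom h q' a ∉ liftHom h q '' S → liftHom h q' b ∈ liftHom h q '' S →
            liftHom h q' b = .inr (lift q x) := by
          rintro a b hab ha ⟨z, hz, e⟩
          have : q' = q := by
            rcases b with y | y <;> rcases z with z | z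
            · have := Sum.inl.inj e
              injection this with this
              injection this with this
              exact this.symm
            · exact nomatch e
            · exact nomatch e
            · exact lift_eq_lift h e.symm
          subst this
          obtain rfl := liftHom_injective h _ e
          have ha' : a ∉ S := fun ha' => ha ⟨a, ha', rfl⟩
          simp only [hS, Set.mem_ofPred_eq, not_forall] at ha'
          obtain ⟨w, hw⟩ := ha'
          -- A walk to `a` that avoids `x`, prolonged by one edge, must meet `x`; hence its new
          -- endpoint is `x`.
          have := hz (w.concat hab)
          rw [SimpleGraph.Walk.support_concat, List.mem_append] at this
          rcases this with this | this
          · exact absurd this hw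
          · rw [List.mem_singleton] at this
            rw [← this]; rfl
        exact ⟨key a b hab, key b a hab.symm⟩
    · rintro ⟨z, _, e⟩
      exact liftHom_ne_top h _ _ _ e

end

end Tree
end Necklace

/-! ### Excess and local conditions in recursive form. -/

namespace Necklace

open Necklace.Graph

/-- The contribution of a pearl to the excess. -/
def Kind.exc : Kind → ℤ
  | some .triangle => 1
  | some .diamond => -1
  | _ => 0

open Classical in
theorem Graph.excess_eq_sum {V : Type} (G : Graph V) [Fintype (Pearl G.word)] (r x : Pearl G.word) :
    G.excess r x = ∑ y, if y ∈ G.subtree r x then Kind.exc (G.kind y) else 0 := by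
  have key : ∀ k, ({y ∈ G.subtree r x | G.kind y = k}.ncard : ℤ) =
      ∑ y, if y ∈ G.subtree r x ∧ G.kind y = k then (1 : ℤ) else 0 := fun k => by
    rw [Set.ncard_eq_toFinset_card', Finset.sum_boole]
    congr 2
    ext
    simp
  rw [excess, key, key, ← Finset.sum_sub_distrib]
  refine Finset.sum_congr rfl fun y _ => ?_
  by_cases hy : y ∈ G.subtree r x
  · rcases hk : G.kind y with _ | _ | _ | _ <;> simp [hy, Kind.exc]
  · simp [hy]

namespace Tree

noncomputable instance (t : Tree) : Fintype t.Vtx := Fintype.ofFinite _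

section
variable {s : List Letter} {p : Option (Pos s)} {ch : Pos s → Tree}

theorem sum_pearl (g : Pearl (node s p ch).word → ℤ) :
    ∑ y, g y = ∑ q, (g (top q) + ∑ y : Pearl (ch q).word, g (lift q y)) := by
  let e : Pos s ⊕ (Σ q, Pearl (ch q).word) → Pearl (node s p ch).word :=
    Sum.elim top fun x => lift x.1 x.2
  have he : Function.Bijective e := by
    constructor
    · rintro (q | ⟨q, y⟩) (q' | ⟨q', z⟩) h
      · exact congrArg Sum.inl (top_inj.1 h)
      · exact absurd h.symm (lift_ne_top _ _ _)
      · exact absurd h (lift_ne_top _ _ _)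
      · have := congrArg Sigma.fst h
        injection this with this
        injection this with this _
        subst this
        have := lift_injective (p := p) q h
        subst this
        rfl
    · intro y
      induction y using pearl_cases with
      | h1 q => exact ⟨.inl q, rfl⟩
      | h2 q y => exact ⟨.inr ⟨q, y⟩, rfl⟩
  rw [← Equiv.sum_comp (Equiv.ofBijective e he), Fintype.sum_sum_type, Fintype.sum_sigma,
    Finset.sum_add_distrib]
  rfl
end

/-- The total excess of a tree. -/
def exc : Tree → ℤ
  | leaf => 0
  | node s _ ch => ∑ q, (Kind.exc (posKind s q) + (ch q).exc)

/-- The kind of a pearl of a tree. -/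
def pearlKind (t : Tree) (y : Pearl t.word) : Kind := posKind (t.word y.1) y.2

theorem sum_exc : ∀ t : Tree, ∑ y, Kind.exc (t.pearlKind y) = t.exc
  | leaf => Finset.sum_eq_zero fun y _ => y.1.elim
  | node s p ch => by
    rw [sum_pearl]
    refine Finset.sum_congr rfl fun q _ => ?_
    rw [← sum_exc (ch q)]
    rfl

/-- The excess is non-negative at all pearls. -/
def Nonneg : Tree → Prop
  | leaf => True
  | node s p ch => 0 ≤ (node s p ch).exc ∧
      ∀ q, p ≠ some q → 0 ≤ Kind.exc (posKind s q) + (ch q).exc ∧ (ch q).Nonneg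

theorem excess_root {t : Tree} (h : t.WF) (r : Pearl t.word) : (t.graph h).excess r r = t.exc := by
  classical
  rw [excess_eq_sum, ← sum_exc]
  refine Finset.sum_congr rfl fun y _ => if_pos ?_
  exact fun w => w.start_mem_support

section
variable {s : List Letter} {p : Pos s} {ch : Pos s → Tree} (h : (node s (some p) ch).WF)

theorem excess_top {q : Pos s} (hq : q ≠ p) :
    ((node s (some p) ch).graph h).excess (top p) (top q) = Kind.exc (posKind s q) + (ch q).exc := by
  classical
  rw [excess_eq_sum, sum_pearl, Finset.sum_eq_single q]
  · simp only [mem_subtree_top h hq]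
    rw [if_pos (.inl trivial), ← sum_exc (ch q)]
    congr 1
    exact Finset.sum_congr rfl fun y _ => if_pos (.inr ⟨y, rfl⟩)
  · intro q' _ hq'
    simp only [mem_subtree_top h hq]
    rw [if_neg, Finset.sum_eq_zero, add_zero]
    · intro y _
      rw [if_neg]
      rintro (e | ⟨y', e⟩)
      · exact lift_ne_top _ _ _ e
      · exact hq' (lift_eq_lift h (z := .inr y') (congrArg Sum.inr e))
    · rintro (e | ⟨y', e⟩)
      · exact hq' (top_inj.1 e)
      · exact lift_ne_top _ _ _ e.symm
  · simp

theorem excess_lift {q : Pos s} {r : Pearl (ch q).word} (hr : (ch q).root = some r)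
    (x : Pearl (ch q).word) : ((node s (some p) ch).graph h).excess (top p) (lift q x) =
      ((ch q).graph (h.child q)).excess r x := by
  classical
  rw [excess_eq_sum, sum_pearl, Finset.sum_eq_single q]
  · simp only [mem_subtree_lift h hr]
    rw [if_neg, zero_add, excess_eq_sum]
    · refine Finset.sum_congr rfl fun y _ => if_congr ⟨?_, fun hy => ⟨y, rfl, hy⟩⟩ rfl rfl
      rintro ⟨y', e, hy⟩
      rwa [lift_injective q e]
    · rintro ⟨y', e, _⟩
      exact lift_ne_top _ _ _ e.symm
  · intro q' _ hq'
    simp only [mem_subtree_lift h hr]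
    rw [if_neg, Finset.sum_eq_zero, add_zero]
    · intro y _
      rw [if_neg]
      rintro ⟨y', e, _⟩
      exact hq' (lift_eq_lift h (z := .inr y') (congrArg Sum.inr e))
    · rintro ⟨y', e, _⟩
      exact lift_ne_top _ _ _ e.symm
  · simp

end

theorem ne_leaf_of_root {t : Tree} {y} (h : t.root = some y) : t ≠ leaf := by
  rintro rfl
  cases h

/-- The excess at `top q` is the contribution of that pearl plus the total excess of the attached
tree, and the excess at a deeper pearl is computed inside the attached tree. This turns the
condition on all pearls into the recursion `Nonneg`. -/
theorem nonneg_iff : ∀ {t : Tree} (h : t.WF) {r : Pearl t.word}, t.root = some r →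
    ((∀ x, 0 ≤ (t.graph h).excess r x) ↔ t.Nonneg)
  | leaf, _, r, _ => r.1.elim
  | node s none ch, _, _, hr => nomatch hr
  | node s (some p) ch, h, r, hr => by
    obtain rfl : top p = r := Option.some.inj hr
    constructor
    · intro hx
      refine ⟨by simpa only [excess_root] using hx (top p), fun q hq => ⟨?_, ?_⟩⟩
      · have := hx (top q)
        rwa [excess_top h (fun e => hq (congrArg some e.symm))] at this
      · cases hr : (ch q).root with
        | none =>
          rw [show ch q = leaf from by_contra fun hl => h.root_ne_none q hl hr]
          trivial
        | some y =>
          refine (nonneg_iff (h.child q) hr).1 fun x => ?_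
          rw [← excess_lift h hr]
          exact hx _
    · rintro ⟨h0, h1⟩ x
      induction x using pearl_cases with
      | h1 q =>
        by_cases hq : q = p
        · rw [hq, excess_root]; exact h0
        · rw [excess_top h hq]
          exact (h1 q fun e => hq (Option.some.inj e).symm).1
      | h2 q x =>
        obtain ⟨y, hy⟩ := h.exists_root q x.1
        rw [excess_lift h hy]
        refine (nonneg_iff (h.child q) hy).2 ?_ x
        exact (h1 q fun e => ne_leaf_of_root hy (h.1 q e)).2

/-- The kind of the root pearl. -/
def rootKind : Tree → Option Kind
  | leaf => none
  | node s p _ => p.map (posKind s)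

theorem rootKind_eq {t : Tree} {r} (h : t.root = some r) : t.rootKind = some (t.pearlKind r) := by
  rcases t with _ | ⟨s, _ | p, ch⟩
  · cases h
  · cases h
  · cases h; rfl

/-- Trees with necklaces in `Q`, free pearls of kinds in `A` except for the root pearl, and edges that join
pearls whose kinds are related by `E`. -/
def Loc (Q : Set (List Letter)) (A : Kind → Prop) (E : Kind → Kind → Prop) : Tree → Prop
  | leaf => False
  | node s p ch => s ∈ Q ∧ ∀ q, (p = some q → ch q = leaf) ∧
      (p ≠ some q → (ch q = leaf ∧ A (posKind s q)) ∨
        ∃ k, (ch q).rootKind = some k ∧ E (posKind s q) k ∧ (ch q).Loc Q A E)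

variable {Q : Set (List Letter)} {A : Kind → Prop} {E : Kind → Kind → Prop}

theorem Loc.ne_leaf {t : Tree} (h : t.Loc Q A E) : t ≠ leaf := by
  rintro rfl; exact h

theorem Loc.wf : ∀ {t : Tree}, t.Loc Q A E → t.WF
  | leaf, _ => trivial
  | node s p ch, h => by
    refine ⟨fun q => (h.2 q).1, fun q => ?_⟩
    by_cases hq : p = some q
    · exact .inl ((h.2 q).1 hq)
    · rcases (h.2 q).2 hq with h | ⟨k, hk, _, h⟩
      · exact .inl h.1
      · refine .inr ⟨fun e => ?_, h.wf⟩
        cases hc : ch q with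
        | leaf => rw [hc] at hk; cases hk
        | node s p ch =>
          rw [hc] at hk e
          cases p with
          | none => cases hk
          | some p => cases e

/-- An edge joins a pearl to the root of the tree attached to it, or lies inside an attached tree.
Symmetry of `E` serves for reading an edge from its lower end. -/
theorem loc_iff (hE : ∀ k k', E k k' → E k' k) : ∀ {t : Tree} (_ : t.WF), t ≠ leaf →
    (((∀ v, t.word v ∈ Q) ∧ (∀ y, t.mate y = y → t.root ≠ some y → A (t.pearlKind y)) ∧
      ∀ y, t.mate y ≠ y → E (t.pearlKind y) (t.pearlKind (t.mate y))) ↔ t.Loc Q A E)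
  | leaf, _, hl => absurd rfl hl
  | node s p ch, h, _ => by
    have root_ne : ∀ {q}, p ≠ some q → (node s p ch).root ≠ some (top q) := fun {q} hq => by
      cases p with
      | none => exact nofun
      | some q' => exact fun e => hq (congrArg some (top_inj.1 (Option.some.inj e)))
    have root_ne' : ∀ {q y}, (node s p ch).root ≠ some (lift q y) := fun {q y} => by
      cases p with
      | none => exact nofun
      | some q' => exact fun e => lift_ne_top _ _ _ (Option.some.inj e).symm
    constructor
    · rintro ⟨h1, h2, h3⟩
      refine ⟨h1 none, fun q => ⟨h.1 q, fun hq => ?_⟩⟩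
      cases hr : (ch q).root with
      | none =>
        exact .inl ⟨by_contra fun hl => h.root_ne_none q hl hr,
          h2 (top q) (mate_top_none hr) (root_ne hq)⟩
      | some y =>
        refine .inr ⟨_, rootKind_eq hr, ?_, ?_⟩
        · have := h3 (top q) (by rw [mate_top_some hr]; exact lift_ne_top _ _ _)
          rwa [mate_top_some hr] at this
        · refine (loc_iff hE (h.child q) (ne_leaf_of_root hr)).1
            ⟨fun v => h1 (some ⟨q, v⟩), fun z hz hz' => ?_, fun z hz => ?_⟩
          · exact h2 (lift q z) (by rw [mate_lift hz', hz]) root_ne'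
          · have hz' : (ch q).root ≠ some z := fun e => hz (root_free (h.child q) e)
            have := h3 (lift q z) (by rw [mate_lift hz']; exact fun e => hz (lift_injective q e))
            rwa [mate_lift hz'] at this
    · rintro ⟨h1, h2⟩
      have hch : ∀ q y, (ch q).root = some y →
          E (posKind s q) ((ch q).pearlKind y) ∧ (ch q).Loc Q A E := by
        intro q y hr
        have hl : ch q ≠ leaf := ne_leaf_of_root hr
        rcases (h2 q).2 (fun e => hl ((h2 q).1 e)) with h | ⟨k, hk, hE, hloc⟩
        · exact absurd h.1 hl
        · rw [rootKind_eq hr, Option.some.injEq] at hk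
          exact ⟨hk ▸ hE, hloc⟩
      have ih := fun q y hr => (loc_iff hE (h.child q) (hch q y hr).2.ne_leaf).2 (hch q y hr).2
      refine ⟨?_, fun y => ?_, fun y => ?_⟩
      · rintro (_ | ⟨q, v⟩)
        · exact h1
        · obtain ⟨y, hy⟩ := h.exists_root q v
          exact (ih q y hy).1 v
      · induction y using pearl_cases with
        | h1 q =>
          intro hm hr
          have hq : p ≠ some q := by rintro rfl; exact hr rfl
          rcases (h2 q).2 hq with h | ⟨k, hk, -, hloc⟩
          · exact h.2
          · exfalso
            obtain ⟨y, hy⟩ := Option.ne_none_iff_exists'.1 (h.root_ne_none q hloc.ne_leaf)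
            rw [mate_top_some hy] at hm
            exact lift_ne_top _ _ _ hm
        | h2 q y =>
          intro hm _
          obtain ⟨r, hr⟩ := h.exists_root q y.1
          have hy : (ch q).root ≠ some y := fun e => by
            rw [mate_lift_root e] at hm
            exact lift_ne_top _ _ _ hm.symm
          rw [mate_lift hy] at hm
          exact (ih q r hr).2.1 y (lift_injective q hm) hy
      · induction y using pearl_cases with
        | h1 q =>
          intro hm
          cases hr : (ch q).root with
          | none => exact absurd (mate_top_none hr) hm
          | some y =>
            rw [mate_top_some hr]
            exact (hch q y hr).1
        | h2 q y =>
          intro hm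
          by_cases hy : (ch q).root = some y
          · rw [mate_lift_root hy]
            exact hE _ _ (hch q y hy).1
          · obtain ⟨r, hr⟩ := h.exists_root q y.1
            rw [mate_lift hy] at hm ⊢
            exact (ih q r hr).2.2 y fun e => hm (congrArg _ e)

end Tree
end Necklace

/-! ### The classes of the theorem as sets of recursive trees. -/

namespace Necklace

open Necklace.Graph

/-- A property of necklace graphs with possibly a root pearl and possibly a marked necklace. -/
abbrev GraphProp : Type 1 := ∀ ⦃V : Type⦄ (G : Graph V), Option (Pearl G.word) → Option V → Prop

/-- Invariance of a property under isomorphisms. -/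
def GraphProp.Invariant (P : GraphProp) : Prop :=
  ∀ ⦃V W : Type⦄ ⦃G : Graph V⦄ ⦃H : Graph W⦄ (f : G.Iso H) (r : Option (Pearl G.word)) (m : Option V),
    P H (r.map f.pearl) (m.map f.toEquiv) ↔ P G r m

/-- `exists_model` gives surjectivity of the passage from trees to classes, and `eq_of_model_iso`
injectivity. The property is needed over arbitrary vertex types because the necklaces of a `Tree`
are not indexed by some `Fin n`. -/
theorem IsoClass.exists_equiv_tree {P : Decorated → Prop} (P' : GraphProp)
    (hP : ∀ A : Decorated, P A ↔ P' A.graph A.root A.mark) (hinv : P'.Invariant)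
    (hA : ∀ A, P A → A.Anchored) (T : Tree → Prop) (hT : ∀ t, T t → t.WF ∧ t ≠ .leaf)
    (hPT : ∀ (t : Tree) (h : t.WF), t ≠ .leaf → (P' (t.graph h) t.root t.mark ↔ T t)) :
    ∃ e : IsoClass P ≃ {t // T t}, ∀ c, (e c).1.necklaces = c.necklaces ∧
      (e c).1.markWord = c.markedNecklace := by
  have hmodel : ∀ (t : Tree) (h : t.WF), t ≠ .leaf → (P (t.model h) ↔ T t) := fun t h hl => by
    rw [hP, ← hinv (t.modelIso h), t.modelIso_root, t.modelIso_mark, hPT t h hl]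
  have hiso : ∀ {A B : Decorated}, A.Iso B → P B → P A := fun {A B} h hB => by
    obtain ⟨f, h1, h2⟩ := Decorated.iso_iff.1 h
    rw [hP, ← hinv f, h1, h2, ← hP]
    exact hB
  let g : {t // T t} → IsoClass P := fun t =>
    Quotient.mk _ ⟨t.1.model (hT _ t.2).1, (hmodel _ _ (hT _ t.2).2).2 t.2⟩
  have hg : Function.Bijective g := by
    constructor
    · intro t t' h
      have := Quotient.exact h
      exact Subtype.ext (Tree.eq_of_model_iso (hT _ t.2).2 (hT _ t'.2).2 this)
    · intro c
      induction c using Quotient.ind with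
      | _ A =>
        obtain ⟨t, h, hl, hi⟩ := Tree.exists_model (hA A.1 A.2)
        exact ⟨⟨t, (hmodel t h hl).1 (hiso hi A.2)⟩, Quotient.sound hi⟩
  refine ⟨(Equiv.ofBijective g hg).symm, fun c => ?_⟩
  obtain ⟨t, rfl⟩ := hg.2 c
  have : (Equiv.ofBijective g hg).symm (g t) = t := (Equiv.ofBijective g hg).symm_apply_apply t
  rw [this]
  exact ⟨(t.1.necklaces_model _).symm, (t.1.markedNecklace_model _).symm⟩

/-- Pearls of these kinds can be joined by an edge. -/
def EdgeRel (l : List (Kind × Kind)) (k k' : Kind) : Prop := (k, k') ∈ l ∨ (k', k) ∈ l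

/-- The relation between the ends of an edge in companion trees. -/
abbrev companionRel : Kind → Kind → Prop :=
  EdgeRel [(some .bullet, none), (some .diamond, some .triangle)]

/-- The relation between the ends of an edge in `Q`-trees. -/
abbrev treeRel : Kind → Kind → Prop := EdgeRel [(some .bullet, none), (some .diamond, none)]

namespace Tree

/-- Trees that describe companion trees without defects. -/
abbrev IsCompanion (Q : Set (List Letter)) : Tree → Prop := Loc Q (· = none) companionRel

/-- Trees that describe `Q`-trees. -/
abbrev IsQTree (Q : Set (List Letter)) (t : Tree) : Prop :=
  t.Loc Q (· = some .triangle) treeRel ∧ t.rootKind = some none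

end Tree

variable (Q : Set (List Letter))

/-- The property `IsC`. -/
def propC (x : Kind) : GraphProp := fun _ G r m => m = none ∧ (∀ p, ¬ G.IsDefect r p) ∧
  ∃ y, r = some y ∧ G.kind y = x ∧ G.IsRootedCompanion Q y

/-- The property `IsMarkedC`. -/
def propMarkedC : GraphProp := fun _ G r m => m ≠ none ∧ r = none ∧ (∀ p, ¬ G.IsDefect none p) ∧
  G.IsUnrootedCompanion Q

/-- The property `IsF0`. -/
def propF0 : GraphProp := fun _ G r m => m = none ∧
  ∃ y, r = some y ∧ G.IsNonnegQTree Q y ∧ G.excess y y = 0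

theorem exists_map_eq {α β : Type*} (e : α ≃ β) (r : Option α) (P : β → Prop) :
    (∃ y, r.map e = some y ∧ P y) ↔ ∃ y, r = some y ∧ P (e y) := by
  cases r <;> simp

theorem propC_invariant (x : Kind) : (propC Q x).Invariant := by
  intro V W G H f r m
  simp only [propC, exists_map_eq, f.isRootedCompanion_iff, f.isDefect_iff, f.pearl.surjective.forall,
    f.kind_pearl, Option.map_eq_none_iff]

theorem propMarkedC_invariant : (propMarkedC Q).Invariant := by
  intro V W G H f r m
  have := f.isDefect_iff none
  simp only [Option.map_none] at this
  simp [propMarkedC, f.isUnrootedCompanion_iff, this, f.pearl.surjective.forall]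

theorem propF0_invariant : (propF0 Q).Invariant := by
  intro V W G H f r m
  simp only [propF0, exists_map_eq, f.isNonnegQTree_iff, f.excess_eq, Option.map_eq_none_iff]

theorem edgeRel_symm (l : List (Kind × Kind)) (k k' : Kind) (h : EdgeRel l k k') : EdgeRel l k' k :=
  Or.symm h

variable {Q}

theorem Tree.mark_of_root {t : Tree} {y} (h : t.root = some y) : t.mark = none := by
  rcases t with _ | ⟨s, _ | p, ch⟩
  · rfl
  · cases h
  · rfl

theorem eq_none_of_kind {k : Kind} (h1 : k ≠ some .bullet) (h2 : k ≠ some .diamond)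
    (h3 : k ≠ some .triangle) : k = none := by
  rcases k with _ | _ | _ | _ <;> simp_all

/-- Absence of defects, combined with the ban on free `●`- and `♦`-pearls, says that the free
non-root pearls are all `□`; this is a local condition. -/
theorem propC_tree (x : Kind) (t : Tree) (h : t.WF) (hl : t ≠ .leaf) :
    propC Q x (t.graph h) t.root t.mark ↔ t.IsCompanion Q ∧ t.rootKind = some x := by
  rw [Tree.IsCompanion, ← Tree.loc_iff (edgeRel_symm _) h hl]
  constructor
  · rintro ⟨-, h2, y, hy, hk, hc⟩
    refine ⟨⟨hc.word_mem, fun z hz hz' => ?_, fun z hz => hc.edges z hz⟩, ?_⟩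
    · obtain ⟨k1, k2⟩ := hc.free_kind z hz (fun e => hz' (by rw [hy, e]))
      exact eq_none_of_kind k1 k2 fun k3 => h2 z ⟨hz, k3, hz'⟩
    · rw [Tree.rootKind_eq hy]
      exact congrArg some hk
  · rintro ⟨⟨h1, h2, h3⟩, hk⟩
    obtain ⟨y, hy⟩ : ∃ y, t.root = some y := by
      rcases t with _ | ⟨s, _ | p, ch⟩
      · cases hk
      · cases hk
      · exact ⟨_, rfl⟩
    refine ⟨Tree.mark_of_root hy, fun p hp => ?_, y, hy, ?_, ⟨⟨?_, h1, h3⟩, Tree.root_free h hy, ?_⟩⟩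
    · have := h2 p hp.1 hp.2.2
      exact nomatch this.symm.trans hp.2.1
    · rw [Tree.rootKind_eq hy] at hk
      exact Option.some.inj hk
    · cases t with
      | leaf => exact absurd rfl hl
      | node s p ch => exact Tree.isTree h
    · intro p hp hne
      have : (t.graph h).kind p = none := h2 p hp (fun e => hne (by rw [hy] at e; exact (Option.some.inj e).symm))
      rw [this]
      exact ⟨nofun, nofun⟩

theorem propMarkedC_tree (t : Tree) (h : t.WF) (hl : t ≠ .leaf) :
    propMarkedC Q (t.graph h) t.root t.mark ↔ t.IsCompanion Q ∧ t.rootKind = none := by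
  rw [Tree.IsCompanion, ← Tree.loc_iff (edgeRel_symm _) h hl]
  constructor
  · rintro ⟨-, hr, h2, hc⟩
    refine ⟨⟨hc.word_mem, fun z hz hz' => ?_, fun z hz => hc.edges z hz⟩, ?_⟩
    · obtain ⟨k1, k2⟩ := hc.free_kind z hz
      exact eq_none_of_kind k1 k2 fun k3 => h2 z ⟨hz, k3, nofun⟩
    · rcases t with _ | ⟨s, _ | p, ch⟩
      · rfl
      · rfl
      · cases hr
  · rintro ⟨⟨h1, h2, h3⟩, hk⟩
    rcases t with _ | ⟨s, _ | p, ch⟩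
    · exact absurd rfl hl
    · have key : ∀ p, ((Tree.node s none ch).graph h).Free p →
        ((Tree.node s none ch).graph h).kind p = none := fun p hp => h2 p hp nofun
      refine ⟨nofun, rfl, fun p hp => ?_, ⟨⟨Tree.isTree h, h1, h3⟩, fun p hp => ?_⟩⟩
      · exact nomatch (key p hp.1).symm.trans hp.2.1
      · rw [key p hp]
        exact ⟨nofun, nofun⟩
    · cases hk

theorem propF0_tree (t : Tree) (h : t.WF) (hl : t ≠ .leaf) :
    propF0 Q (t.graph h) t.root t.mark ↔ t.IsQTree Q ∧ t.Nonneg ∧ t.exc = 0 := by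
  rw [Tree.IsQTree, ← Tree.loc_iff (edgeRel_symm _) h hl]
  constructor
  · rintro ⟨-, y, hy, ⟨hc, hn⟩, he⟩
    refine ⟨⟨⟨hc.word_mem, fun z hz hz' => ?_, fun z hz => hc.edges z hz⟩, ?_⟩,
      (Tree.nonneg_iff h hy).1 hn, by rwa [Tree.excess_root] at he⟩
    · rcases (hc.free_iff z).1 hz with rfl | hk
      · exact absurd hy hz'
      · exact hk
    · rw [Tree.rootKind_eq hy]
      exact congrArg some hc.root_kind
  · rintro ⟨⟨⟨h1, h2, h3⟩, hk⟩, hn, he⟩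
    obtain ⟨y, hy⟩ : ∃ y, t.root = some y := by
      rcases t with _ | ⟨s, _ | p, ch⟩
      · cases hk
      · cases hk
      · exact ⟨_, rfl⟩
    refine ⟨Tree.mark_of_root hy, y, hy, ⟨⟨?_, h1, h3, ?_, fun p => ⟨fun hp => ?_, ?_⟩⟩,
      (Tree.nonneg_iff h hy).2 hn⟩, by rwa [Tree.excess_root]⟩
    · cases t with
      | leaf => exact absurd rfl hl
      | node s p ch => exact Tree.isTree h
    · rw [Tree.rootKind_eq hy] at hk
      exact Option.some.inj hk
    · by_cases hpy : p = y
      · exact .inl hpy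
      · exact .inr (h2 p hp fun e => hpy (by rw [hy] at e; exact (Option.some.inj e).symm))
    · rintro (rfl | hp)
      · exact Tree.root_free h hy
      -- No edge type of a `Q`-tree involves `▲`, so a `▲`-pearl is automatically free.
      · by_contra hf
        have : treeRel ((t.graph h).kind p) _ := h3 p hf
        rw [hp] at this
        simp [treeRel, EdgeRel] at this

variable (Q)

theorem exists_equiv_C (x : Kind) :
    ∃ e : C Q x ≃ {t : Tree // t.IsCompanion Q ∧ t.rootKind = some x}, ∀ c,
      (e c).1.necklaces = c.necklaces ∧ (e c).1.markWord = c.markedNecklace :=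
  IsoClass.exists_equiv_tree (propC Q x) (fun _ => Iff.rfl) (propC_invariant Q x)
    (fun _ h => by
      obtain ⟨h1, -, r, hr, -, hc⟩ := h
      exact ⟨hc.tree, .inl ⟨h1, r, hr, hc.root_free⟩⟩)
    _ (fun _ h => ⟨h.1.wf, h.1.ne_leaf⟩) (propC_tree x)

theorem exists_equiv_markedC :
    ∃ e : IsoClass (IsMarkedC Q) ≃ {t : Tree // t.IsCompanion Q ∧ t.rootKind = none}, ∀ c,
      (e c).1.necklaces = c.necklaces ∧ (e c).1.markWord = c.markedNecklace :=
  IsoClass.exists_equiv_tree (propMarkedC Q) (fun _ => Iff.rfl) (propMarkedC_invariant Q)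
    (fun _ h => ⟨h.2.2.2.tree, .inr ⟨h.2.1, h.1⟩⟩)
    _ (fun _ h => ⟨h.1.wf, h.1.ne_leaf⟩) propMarkedC_tree

theorem exists_equiv_F0 :
    ∃ e : IsoClass (IsF0 Q) ≃ {t : Tree // t.IsQTree Q ∧ t.Nonneg ∧ t.exc = 0}, ∀ c,
      (e c).1.necklaces = c.necklaces ∧ (e c).1.markWord = c.markedNecklace :=
  IsoClass.exists_equiv_tree (propF0 Q) (fun _ => Iff.rfl) (propF0_invariant Q)
    (fun _ h => by
      obtain ⟨h1, r, hr, hc, -⟩ := h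
      exact ⟨hc.1.tree, .inl ⟨h1, r, hr, (hc.1.free_iff r).2 (.inl rfl)⟩⟩)
    _ (fun _ h => ⟨h.1.1.wf, h.1.1.ne_leaf⟩) propF0_tree

end Necklace

/-! ### Weighted generating functions of recursive trees. -/

namespace Necklace

instance : Fintype Letter := ⟨{.bullet, .diamond, .triangle}, fun x => by cases x <;> simp⟩

theorem prod_letter {B : Type*} [CommMonoid B] (f : Letter → B) :
    ∏ x, f x = f .bullet * f .diamond * f .triangle := by
  rw [show (Finset.univ : Finset Letter) = {.bullet, .diamond, .triangle} from rfl,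
    Finset.prod_insert (by simp), Finset.prod_pair (by simp), mul_assoc]

/-- The number of occurrences of a letter in a word. -/
def occ (x : Letter) (s : List Letter) : ℕ := (Finset.univ.filter fun i : Fin s.length => s.get i = x).card

theorem prod_get {B : Type*} [CommMonoid B] (y : Letter → B) (s : List Letter) :
    ∏ i : Fin s.length, y (s.get i) = y .bullet ^ occ .bullet s * y .diamond ^ occ .diamond s *
      y .triangle ^ occ .triangle s := by
  rw [← prod_letter fun x => y x ^ occ x s, ← Finset.prod_fiberwise Finset.univ s.get]
  refine Finset.prod_congr rfl fun x _ => ?_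
  rw [occ, ← Finset.prod_const]
  exact Finset.prod_congr rfl fun i hi => by rw [(Finset.mem_filter.1 hi).2]

/-- Omitting one position lowers the exponent of its own letter by one, which produces the exponents
of the partial derivatives in `IsSystem`. -/
theorem prod_erase_get {B : Type*} [CommMonoid B] (y : Letter → B) (s : List Letter) (j : Fin s.length) :
    ∏ i ∈ Finset.univ.erase j, y (s.get i) = ∏ x, y x ^ (occ x s - if s.get j = x then 1 else 0) := by
  rw [← Finset.prod_fiberwise _ s.get]
  refine Finset.prod_congr rfl fun x _ => ?_
  have : (Finset.univ.erase j).filter (fun i => s.get i = x) =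
      (Finset.univ.filter fun i => s.get i = x).erase j := by
    ext i; simp
  rw [this, Finset.prod_congr rfl (g := fun _ => y x), Finset.prod_const]
  · congr 1
    split_ifs with h
    · rw [Finset.card_erase_of_mem (by simpa using h), occ]
    · rw [Finset.erase_eq_of_notMem (by simpa using h), occ, Nat.sub_zero]
  · intro i hi
    rw [(Finset.mem_filter.1 (Finset.mem_of_mem_erase hi)).2]

namespace Tree

/-- The number of trees with at most `n` necklaces, all of them in `S`, is finite. -/
theorem finite_card_le (S : Finset (List Letter)) (n : ℕ) :
    {t : Tree | t.necklaces.card ≤ n ∧ ∀ s ∈ t.necklaces, s ∈ S}.Finite := by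
  induction n with
  | zero =>
    refine (Set.finite_singleton leaf).subset ?_
    rintro (_ | ⟨s, p, ch⟩) ⟨h, -⟩
    · rfl
    · simp [necklaces] at h
  | succ n ih =>
    have : Finite ↥{t : Tree | t.necklaces.card ≤ n ∧ ∀ s ∈ t.necklaces, s ∈ S} := ih
    let g : (Σ s : S, Option (Pos s.1) × (Pos s.1 → {t : Tree | t.necklaces.card ≤ n ∧
        ∀ s ∈ t.necklaces, s ∈ S})) → Tree := fun x => node x.1.1 x.2.1 fun q => x.2.2 q
    refine ((Set.finite_range g).union (Set.finite_singleton leaf)).subset ?_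
    rintro (_ | ⟨s, p, ch⟩) ⟨h1, h2⟩
    · exact .inr rfl
    · left
      simp only [necklaces, Multiset.card_cons, Nat.add_le_add_iff_right, Multiset.mem_cons,
        Multiset.card_sum] at h1 h2
      refine ⟨⟨⟨s, h2 s (.inl rfl)⟩, p, fun q => ⟨ch q, ?_, fun s' hs' => h2 s' (.inr ?_)⟩⟩, rfl⟩
      · exact (Finset.single_le_sum (f := fun q => (ch q).necklaces.card) (fun _ _ => Nat.zero_le _)
          (Finset.mem_univ q)).trans h1
      · exact Multiset.mem_sum.2 ⟨q, Finset.mem_univ q, hs'⟩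

theorem finite_necklaces_eq (M : Multiset (List Letter)) : {t : Tree | t.necklaces = M}.Finite := by
  classical
  refine (finite_card_le M.toFinset M.card).subset ?_
  rintro t rfl
  exact ⟨le_rfl, fun s hs => Multiset.mem_toFinset.2 hs⟩

section weight
variable {R : Type*} [CommRing R] (x : List Letter → R)

/-- The product of the weights of the necklaces of a tree. -/
def weight (t : Tree) : R := (t.necklaces.map x).prod

theorem weight_node (s : List Letter) (p : Option (Pos s)) (ch : Pos s → Tree) :
    (node s p ch).weight x = x s * ∏ q, (ch q).weight x := by
  have h := map_sum (Multiset.mapAddMonoidHom x) (fun q => (ch q).necklaces) Finset.univ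
  simp only [Multiset.coe_mapAddMonoidHom] at h
  simp only [weight, necklaces, Multiset.map_cons, Multiset.prod_cons, h, Multiset.prod_sum]

@[simp] theorem weight_leaf : leaf.weight x = 1 := by simp [weight, necklaces]

/-- A tree with more than `N` necklaces has its weight in `I ^ N = ⊥`, and a necklace outside `S`
has weight zero. Every `finsum` of weights is therefore a genuine finite sum. -/
theorem weight_support_finite {I : Ideal R} {N : ℕ} (hI : I ^ N = ⊥) (S : Finset (List Letter))
    (hx : ∀ s, x s ∈ I) (hS : ∀ s, s ∉ S → x s = 0) : {t : Tree | t.weight x ≠ 0}.Finite := by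
  refine (finite_card_le S N).subset fun t ht => ⟨?_, fun s hs => ?_⟩
  · by_contra hN
    have key : ∀ M : Multiset (List Letter), (M.map x).prod ∈ I ^ M.card := fun M => by
      induction M using Multiset.induction with
      | empty => simp
      | cons a M ih =>
        rw [Multiset.map_cons, Multiset.prod_cons, Multiset.card_cons, pow_succ']
        exact Ideal.mul_mem_mul (hx a) ih
    have := Ideal.pow_le_pow_right (Nat.le_of_lt (not_le.1 hN)) (key t.necklaces)
    rw [hI] at this
    exact ht this
  · by_contra hs'
    exact ht (Multiset.prod_eq_zero (Multiset.mem_map.2 ⟨s, hs, hS s hs'⟩))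

end weight

open Classical in
/-- The generating function of a class of trees in terms of the classes of the attached trees. -/
theorem finsum_node {B : Type*} [CommRing B] (S : Finset (List Letter)) (x : List Letter → B)
    (hS : ∀ s, s ∉ S → x s = 0) (T : Set Tree) (hleaf : leaf ∉ T)
    (root : ∀ s : List Letter, Option (Pos s) → Prop) (slot : Kind → Set Tree)
    (hT : ∀ s ∈ S, ∀ p ch, node s p ch ∈ T ↔ root s p ∧ ∀ q,
      (p = some q → ch q = leaf) ∧ (p ≠ some q → ch q ∈ slot (posKind s q)))
    (w : Tree → B) (w' : Kind → Tree → B)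
    (hw : ∀ s p ch, node s p ch ∈ T → w (node s p ch) =
      x s * ∏ q, if p = some q then 1 else w' (posKind s q) (ch q))
    (hfin : ∀ k, (slot k ∩ Function.support (w' k)).Finite) :
    ∑ᶠ t ∈ T, w t = ∑ s ∈ S, ∑ p with root s p, x s *
      ∏ q, if p = some q then 1 else ∑ᶠ t ∈ slot (posKind s q), w' (posKind s q) t := by
  let F : ∀ s : List Letter, Option (Pos s) → Pos s → Finset Tree := fun s p q =>
    if p = some q then {leaf} else (hfin (posKind s q)).toFinset
  let W : ∀ s : List Letter, Option (Pos s) → Pos s → Tree → B := fun s p q t =>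
    if p = some q then 1 else w' (posKind s q) t
  have hF : ∀ s p q, (if p = some q then 1 else ∑ᶠ t ∈ slot (posKind s q), w' (posKind s q) t) =
      ∑ t ∈ F s p q, W s p q t := by
    intro s p q
    by_cases hq : p = some q
    · simp [F, W, hq]
    · simp only [F, W, hq, if_false]
      exact finsum_mem_eq_sum _ (hfin _)
  simp only [hF, Finset.prod_univ_sum]
  simp only [Finset.mul_sum]
  rw [Finset.sum_congr rfl fun s _ => Finset.sum_sigma' _ _ _, Finset.sum_sigma']
  let g : (Σ s : List Letter, Σ _ : Option (Pos s), Pos s → Tree) → Tree := fun y =>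
    node y.1 y.2.1 y.2.2
  have hg : Function.Injective g := by
    rintro ⟨s, p, ch⟩ ⟨s', p', ch'⟩ h
    injection h with h1 h2 h3
    subst h1
    cases h2
    cases h3
    rfl
  set D := S.sigma fun s => (Finset.univ.filter (root s)).sigma fun p => Fintype.piFinset (F s p) with hD
  have hmem : ∀ y ∈ D, g y ∈ T := by
    rintro ⟨s, p, ch⟩ hy
    simp only [hD, Finset.mem_sigma, Finset.mem_filter, Finset.mem_univ, true_and,
      Fintype.mem_piFinset] at hy
    refine (hT s hy.1 p ch).2 ⟨hy.2.1, fun q => ⟨fun hq => ?_, fun hq => ?_⟩⟩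
    · simpa [F, hq] using hy.2.2 q
    · have := hy.2.2 q
      simp only [F, hq, if_false, Set.Finite.mem_toFinset] at this
      exact this.1
  -- A tree of `T` outside this finite image has weight zero: its top word lies outside `S`, or one
  -- of its children has zero weight.
  have himg : ∑ᶠ t ∈ T, w t = ∑ t ∈ D.image g, w t := by
    refine finsum_mem_eq_sum_of_inter_support_eq _ ?_
    ext t
    simp only [Set.mem_inter_iff, Function.mem_support, Finset.coe_image, Set.mem_image,
      Finset.mem_coe]
    refine ⟨?_, ?_⟩
    · rintro ⟨ht, hwt⟩
      rcases t with _ | ⟨s, p, ch⟩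
      · exact absurd ht hleaf
      have hwt' := hwt
      rw [hw s p ch ht] at hwt'
      have hs : s ∈ S := by
        by_contra hs
        rw [hS s hs, zero_mul] at hwt'
        exact hwt' rfl
      obtain ⟨hr, hq⟩ := (hT s hs p ch).1 ht
      refine ⟨⟨⟨s, p, ch⟩, ?_, rfl⟩, hwt⟩
      simp only [hD, Finset.mem_sigma, Finset.mem_filter, Finset.mem_univ, true_and,
        Fintype.mem_piFinset]
      refine ⟨hs, hr, fun q => ?_⟩
      by_cases hpq : p = some q
      · simp only [F, hpq, if_true, Finset.mem_singleton]
        exact (hq q).1 hpq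
      · simp only [F, hpq, if_false, Set.Finite.mem_toFinset]
        refine ⟨(hq q).2 hpq, fun h0 => hwt' ?_⟩
        rw [Finset.prod_eq_zero (Finset.mem_univ q) (by rw [if_neg hpq, h0]), mul_zero]
    · rintro ⟨⟨y, hy, rfl⟩, hwt⟩
      exact ⟨hmem y hy, hwt⟩
  rw [himg, Finset.sum_image hg.injOn]
  exact Finset.sum_congr rfl fun y hy => hw _ _ _ (hmem y hy)

end Tree
end Necklace

/-! ### The algebraic system for the series of companion trees. -/

namespace Necklace

namespace Tree

variable {R : Type*} [CommRing R] (Q : Set (List Letter)) (x : List Letter → R)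

/-- The trees that describe companion trees without defects with a root pearl of kind `k`. -/
def compSet (k : Kind) : Set Tree := {t | t.IsCompanion Q ∧ t.rootKind = some k}

/-- The generating function of `compSet`. -/
noncomputable def compGF (k : Kind) : R := ∑ᶠ t ∈ compSet Q k, t.weight x

/-- What can be attached to a pearl of kind `k` of a companion tree without defects. -/
def compSlot (k : Kind) : Set Tree :=
  {t | (t = leaf ∧ k = none) ∨ ∃ k', t.rootKind = some k' ∧ companionRel k k' ∧ t.IsCompanion Q}

theorem compSlot_some (y : Letter) : compSlot Q (some y) = compSet Q y.partner := by
  ext t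
  constructor
  · rintro (⟨-, h⟩ | ⟨k', h1, h2, h3⟩)
    · cases h
    · refine ⟨h3, h1.trans (congrArg some ?_)⟩
      rcases y with _ | _ | _ <;> rcases k' with _ | _ | _ | _ <;>
        simp [companionRel, EdgeRel, Letter.partner] at h2 ⊢
  · rintro ⟨h1, h2⟩
    refine .inr ⟨_, h2, ?_, h1⟩
    rcases y with _ | _ | _ <;> simp [companionRel, EdgeRel, Letter.partner]

/-- A non-root `□` may stay free or carry a tree rooted at `●`; this is the source of the factor `1
+ C_●`. -/
theorem compSlot_none : compSlot Q none = insert leaf (compSet Q (some .bullet)) := by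
  ext t
  constructor
  · rintro (⟨h, -⟩ | ⟨k', h1, h2, h3⟩)
    · exact .inl h
    · refine .inr ⟨h3, h1.trans (congrArg some ?_)⟩
      rcases k' with _ | _ | _ | _ <;> simp [companionRel, EdgeRel] at h2 ⊢
  · rintro (h | ⟨h1, h2⟩)
    · exact .inl ⟨h, rfl⟩
    · exact .inr ⟨_, h2, by simp [companionRel, EdgeRel], h1⟩

variable {Q x} {S : Finset (List Letter)}
  (hfin : {t : Tree | t.weight x ≠ 0}.Finite) (hS : ∀ s, s ∉ S → x s = 0) (hQ : ∀ s ∈ S, s ∈ Q)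

include hfin in
theorem finsum_compSlot_none :
    ∑ᶠ t ∈ compSlot Q none, t.weight x = 1 + compGF Q x (some .bullet) := by
  rw [compSlot_none, finsum_mem_insert' _ (fun h => h.1.ne_leaf rfl)
    (hfin.subset fun t ht => ht.2), weight_leaf]
  rfl

-- The predicate `root` prescribes the position of the root on the top necklace, so that one
-- computation covers trees rooted at `□`, trees rooted at a letter, and trees with only a marked
-- necklace.
include hfin hS hQ in
open Classical in
theorem finsum_comp (root : ∀ s : List Letter, Option (Pos s) → Prop) :
    ∑ᶠ t ∈ {t : Tree | t.IsCompanion Q ∧ ∃ s p ch, t = node s p ch ∧ root s p}, t.weight x =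
      ∑ s ∈ S, ∑ p with root s p, x s *
        ((if p = some none then 1 else 1 + compGF Q x (some .bullet)) *
        ∏ i : Fin s.length, if p = some (some i) then 1 else compGF Q x (s.get i).partner) := by
  rw [finsum_node S x hS _ (fun h => h.1.ne_leaf rfl) root (compSlot Q) _ _ (fun _ => weight x)]
  · refine Finset.sum_congr rfl fun s _ => Finset.sum_congr rfl fun p _ => ?_
    rw [Fintype.prod_option]
    simp only [posKind, Option.map_none, Option.map_some, compSlot_some]
    rw [finsum_compSlot_none hfin]
    rfl
  · intro s p ch h
    rw [weight_node]
    congr 1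
    refine Finset.prod_congr rfl fun q _ => ?_
    split_ifs with hq
    · rw [(h.1.2 q).1 hq, weight_leaf]
    · rfl
  · exact fun k => hfin.subset fun t ht => ht.2
  · intro s hs p ch
    constructor
    · rintro ⟨h, s', p', ch', e, hr⟩
      cases e
      exact ⟨hr, fun q => ⟨(h.2 q).1, (h.2 q).2⟩⟩
    · rintro ⟨hr, h⟩
      exact ⟨⟨hQ s hs, h⟩, s, p, ch, rfl, hr⟩

-- The root occupies the `□` of its necklace, so nothing is attached there and no factor `1 + C_●`
-- appears.
include hfin hS hQ in
theorem compGF_none : compGF Q x none = mono S (occ .bullet) (occ .diamond) (occ .triangle) x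
    (compGF Q x none) (compGF Q x (some .triangle)) (compGF Q x (some .diamond)) := by
  classical
  have h := finsum_comp hfin hS hQ fun s p => p = some none
  have e : {t : Tree | t.IsCompanion Q ∧ ∃ s p ch, t = node s p ch ∧ p = some none} = compSet Q none := by
    ext t
    refine and_congr_right fun ht => ?_
    rcases t with _ | ⟨s, _ | _ | p, ch⟩
    · exact absurd rfl ht.ne_leaf
    · exact ⟨fun ⟨_, _, _, e, h⟩ => (by cases e; cases h), nofun⟩
    · exact ⟨fun _ => rfl, fun _ => ⟨_, _, _, rfl, rfl⟩⟩
    · exact ⟨fun ⟨_, _, _, e, h⟩ => (by cases e; cases h), nofun⟩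
  rw [e] at h
  refine h.trans (Finset.sum_congr rfl fun s _ => ?_)
  refine (Finset.sum_eq_single_of_mem (some none) (by simp)
    fun p hp h => absurd (by simpa using hp) h).trans ?_
  simp only [if_true, one_mul, Option.some.injEq, reduceCtorEq, if_false]
  rw [prod_get fun y => compGF Q x y.partner]
  rfl

-- The root is one of the `occ y s` positions with letter `y`. The other letters give a partial
-- derivative of `Q`, and the non-root `□` gives the factor `1 + C_●`.
include hfin hS hQ in
open Classical in
theorem compGF_some (y : Letter) : compGF Q x (some y) = (1 + compGF Q x (some .bullet)) *
    ∑ s ∈ S, x s * (occ y s * ∏ z, compGF Q x z.partner ^ (occ z s - if y = z then 1 else 0)) := by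
  have h := finsum_comp hfin hS hQ fun s p => ∃ j, p = some (some j) ∧ s.get j = y
  have e : {t : Tree | t.IsCompanion Q ∧ ∃ s p ch, t = node s p ch ∧
      ∃ j, p = some (some j) ∧ s.get j = y} = compSet Q (some y) := by
    ext t
    refine and_congr_right fun ht => ?_
    rcases t with _ | ⟨s, _ | _ | p, ch⟩
    · exact absurd rfl ht.ne_leaf
    · exact ⟨fun ⟨_, _, _, e, _, h, _⟩ => (by cases e; cases h), nofun⟩
    · exact ⟨fun ⟨_, _, _, e, _, h, _⟩ => (by cases e; cases h), nofun⟩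
    · constructor
      · rintro ⟨_, _, _, e, j, hj, hy⟩
        cases e
        cases hj
        rw [← hy]; rfl
      · intro h
        exact ⟨s, _, ch, rfl, p, rfl, Option.some.inj (Option.some.inj h)⟩
  rw [e] at h
  rw [compGF, h, Finset.mul_sum]
  refine Finset.sum_congr rfl fun s _ => ?_
  rw [Finset.sum_filter, Fintype.sum_option, Fintype.sum_option, if_neg (by simp), if_neg (by simp),
    zero_add, zero_add]
  simp only [Option.some.injEq, exists_eq_left', reduceCtorEq, if_false]
  rw [← Finset.sum_filter, Finset.sum_congr rfl (g := fun _ => x s * ((1 + compGF Q x (some .bullet)) *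
    ∏ z, compGF Q x z.partner ^ (occ z s - if y = z then 1 else 0))), Finset.sum_const, nsmul_eq_mul, occ]
  · ring
  · intro j hj
    have hj := (Finset.mem_filter.1 hj).2
    have := prod_erase_get (fun z => compGF Q x z.partner) s j
    rw [hj] at this
    rw [← this, ← Finset.mul_prod_erase Finset.univ _ (Finset.mem_univ j), if_pos rfl, one_mul]
    congr 2
    refine Finset.prod_congr rfl fun i hi => if_neg fun e => ?_
    exact (Finset.mem_erase.1 hi).1 e.symm

-- The crossing of `♦` and `▲` comes from `Letter.partner`: a `♦` carries a tree rooted at `▲`, so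
-- the variable of `♦` has the value `C_▲`, whereas a root at `♦` differentiates in that variable
-- and gives the equation of `C_♦`.
include hfin hS hQ in
theorem isSystem_comp : IsSystem S (occ .bullet) (occ .diamond) (occ .triangle) x
    (1 + compGF Q x (some .bullet)) (compGF Q x none) (compGF Q x (some .triangle))
    (compGF Q x (some .diamond)) := by
  refine ⟨compGF_none hfin hS hQ, ?_, ?_, ?_⟩
  · conv_lhs => rw [compGF_some hfin hS hQ]
    refine congrArg (1 + ·) (congrArg _ (Finset.sum_congr rfl fun s _ => ?_))
    simp [prod_letter, Letter.partner, mul_assoc]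
  · conv_lhs => rw [compGF_some hfin hS hQ]
    refine congrArg _ (Finset.sum_congr rfl fun s _ => ?_)
    simp [prod_letter, Letter.partner]
    ring
  · conv_lhs => rw [compGF_some hfin hS hQ]
    refine congrArg _ (Finset.sum_congr rfl fun s _ => ?_)
    simp [prod_letter, Letter.partner]
    ring

include hfin hS hQ in
/-- The generating function of the companion trees with a marked necklace `s₀`. -/
theorem markedGF (s₀ : List Letter) (hs₀ : s₀ ∈ S) :
    ∑ᶠ t ∈ {t : Tree | (t.IsCompanion Q ∧ t.rootKind = none) ∧ t.markWord = some s₀}, t.weight x =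
    x s₀ * ((1 + compGF Q x (some .bullet)) * (compGF Q x none ^ occ .bullet s₀ *
      compGF Q x (some .triangle) ^ occ .diamond s₀ * compGF Q x (some .diamond) ^ occ .triangle s₀)) := by
  classical
  have h := finsum_comp hfin hS hQ fun s p => p = none ∧ s = s₀
  have e : {t : Tree | t.IsCompanion Q ∧ ∃ s p ch, t = node s p ch ∧ p = none ∧ s = s₀} =
      {t : Tree | (t.IsCompanion Q ∧ t.rootKind = none) ∧ t.markWord = some s₀} := by
    ext t
    rw [Set.mem_ofPred_eq, Set.mem_ofPred_eq, and_assoc]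
    refine and_congr_right fun ht => ?_
    rcases t with _ | ⟨s, _ | p, ch⟩
    · exact absurd rfl ht.ne_leaf
    · exact ⟨fun ⟨_, _, _, e, _, h⟩ => (by cases e; exact ⟨rfl, congrArg some h⟩),
        fun ⟨_, h⟩ => ⟨_, _, _, rfl, rfl, Option.some.inj h⟩⟩
    · exact ⟨fun ⟨_, _, _, e, h, _⟩ => (by cases e; cases h), nofun⟩
  rw [e] at h
  rw [h, Finset.sum_eq_single_of_mem s₀ hs₀]
  · refine (Finset.sum_eq_single_of_mem none (by simp)
      fun p hp h => absurd (by simpa using hp) h).trans ?_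
    simp only [reduceCtorEq, if_false]
    rw [prod_get fun y => compGF Q x y.partner]
    rfl
  · intro s _ hs
    simp [hs]

end Tree
end Necklace

/-! ### The catalytic equation for non-negative `Q`-trees. -/

section

open Polynomial

namespace Necklace

namespace Tree

variable {R : Type*} [CommRing R] (Q : Set (List Letter)) (x : List Letter → R)

/-- The trees that describe non-negative `Q`-trees. -/
def nonnegSet : Set Tree := {t | t.IsQTree Q ∧ t.Nonneg}

/-- What can be attached to a non-root pearl of kind `k` of a non-negative `Q`-tree. -/
def treeSlot (k : Kind) : Set Tree :=
  {t | (t = leaf ∧ k = some .triangle) ∨ treeRel k none ∧ t ∈ nonnegSet Q ∧ 0 ≤ Kind.exc k + t.exc}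

/-- The weight of a tree attached to a pearl of kind `k`, where the variable records the excess of the
pearl. -/
noncomputable def excWeight (k : Kind) (t : Tree) : R[X] :=
  Polynomial.C (t.weight x) * X ^ (Kind.exc k + t.exc).toNat

/-- The generating function of non-negative `Q`-trees. -/
noncomputable def nonnegGF : R[X] := ∑ᶠ t ∈ nonnegSet Q, excWeight x none t

variable {Q}

theorem Nonneg.exc_nonneg {t : Tree} (h : t.Nonneg) : 0 ≤ t.exc := by
  rcases t with _ | ⟨s, p, ch⟩
  · exact le_rfl
  · exact h.1

/-- Only the conditions at the non-root pearls of the top necklace matter. The total excess is the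
sum of theirs, since the root `□` contributes zero, so its sign is automatic. -/
theorem node_mem_nonnegSet {s : List Letter} (hs : s ∈ Q) (p : Option (Pos s)) (ch : Pos s → Tree) :
    node s p ch ∈ nonnegSet Q ↔ p = some none ∧ ∀ q, (p = some q → ch q = leaf) ∧
      (p ≠ some q → ch q ∈ treeSlot Q (posKind s q)) := by
  have hrel : ∀ {y : Letter} {k : Kind}, treeRel (some y) k → k = none := fun {y k} h => by
    rcases y with _ | _ | _ <;> rcases k with _ | _ | _ | _ <;> simp [treeRel, EdgeRel] at h ⊢
  constructor
  · rintro ⟨⟨h1, h2⟩, h3⟩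
    have hp : p = some none := by
      rcases p with _ | _ | p
      · cases h2
      · rfl
      · cases h2
    subst hp
    refine ⟨rfl, fun q => ⟨(h1.2 q).1, fun hq => ?_⟩⟩
    rcases (h1.2 q).2 hq with h | ⟨k, hk, hr, h⟩
    · exact .inl h
    · rcases q with _ | i
      · exact absurd rfl hq
      obtain rfl := hrel hr
      exact .inr ⟨hr, ⟨⟨h, hk⟩, (h3.2 _ hq).2⟩, (h3.2 _ hq).1⟩
  · rintro ⟨rfl, h⟩
    have hn : ∀ q, some none ≠ some q → 0 ≤ Kind.exc (posKind s q) + (ch q).exc ∧ (ch q).Nonneg :=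
      fun q hq => by
        rcases (h q).2 hq with ⟨h1, h2⟩ | ⟨h1, h2, h3⟩
        · rw [h1, h2]
          exact ⟨zero_le_one, trivial⟩
        · exact ⟨h3, h2.2⟩
    refine ⟨⟨⟨hs, fun q => ⟨(h q).1, fun hq => ?_⟩⟩, rfl⟩, Finset.sum_nonneg fun q _ => ?_, hn⟩
    · rcases (h q).2 hq with h | ⟨h1, h2, h3⟩
      · exact .inl h
      · exact .inr ⟨_, h2.1.2, h1, h2.1.1⟩
    · by_cases hq : some none = some q
      · rw [(h q).1 hq]
        cases hq
        exact le_rfl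
      · exact (hn q hq).1

/-- Excesses add over the pearls of the top necklace. Non-negativity of each summand is what lets
`Int.toNat` commute with this sum. -/
theorem excWeight_node {s : List Letter} (p : Option (Pos s)) (ch : Pos s → Tree)
    (h : node s p ch ∈ nonnegSet Q) [∀ q : Pos s, Decidable (p = some q)] :
    excWeight x none (node s p ch) = Polynomial.C (x s) *
      ∏ q, if p = some q then 1 else excWeight x (posKind s q) (ch q) := by
  obtain ⟨rfl, h'⟩ := (node_mem_nonnegSet h.1.1.1 _ _).1 h
  have hq : ∀ q, (if some none = some q then 1 else excWeight x (posKind s q) (ch q)) =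
      excWeight x (posKind s q) (ch q) := fun q => by
    split_ifs with hq
    · rw [(h' q).1 hq]
      cases hq
      simp [excWeight, posKind, Kind.exc, exc]
    · rfl
  have hn : ∀ q, 0 ≤ Kind.exc (posKind s q) + (ch q).exc := fun q => by
    by_cases hq : some none = some q
    · rw [(h' q).1 hq]
      cases hq
      exact le_rfl
    · exact (h.2.2 q hq).1
  simp only [hq]
  have e : (Kind.exc none + (node s (some none) ch).exc).toNat =
      ∑ q, (Kind.exc (posKind s q) + (ch q).exc).toNat := by
    zify
    rw [Int.toNat_of_nonneg (a := Kind.exc none + _) (add_nonneg le_rfl h.2.exc_nonneg)]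
    simp only [Int.toNat_of_nonneg (hn _)]
    exact zero_add _
  rw [excWeight, e, weight_node]
  simp only [excWeight, Finset.prod_mul_distrib, Finset.prod_pow_eq_pow_sum, map_mul, map_prod]
  ring

variable {x} {S : Finset (List Letter)}
  (hfin : {t : Tree | t.weight x ≠ 0}.Finite) (hS : ∀ s, s ∉ S → x s = 0) (hQ : ∀ s ∈ S, s ∈ Q)

include hfin in
theorem support_excWeight_finite (k : Kind) : (Function.support (excWeight x k)).Finite :=
  hfin.subset fun t ht ht' => ht (by simp [excWeight, ht'])

theorem finsum_treeSlot_bullet :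
    ∑ᶠ t ∈ treeSlot Q (some .bullet), excWeight x (some .bullet) t = nonnegGF Q x := by
  have : treeSlot Q (some .bullet) = nonnegSet Q := by
    ext t
    constructor
    · rintro (⟨-, h⟩ | ⟨-, h, -⟩)
      · cases h
      · exact h
    · exact fun h => .inr ⟨by simp [treeRel, EdgeRel], h, add_nonneg le_rfl h.2.exc_nonneg⟩
  rw [this]
  rfl

/-- A `▲` is free and has excess one, hence contributes exactly the variable. -/
theorem finsum_treeSlot_triangle :
    ∑ᶠ t ∈ treeSlot Q (some .triangle), excWeight x (some .triangle) t = X := by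
  have : treeSlot Q (some .triangle) = {leaf} := by
    ext t
    constructor
    · rintro (⟨h, -⟩ | ⟨h, -⟩)
      · exact h
      · simp [treeRel, EdgeRel] at h
    · exact fun h => .inl ⟨h, rfl⟩
  rw [this, finsum_mem_singleton]
  simp [excWeight, Kind.exc, exc]

-- A `♦` lowers the excess by one, and non-negativity at it excludes trees of excess zero. On the
-- monomials of the series this is what `divX` does: it drops the constant term and divides by `X`.
include hfin in
theorem finsum_treeSlot_diamond :
    ∑ᶠ t ∈ treeSlot Q (some .diamond), excWeight x (some .diamond) t = divX (nonnegGF Q x) := by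
  have h := AddMonoidHom.map_finsum_mem' (s := nonnegSet Q) (f := excWeight x none) (divX_hom (R := R))
    ((support_excWeight_finite hfin none).subset fun t ht => ht.2)
  refine Eq.trans ?_ h.symm
  rw [finsum_mem_def, finsum_mem_def]
  refine finsum_congr fun t => ?_
  by_cases ht : t ∈ nonnegSet Q
  · have h0 := ht.2.exc_nonneg
    rw [Set.indicator_of_mem ht, divX_hom_toFun, excWeight, divX_C_mul_X_pow]
    split_ifs with h1
    · refine Set.indicator_of_notMem ?_ _
      rintro (⟨rfl, -⟩ | ⟨-, -, h⟩)
      · exact ht.1.1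
      · simp only [Kind.exc] at h h1
        omega
    · simp only [Kind.exc] at h1
      rw [Set.indicator_of_mem, excWeight]
      · congr 2
        simp only [Kind.exc]
        omega
      · refine .inr ⟨by simp [treeRel, EdgeRel], ht, ?_⟩
        simp only [Kind.exc]
        omega
  · rw [Set.indicator_of_notMem ht, Set.indicator_of_notMem]
    rintro (⟨-, h⟩ | ⟨-, h, -⟩)
    · cases h
    · exact ht h

include hfin hS hQ in
theorem nonnegGF_eq : nonnegGF Q x = mono S (occ .bullet) (occ .diamond) (occ .triangle)
    (Polynomial.C ∘ x) (nonnegGF Q x) (divX (nonnegGF Q x)) X := by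
  classical
  refine (finsum_node S (Polynomial.C ∘ x) (fun s hs => by simp [hS s hs]) (nonnegSet Q) (fun h => h.1.1)
    (fun _ p => p = some none) (treeSlot Q) (fun s hs => node_mem_nonnegSet (hQ s hs)) (excWeight x none)
    (excWeight x) (fun s p ch h => excWeight_node x p ch h)
    fun k => (support_excWeight_finite hfin k).subset fun t ht => ht.2).trans
      (Finset.sum_congr rfl fun s _ => ?_)
  refine (Finset.sum_eq_single_of_mem (some none) (by simp)
    fun p hp h => absurd (by simpa using hp) h).trans ?_
  rw [Fintype.prod_option, if_pos rfl, one_mul]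
  simp only [Option.some.injEq, reduceCtorEq, if_false, posKind, Option.map_some]
  rw [prod_get fun y => ∑ᶠ t ∈ treeSlot Q (some y), excWeight x (some y) t, finsum_treeSlot_bullet,
    finsum_treeSlot_triangle, finsum_treeSlot_diamond hfin]

-- The exponent of the variable is the excess of the root, so the constant term selects excess `0`.
include hfin in
theorem coeff_nonnegGF : (nonnegGF Q x).coeff 0 =
    ∑ᶠ t ∈ {t : Tree | t.IsQTree Q ∧ t.Nonneg ∧ t.exc = 0}, t.weight x := by
  have h := AddMonoidHom.map_finsum_mem' (s := nonnegSet Q) (f := excWeight x none)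
    (lcoeff R 0).toAddMonoidHom ((support_excWeight_finite hfin none).subset fun t ht => ht.2)
  refine h.trans ?_
  rw [finsum_mem_def, finsum_mem_def]
  refine finsum_congr fun t => ?_
  by_cases ht : t ∈ nonnegSet Q
  · have h0 := ht.2.exc_nonneg
    rw [Set.indicator_of_mem ht]
    change coeff (Polynomial.C (t.weight x) * X ^ (0 + t.exc).toNat) 0 = _
    rw [coeff_C_mul, coeff_X_pow, zero_add]
    by_cases h1 : t.exc = 0
    · have h2 : t ∈ {t : Tree | t.IsQTree Q ∧ t.Nonneg ∧ t.exc = 0} := ⟨ht.1, ht.2, h1⟩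
      rw [Set.indicator_of_mem h2, h1]
      simp
    · rw [Set.indicator_of_notMem fun h => h1 h.2.2, if_neg (by omega), mul_zero]
  · rw [Set.indicator_of_notMem ht, Set.indicator_of_notMem fun h => ht ⟨h.1, h.2.1⟩]

end Tree
end Necklace

end

/-! ### Truncated polynomials and the count for a fixed multiset of necklaces. -/

namespace Necklace

namespace Tree

theorem Loc.mem_of_mem_necklaces {Q : Set (List Letter)} {A : Kind → Prop} {E : Kind → Kind → Prop} :
    ∀ {t : Tree}, t.Loc Q A E → ∀ s ∈ t.necklaces, s ∈ Q
  | leaf, h, _, _ => h.elim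
  | node s p ch, h, s', hs' => by
    rcases Multiset.mem_cons.1 hs' with rfl | hs'
    · exact h.1
    · obtain ⟨q, -, hq⟩ := Multiset.mem_sum.1 hs'
      have hl : ch q ≠ leaf := fun e => by rw [e] at hq; exact absurd hq (Multiset.notMem_zero _)
      by_cases hp : p = some q
      · exact absurd ((h.2 q).1 hp) hl
      · rcases (h.2 q).2 hp with h' | ⟨k, -, -, h'⟩
        · exact absurd h'.1 hl
        · exact h'.mem_of_mem_necklaces s' hq

theorem mem_necklaces_of_markWord : ∀ {t : Tree} {s}, t.markWord = some s → s ∈ t.necklaces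
  | node _ none _, _, h => Multiset.mem_cons.2 (.inl (Option.some.inj h).symm)

section truncation

variable (σ : Type) (N : ℕ)

/-- The ring of polynomials truncated at total degree `N`. -/
abbrev Truncated : Type := MvPolynomial σ ℤ ⧸ MvPolynomial.idealOfVars σ ℤ ^ N

variable {σ N}

/-- The coefficient of a monomial of degree less than `N`. -/
noncomputable def truncCoeff (m : σ →₀ ℕ) (hm : m.degree < N) : Truncated σ N →+ ℤ :=
  QuotientAddGroup.lift _ (MvPolynomial.lcoeff ℤ m).toAddMonoidHom fun p hp =>
    (MvPolynomial.mem_pow_idealOfVars_iff' N p).1 hp m hm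

/-- The operator `X_s ∂/∂X_s`. -/
noncomputable def euler (s : σ) : Derivation ℤ (MvPolynomial σ ℤ) (MvPolynomial σ ℤ) :=
  (MvPolynomial.X s : MvPolynomial σ ℤ) • MvPolynomial.pderiv s

theorem coeff_euler (s : σ) (p : MvPolynomial σ ℤ) (m : σ →₀ ℕ) :
    (euler s p).coeff m = m s * p.coeff m := by
  classical
  rw [euler, Derivation.smul_apply, smul_eq_mul, MvPolynomial.coeff_X_mul']
  split_ifs with h
  · have h1 : 1 ≤ m s := Nat.one_le_iff_ne_zero.2 (Finsupp.mem_support_iff.1 h)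
    rw [MvPolynomial.coeff_pderiv, tsub_add_cancel_of_le (Finsupp.single_le_iff.2 h1), mul_comm]
    congr 1
    simp only [Finsupp.coe_tsub, Pi.sub_apply, Finsupp.single_eq_same]
    push_cast [h1]
    ring
  · rw [Finsupp.notMem_support_iff.1 h]
    simp

/-- The operator `X_s ∂/∂X_s` on truncated polynomials. -/
noncomputable def truncEuler (s : σ) : Derivation ℤ (Truncated σ N) (Truncated σ N) :=
  Derivation.mk' (AddMonoidHom.toIntLinearMap (QuotientAddGroup.map _ _
    (euler s).toLinearMap.toAddMonoidHom fun p hp =>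
      (MvPolynomial.mem_pow_idealOfVars_iff' N _).2 fun m hm => by
        have := (MvPolynomial.mem_pow_idealOfVars_iff' N p).1 hp m hm
        exact (coeff_euler s p m).trans (by rw [this, mul_zero]))) fun a b => by
    obtain ⟨a, rfl⟩ := Ideal.Quotient.mk_surjective a
    obtain ⟨b, rfl⟩ := Ideal.Quotient.mk_surjective b
    exact congrArg (Ideal.Quotient.mk _) ((euler s).leibniz a b)

theorem truncEuler_mk (s : σ) (p : MvPolynomial σ ℤ) :
    truncEuler s (Ideal.Quotient.mk (MvPolynomial.idealOfVars σ ℤ ^ N) p) = Ideal.Quotient.mk _ (euler s p) :=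
  rfl

theorem truncCoeff_mk (m : σ →₀ ℕ) (hm : m.degree < N) (p : MvPolynomial σ ℤ) :
    truncCoeff m hm (Ideal.Quotient.mk _ p) = p.coeff m :=
  rfl

theorem truncCoeff_truncEuler (m : σ →₀ ℕ) (hm : m.degree < N) (s : σ) (r : Truncated σ N) :
    truncCoeff m hm (truncEuler s r) = m s * truncCoeff m hm r := by
  obtain ⟨p, rfl⟩ := Ideal.Quotient.mk_surjective r
  exact coeff_euler s p m

open Classical in
/-- The weights of necklaces that record the necklaces in `S`. -/
noncomputable def truncVar (S : Finset σ) (s : σ) : Truncated σ N :=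
  if s ∈ S then Ideal.Quotient.mk _ (MvPolynomial.X s) else 0

theorem truncEuler_truncVar (S : Finset σ) (s : σ) :
    truncEuler s (truncVar S s : Truncated σ N) = truncVar S s := by
  rw [truncVar]
  split_ifs
  · rw [truncEuler_mk]
    simp [euler]
  · exact map_zero _

theorem truncEuler_truncVar_of_ne (S : Finset σ) {s s' : σ} (h : s' ≠ s) :
    truncEuler s (truncVar S s' : Truncated σ N) = 0 := by
  rw [truncVar]
  split_ifs
  · rw [truncEuler_mk]
    simp [euler, MvPolynomial.pderiv_X_of_ne h]
  · exact map_zero _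

theorem map_mk_idealOfVars_pow : ((MvPolynomial.idealOfVars σ ℤ).map
    (Ideal.Quotient.mk (MvPolynomial.idealOfVars σ ℤ ^ N))) ^ N = ⊥ := by
  rw [← Ideal.map_pow, Ideal.map_quotient_self]

theorem truncVar_mem (S : Finset σ) (s : σ) : (truncVar S s : Truncated σ N) ∈
    (MvPolynomial.idealOfVars σ ℤ).map (Ideal.Quotient.mk (MvPolynomial.idealOfVars σ ℤ ^ N)) := by
  rw [truncVar]
  split_ifs
  · exact Ideal.mem_map_of_mem _ (Ideal.subset_span ⟨s, rfl⟩)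
  · exact zero_mem _

/-- The weight of a tree is the monomial of its multiset of necklaces, so a coefficient picks out
the trees with a prescribed multiset. A necklace outside `S` has weight zero and cannot occur in
`m`. -/
theorem truncCoeff_prod [DecidableEq σ] (S : Finset σ) (m : σ →₀ ℕ) (hm : m.degree < N) (hS : m.support ⊆ S)
    (K : Multiset σ) :
    truncCoeff m hm (K.map (truncVar S)).prod = if K = Finsupp.toMultiset m then 1 else 0 := by
  by_cases hK : ∀ s ∈ K, s ∈ S
  · have e : (K.map (truncVar S)).prod = Ideal.Quotient.mk (MvPolynomial.idealOfVars σ ℤ ^ N)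
        (MvPolynomial.monomial (Multiset.toFinsupp K) 1) := by
      clear hm hS
      induction K using Multiset.induction with
      | empty => simp
      | cons a K ih =>
        rw [Multiset.map_cons, Multiset.prod_cons, ih fun s hs => hK s (Multiset.mem_cons_of_mem hs),
          truncVar, if_pos (hK a (Multiset.mem_cons_self _ _)), ← map_mul, MvPolynomial.X,
          MvPolynomial.monomial_mul, ← Multiset.singleton_add, map_add, Multiset.toFinsupp_singleton, one_mul]
    rw [e, truncCoeff_mk, MvPolynomial.coeff_monomial]
    refine if_congr ⟨?_, ?_⟩ rfl rfl
    · rintro rfl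
      simp
    · rintro rfl
      simp
  · push Not at hK
    obtain ⟨s, hs, hs'⟩ := hK
    rw [Multiset.prod_eq_zero (Multiset.mem_map.2 ⟨s, hs, if_neg hs'⟩), map_zero, if_neg]
    rintro rfl
    exact hs' (hS (Finsupp.mem_toMultiset _ _ |>.1 hs))

end truncation

/-- The heart of the proof: this is the coefficient of the monomial `M` in the identity of
`derivation_coeff_zero`. The Euler operator of `s` multiplies this coefficient by `M.count s`, the
number of ways to mark a necklace of type `s`. -/
theorem ncard_mul_count [DecidableEq (List Letter)] (Q : Set (List Letter)) (M : Multiset (List Letter)) (s : List Letter) :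
    M.count s * {t : Tree | (t.IsQTree Q ∧ t.Nonneg ∧ t.exc = 0) ∧ t.necklaces = M}.ncard =
      {t : Tree | ((t.IsCompanion Q ∧ t.rootKind = none) ∧ t.markWord = some s) ∧
        t.necklaces = M}.ncard := by
  classical
  by_cases hsM : s ∈ M
  swap
  · rw [Multiset.count_eq_zero_of_notMem hsM, zero_mul, eq_comm, Set.ncard_eq_zero
      ((finite_necklaces_eq M).subset fun t ht => ht.2)]
    refine Set.eq_empty_of_forall_notMem ?_
    rintro t ⟨⟨-, h⟩, rfl⟩
    exact hsM (mem_necklaces_of_markWord h)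
  -- If `M` contains a word outside `Q`, both sets are empty. Otherwise the finite support of `M`
  -- can replace `Q`.
  by_cases hMQ : ∀ s ∈ M, s ∈ Q
  swap
  · have e : ∀ T : Set Tree, (∀ t ∈ T, t.necklaces = M ∧ ∀ s ∈ t.necklaces, s ∈ Q) → T = ∅ := fun T hT =>
      Set.eq_empty_of_forall_notMem fun t ht => hMQ ((hT t ht).1 ▸ (hT t ht).2)
    rw [e {t | (t.IsQTree Q ∧ _) ∧ _} fun t ht => ⟨ht.2, ht.1.1.1.mem_of_mem_necklaces⟩,
      e {t | ((t.IsCompanion Q ∧ _) ∧ _) ∧ _} fun t ht => ⟨ht.2, ht.1.1.1.mem_of_mem_necklaces⟩]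
    simp
  set S := M.toFinset with hSdef
  -- Truncation at `M.card + 1` is the lowest that keeps the coefficient of `M`.
  have hm : (Multiset.toFinsupp M).degree < M.card + 1 := by
    rw [Nat.lt_succ_iff, ← Multiset.toFinsupp_sum_eq]
    exact le_rfl
  let x : List Letter → Truncated (List Letter) (M.card + 1) := truncVar S
  have hS : ∀ s, s ∉ S → x s = 0 := fun s hs => if_neg hs
  have hQ : ∀ s ∈ S, s ∈ Q := fun s hs => hMQ s (Multiset.mem_toFinset.1 hs)
  have hs : s ∈ S := Multiset.mem_toFinset.2 hsM
  have hfin : {t : Tree | t.weight x ≠ 0}.Finite :=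
    weight_support_finite x map_mk_idealOfVars_pow S (truncVar_mem S) hS
  have key : ∀ T : Set Tree, truncCoeff _ hm (∑ᶠ t ∈ T, t.weight x) = ({t ∈ T | t.necklaces = M}.ncard : ℤ) := by
    intro T
    rw [AddMonoidHom.map_finsum_mem' _ (hfin.subset fun t ht => ht.2)]
    have hf : {t ∈ T | t.necklaces = M}.Finite := (finite_necklaces_eq M).subset fun t ht => ht.2
    have h1 : ∀ t : Tree, truncCoeff _ hm (t.weight x) = if t.necklaces = M then 1 else 0 := fun t => by
      refine (truncCoeff_prod S _ hm ?_ _).trans ?_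
      · rw [Multiset.toFinsupp_support]
      · rw [Multiset.toFinsupp_toMultiset]
    simp only [h1]
    rw [finsum_mem_eq_sum_of_inter_support_eq (t := hf.toFinset), Finset.sum_congr rfl (g := fun _ => 1),
      Finset.sum_const, Set.ncard_eq_toFinset_card _ hf]
    · simp
    · intro t ht
      rw [if_pos (hf.mem_toFinset.1 ht).2]
    · ext t
      simp
  have hI := derivation_coeff_zero map_mk_idealOfVars_pow (fun s _ => truncVar_mem S s)
    (isSystem_comp hfin hS hQ) _ (nonnegGF_eq hfin hS hQ) (truncEuler s) s hs
    fun s' _ h => truncEuler_truncVar_of_ne S h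
  -- The Euler operator fixes its own weight, so the right-hand side of `hI` becomes the series of
  -- `markedGF`; the coefficient of `M` is then read on both sides.
  have h := (truncCoeff_truncEuler _ hm s _).symm.trans (congrArg (truncCoeff _ hm) (hI.trans
    ((congrArg (_ * ·) (truncEuler_truncVar S s)).trans
      ((mul_comm _ _).trans (markedGF hfin hS hQ s hs).symm))))
  rw [coeff_nonnegGF hfin, key, key, Multiset.toFinsupp_apply] at h
  exact_mod_cast h

end Tree
end Necklace

/-! ### Rigidity of rooted trees and marked non-negative trees. -/

namespace Necklace

open Necklace.Graph

namespace Tree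

/-- An immersion of a tree is determined by the image of its top necklace or root pearl. -/
theorem Immersion.toFun_eq {V : Type} {G : Graph V} : ∀ {t : Tree} {h : t.WF} (f f' : t.Immersion h G),
    t.rootNode.map (Sum.map f.toFun f.pearl) = t.rootNode.map (Sum.map f'.toFun f'.pearl) →
    f.toFun = f'.toFun
  | .leaf, _, _, _, _ => funext fun x => Empty.elim x
  | node s p ch, h, f, f', e => by
    have hv : f.toFun none = f'.toFun none := by
      cases p
      · exact Sum.inl.inj (Option.some.inj e)
      · exact congrArg Sigma.fst (Sum.inr.inj (Option.some.inj e))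
    funext x
    rcases x with _ | ⟨q, x⟩
    · exact hv
    refine congrFun (Immersion.toFun_eq (f.child q) (f'.child q) ?_) x
    cases hr : (ch q).root with
    | none =>
      have hl : ch q = .leaf := by_contra fun hl => h.root_ne_none q hl hr
      have : (ch q).rootNode = none := by rw [hl]; rfl
      rw [this]
      rfl
    | some y =>
      rw [rootNode_eq hr, Option.map_some, Option.map_some, Sum.map_inr, Sum.map_inr, ← f.pearl_lift,
        ← f'.pearl_lift]
      have hne : (node s p ch).root ≠ some (top q) := by
        cases p with
        | none => exact nofun
        | some q' =>
          intro e
          have := h.1 q' rfl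
          rw [top_inj.1 (Option.some.inj e)] at this
          rw [show (ch q).root = none by rw [this]; rfl] at hr
          cases hr
      have h1 := f.map_mate (top q) hne
      have h2 := f'.map_mate (top q) hne
      rw [mate_top_some hr] at h1 h2
      change f.pearl _ = G.mate (f.pearl _) at h1
      change f'.pearl _ = G.mate (f'.pearl _) at h2
      rw [h1, h2, f.pearl_top_eq f' hv]

/-- A rooted tree has no automorphism but the identity. -/
theorem toEquiv_eq_refl (t : Tree) (h : t.WF) (f : (t.model h).graph.Iso (t.model h).graph)
    (hr : (t.model h).root.map f.pearl = (t.model h).root) (ht : (t.model h).root ≠ none) :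
    f.toEquiv = Equiv.refl _ := by
  have key : ((t.modelIso h).symm.trans f).toEquiv = (t.modelIso h).symm.toEquiv := by
    refine DFunLike.coe_injective (Immersion.toFun_eq (immersionOfIso ((t.modelIso h).symm.trans f))
      (immersionOfIso (t.modelIso h).symm) ?_)
    obtain ⟨y, hy⟩ := Option.ne_none_iff_exists'.1 ht
    have hy1 := t.modelIso_root h
    rw [hy] at hy1 hr
    rw [rootNode_eq hy1.symm, Option.map_some, Option.map_some, Sum.map_inr, Sum.map_inr]
    refine congrArg (some ∘ Sum.inr) ?_
    change ((t.modelIso h).symm.trans f).pearl _ = (t.modelIso h).symm.pearl _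
    rw [Iso.pearl_trans, Iso.pearl_symm, Equiv.symm_apply_apply, Option.some.inj hr]
  ext1 v
  have h2 : f.toEquiv ((t.modelIso h).toEquiv.symm _) = (t.modelIso h).toEquiv.symm _ :=
    congrArg (fun e => e ((t.modelIso h).toEquiv v)) key
  rwa [Equiv.symm_apply_apply] at h2

end Tree

/-- The same graph with another marked necklace. -/
def Decorated.withMark (A : Decorated) (m : Option (Fin A.size)) : Decorated := { A with mark := m }

variable {Q : Set (List Letter)}

theorem isF0_model {t : Tree} (h : t.WF) (hl : t ≠ .leaf) :
    IsF0 Q (t.model h) ↔ t.IsQTree Q ∧ t.Nonneg ∧ t.exc = 0 := by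
  rw [← propF0_tree t h hl, ← t.modelIso_root h, ← t.modelIso_mark h]
  exact (propF0_invariant Q (t.modelIso h) _ _).symm

theorem isF0_of_iso {A B : Decorated} (h : A.Iso B) (hB : IsF0 Q B) : IsF0 Q A := by
  obtain ⟨f, h1, h2⟩ := Decorated.iso_iff.1 h
  refine (propF0_invariant Q f A.root A.mark).1 ?_
  rw [h1, h2]
  exact hB

variable (Q)

/-- Non-negative trees with a marked necklace are pairs of a non-negative tree and one of its necklaces. -/
theorem exists_equiv_markedF0 :
    ∃ e : IsoClass (IsMarkedF0 Q) ≃ Σ t : {t : Tree // t.IsQTree Q ∧ t.Nonneg ∧ t.exc = 0}, t.1.Vtx,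
      ∀ c, (e c).1.1.necklaces = c.necklaces ∧ some ((e c).1.1.word (e c).2) = c.markedNecklace := by
  have wf : ∀ t : {t : Tree // t.IsQTree Q ∧ t.Nonneg ∧ t.exc = 0}, t.1.WF := fun t => t.2.1.1.wf
  have hmod : ∀ t : {t : Tree // t.IsQTree Q ∧ t.Nonneg ∧ t.exc = 0}, IsF0 Q (t.1.model (wf t)) :=
    fun t => (isF0_model _ t.2.1.1.ne_leaf).2 t.2
  -- The model of a recursive tree never has both a root pearl and a mark, so the mark is added to
  -- the model of the rooted tree afterwards.
  let D : (Σ t : {t : Tree // t.IsQTree Q ∧ t.Nonneg ∧ t.exc = 0}, t.1.Vtx) → Decorated := fun x =>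
    (x.1.1.model (wf x.1)).withMark (some ((x.1.1.modelIso (wf x.1)).toEquiv.symm x.2))
  let g : (Σ t : {t : Tree // t.IsQTree Q ∧ t.Nonneg ∧ t.exc = 0}, t.1.Vtx) → IsoClass (IsMarkedF0 Q) :=
    fun x => Quotient.mk _ ⟨D x, nofun, (hmod x.1).2⟩
  have hg : Function.Bijective g := by
    constructor
    · rintro ⟨t, v⟩ ⟨t', v'⟩ h
      obtain ⟨f, hr, hm⟩ := Decorated.iso_iff.1 (Quotient.exact h : (D _).Iso (D _))
      have hi : (t.1.model (wf t)).Iso (t'.1.model (wf t')) := Decorated.iso_iff.2 ⟨f, hr, by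
        rw [(hmod t).1, (hmod t').1]; rfl⟩
      obtain rfl : t = t' := Subtype.ext (Tree.eq_of_model_iso t.2.1.1.ne_leaf t'.2.1.1.ne_leaf hi)
      -- Rigidity makes different markings of one rooted tree non-isomorphic.
      have key : f.toEquiv = Equiv.refl _ := t.1.toEquiv_eq_refl (wf t) f hr fun h => by
        obtain ⟨-, y, hy, -⟩ := hmod t
        exact nomatch hy.symm.trans h
      have h1 : f.toEquiv _ = _ := Option.some.inj hm
      rw [key] at h1
      exact congrArg (Sigma.mk t) ((t.1.modelIso (wf t)).toEquiv.symm.injective h1)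
    · intro c
      induction c using Quotient.ind with
      | _ A =>
        obtain ⟨A, hA1, hA2⟩ := A
        have hA : IsF0 Q (A.withMark none) := ⟨rfl, hA2⟩
        obtain ⟨-, r, hr, hc, -⟩ := hA
        obtain ⟨t, h, hl, hi⟩ := Tree.exists_model (A := A.withMark none)
          ⟨hc.1.tree, .inl ⟨rfl, r, hr, (hc.1.free_iff r).2 (.inl rfl)⟩⟩
        have ht := (isF0_model h hl).1 (isF0_of_iso hi ⟨rfl, hA2⟩)
        obtain ⟨f, hf, -⟩ := Decorated.iso_iff.1 hi
        obtain ⟨v, hv⟩ := Option.ne_none_iff_exists'.1 hA1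
        refine ⟨⟨⟨t, ht⟩, (t.modelIso h).toEquiv (f.toEquiv.symm v)⟩, Quotient.sound
          (Decorated.iso_iff.2 ⟨f, hf, ?_⟩)⟩
        refine Eq.trans ?_ hv.symm
        exact congrArg some ((congrArg f.toEquiv (Equiv.symm_apply_apply _ _)).trans
          (f.toEquiv.apply_symm_apply v))
  refine ⟨(Equiv.ofBijective g hg).symm, fun c => ?_⟩
  obtain ⟨x, rfl⟩ := hg.2 c
  have : (Equiv.ofBijective g hg).symm (g x) = x := (Equiv.ofBijective g hg).symm_apply_apply x
  rw [this]
  refine ⟨(x.1.1.necklaces_model _).symm, congrArg some ?_⟩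
  exact (x.1.1.modelIso (wf x.1)).symm.word_eq x.2 |>.symm

end Necklace

/-! ### The two bijections. -/

namespace Necklace

/-- Finiteness is needed because `Nat.card` does not distinguish infinite types from empty ones; the
bijections of the fibres are then chosen arbitrarily and assembled. -/
theorem exists_equiv_of_card_fiber {X Y K : Type*} (k : X → K) (l : Y → K)
    (hX : ∀ a, Finite {x // k x = a}) (hY : ∀ a, Finite {y // l y = a})
    (h : ∀ a, Nat.card {x // k x = a} = Nat.card {y // l y = a}) : ∃ e : X ≃ Y, ∀ x, l (e x) = k x := by
  have e : ∀ a, {x // k x = a} ≃ {y // l y = a} := fun a =>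
    have := hX a
    have := hY a
    (Finite.card_eq.1 (h a)).some
  refine ⟨(Equiv.sigmaFiberEquiv k).symm.trans ((Equiv.sigmaCongrRight e).trans (Equiv.sigmaFiberEquiv l)),
    fun x => ?_⟩
  exact (e (k x) ⟨x, rfl⟩).2

namespace Tree

theorem card_word_eq [DecidableEq (List Letter)] (t : Tree) (s : List Letter) :
    Nat.card {v : t.Vtx // t.word v = s} = t.necklaces.count s := by
  rw [← sum_word, Multiset.count_sum', Nat.card_eq_fintype_card, Fintype.card_subtype,
    Finset.card_filter]
  refine Finset.sum_congr rfl fun v _ => ?_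
  rw [Multiset.count_singleton]
  exact if_congr eq_comm rfl rfl

theorem card_vtx (t : Tree) : Nat.card t.Vtx = t.necklaces.card := by
  rw [← sum_word, Multiset.card_sum, Nat.card_eq_fintype_card]
  simp

end Tree

variable (Q : Set (List Letter))

-- The fibres are taken over pairs of a multiset of necklaces and a marked type. They are finite
-- even for infinite `Q`, because the multiset fixes the available words, and `ncard_mul_count`
-- compares their cardinalities.
open Classical in
theorem exists_equiv_markedF0_markedC : ∃ e : IsoClass (IsMarkedF0 Q) ≃ IsoClass (IsMarkedC Q),
    ∀ c, (e c).necklaces = c.necklaces ∧ (e c).markedNecklace = c.markedNecklace := by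
  obtain ⟨e1, h1⟩ := exists_equiv_markedF0 Q
  obtain ⟨e2, h2⟩ := exists_equiv_markedC Q
  suffices h : ∃ e : (Σ t : {t : Tree // t.IsQTree Q ∧ t.Nonneg ∧ t.exc = 0}, t.1.Vtx) ≃
      {t : Tree // t.IsCompanion Q ∧ t.rootKind = none}, ∀ x,
      ((e x).1.necklaces, (e x).1.markWord) = (x.1.1.necklaces, some (x.1.1.word x.2)) by
    obtain ⟨e, he⟩ := h
    refine ⟨e1.trans (e.trans e2.symm), fun c => ?_⟩
    have h3 := h2 (e2.symm (e (e1 c)))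
    rw [Equiv.apply_symm_apply] at h3
    have h4 := Prod.ext_iff.1 (he (e1 c))
    exact ⟨h3.1.symm.trans (h4.1.trans (h1 c).1), h3.2.symm.trans (h4.2.trans (h1 c).2)⟩
  refine exists_equiv_of_card_fiber
    (X := Σ t : {t : Tree // t.IsQTree Q ∧ t.Nonneg ∧ t.exc = 0}, t.1.Vtx)
    (Y := {t : Tree // t.IsCompanion Q ∧ t.rootKind = none})
    (fun x => (x.1.1.necklaces, some (x.1.1.word x.2))) (fun t => (t.1.necklaces, t.1.markWord)) ?_ ?_ ?_
  · rintro ⟨M, o⟩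
    have : Finite {t : Tree // t.necklaces = M} := Tree.finite_necklaces_eq M
    refine Finite.of_injective (β := Σ t : {t : Tree // t.necklaces = M}, t.1.Vtx)
      (fun x => ⟨⟨x.1.1.1, congrArg Prod.fst x.2⟩, x.1.2⟩) ?_
    rintro ⟨⟨⟨t, ht⟩, v⟩, hx⟩ ⟨⟨⟨t', ht'⟩, v'⟩, hx'⟩ h
    obtain ⟨h1, h2⟩ := Sigma.mk.inj_iff.1 h
    cases h1
    cases h2
    rfl
  · rintro ⟨M, o⟩
    have : Finite {t : Tree // t.necklaces = M} := Tree.finite_necklaces_eq M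
    exact Finite.of_injective (β := {t : Tree // t.necklaces = M})
      (fun x => ⟨x.1.1, congrArg Prod.fst x.2⟩) fun x y h =>
        Subtype.ext (Subtype.ext (congrArg (fun z : {t : Tree // t.necklaces = M} => z.1) h :))
  · rintro ⟨M, _ | s⟩
    · have i1 : IsEmpty {x : Σ t : {t : Tree // t.IsQTree Q ∧ t.Nonneg ∧ t.exc = 0}, t.1.Vtx //
          (x.1.1.necklaces, some (x.1.1.word x.2)) = (M, none)} :=
        ⟨fun x => nomatch (Prod.ext_iff.1 x.2).2⟩
      have i2 : IsEmpty {t : {t : Tree // t.IsCompanion Q ∧ t.rootKind = none} //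
          (t.1.necklaces, t.1.markWord) = (M, none)} := by
        refine ⟨?_⟩
        rintro ⟨⟨_ | ⟨s, _ | p, ch⟩, h⟩, hx⟩
        · exact h.1.ne_leaf rfl
        · exact nomatch (Prod.ext_iff.1 hx).2
        · exact nomatch h.2
      rw [Nat.card_of_isEmpty, Nat.card_of_isEmpty]
    · set A := {t : Tree | (t.IsQTree Q ∧ t.Nonneg ∧ t.exc = 0) ∧ t.necklaces = M} with hA
      set B := {t : Tree | ((t.IsCompanion Q ∧ t.rootKind = none) ∧ t.markWord = some s) ∧ t.necklaces = M}
        with hB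
      have hfA : A.Finite := (Tree.finite_necklaces_eq M).subset fun t ht => ht.2
      have : Fintype A := hfA.fintype
      let f1 : {x : Σ t : {t : Tree // t.IsQTree Q ∧ t.Nonneg ∧ t.exc = 0}, t.1.Vtx //
          (x.1.1.necklaces, some (x.1.1.word x.2)) = (M, some s)} ≃ Σ t : A, {v : t.1.Vtx // t.1.word v = s} :=
        { toFun := fun x => ⟨⟨x.1.1.1, x.1.1.2, (Prod.ext_iff.1 x.2).1⟩, x.1.2,
            Option.some.inj (Prod.ext_iff.1 x.2).2⟩
          invFun := fun x => ⟨⟨⟨x.1.1, x.1.2.1⟩, x.2.1⟩, Prod.ext x.1.2.2 (congrArg some x.2.2)⟩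
          left_inv := fun x => rfl
          right_inv := fun x => rfl }
      let f2 : {t : {t : Tree // t.IsCompanion Q ∧ t.rootKind = none} //
          (t.1.necklaces, t.1.markWord) = (M, some s)} ≃ B :=
        { toFun := fun x => ⟨x.1.1, ⟨x.1.2, (Prod.ext_iff.1 x.2).2⟩, (Prod.ext_iff.1 x.2).1⟩
          invFun := fun x => ⟨⟨x.1, x.2.1.1⟩, Prod.ext x.2.2 x.2.1.2⟩
          left_inv := fun x => rfl
          right_inv := fun x => rfl }
      rw [Nat.card_congr f1, Nat.card_congr f2, Nat.card_sigma]
      refine Eq.trans ?_ (Tree.ncard_mul_count Q M s)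
      rw [Finset.sum_congr rfl (g := fun _ => M.count s), Finset.sum_const, smul_eq_mul, mul_comm]
      · congr 1
        rw [Finset.card_univ, ← Nat.card_eq_fintype_card]
        rfl
      · intro t _
        rw [Tree.card_word_eq, t.2.2]

/-- Companion trees with a marked necklace, cut at the pearls of the marked necklace. -/
theorem exists_equiv_markedC_pairs : ∃ e : IsoClass (IsMarkedC Q) ≃ Pairs Q,
    ∀ c, (e c).necklaces = c.necklaces ∧ some (e c).2.1.1 = c.markedNecklace := by
  obtain ⟨e2, h2⟩ := exists_equiv_markedC Q
  choose e1 h1 using exists_equiv_C Q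
  let ch : ∀ x : Pairs Q, Pos x.2.1.1 → Tree := fun x q =>
    match q with
    | none => x.1.elim .leaf fun c => (e1 _ c).1
    | some i => (e1 _ (x.2.2 i)).1
  have hch : ∀ x, (Tree.node x.2.1.1 none (ch x)).IsCompanion Q := fun x => by
    refine ⟨x.2.1.2, fun q => ⟨nofun, fun _ => ?_⟩⟩
    change ch x q ∈ Tree.compSlot Q (posKind x.2.1.1 q)
    rcases q with _ | i
    · change ch x none ∈ Tree.compSlot Q none
      rw [Tree.compSlot_none]
      rcases x with ⟨_ | c, s⟩
      · exact .inl rfl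
      · exact .inr (e1 _ c).2
    · change ch x (some i) ∈ Tree.compSlot Q (some (x.2.1.1.get i))
      rw [Tree.compSlot_some]
      exact (e1 _ (x.2.2 i)).2
  let g : Pairs Q → {t : Tree // t.IsCompanion Q ∧ t.rootKind = none} := fun x => ⟨_, hch x, rfl⟩
  have hg : Function.Bijective g := by
    constructor
    · rintro ⟨o, ⟨s, hs⟩, a⟩ ⟨o', ⟨s', hs'⟩, a'⟩ h
      have h := Subtype.ext_iff.1 h
      injection h with h3 _ h4
      obtain rfl : s = s' := h3
      have h4 := eq_of_heq h4
      obtain rfl : a = a' := funext fun i => (e1 _).injective (Subtype.ext (congrFun h4 (some i)))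
      obtain rfl : o = o' := by
        have h5 := congrFun h4 none
        rcases o with _ | c <;> rcases o' with _ | c'
        · rfl
        · exact absurd h5.symm (e1 _ c').2.1.ne_leaf
        · exact absurd h5 (e1 _ c).2.1.ne_leaf
        · exact congrArg some ((e1 _).injective (Subtype.ext h5))
      rfl
    · rintro ⟨_ | ⟨s, _ | p, c⟩, ht⟩
      · exact absurd rfl ht.1.ne_leaf
      · have hc : ∀ q, c q ∈ Tree.compSlot Q (posKind s q) := fun q => (ht.1.2 q).2 nofun
        have hi : ∀ i, c (some i) ∈ Tree.compSet Q (s.get i).partner := fun i => by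
          rw [← Tree.compSlot_some]
          exact hc (some i)
        obtain ⟨o, ho⟩ : ∃ o : Option (C Q (some .bullet)), o.elim .leaf (fun c => (e1 _ c).1) = c none := by
          have := hc none
          change c none ∈ Tree.compSlot Q none at this
          rw [Tree.compSlot_none] at this
          rcases this with h | h
          · exact ⟨none, h.symm⟩
          · exact ⟨some ((e1 _).symm ⟨_, h⟩), by simp⟩
        refine ⟨⟨o, ⟨s, ht.1.1⟩, fun i => (e1 _).symm ⟨_, hi i⟩⟩, Subtype.ext ?_⟩
        refine congrArg (Tree.node s none) (funext fun q => ?_)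
        rcases q with _ | i
        · exact ho
        · exact congrArg Subtype.val ((e1 _).apply_symm_apply _)
      · exact nomatch ht.2
  have hgn : ∀ x, (g x).1.necklaces = x.necklaces := fun x => by
    change x.2.1.1 ::ₘ ∑ q, (ch x q).necklaces = _
    rw [Fintype.sum_option, Pairs.necklaces, Multiset.add_cons]
    congr 2
    · rcases x with ⟨_ | c, s⟩
      · rfl
      · exact (h1 _ c).1
    · exact Finset.sum_congr rfl fun i _ => (h1 _ _).1
  refine ⟨e2.trans (Equiv.ofBijective g hg).symm, fun c => ?_⟩
  obtain ⟨x, hx⟩ := hg.2 (e2 c)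
  have : (Equiv.ofBijective g hg).symm (e2 c) = x := by
    rw [← hx]
    exact (Equiv.ofBijective g hg).symm_apply_apply x
  rw [Equiv.trans_apply, this, ← (h2 c).1, ← (h2 c).2, ← hx]
  exact ⟨(hgn x).symm, rfl⟩

end Necklace

/-! ### Finiteness in each size, and the derivative of `f`. -/

namespace Necklace

theorem IsoClass.size_eq_card {P : Decorated → Prop} (c : IsoClass P) : c.size = c.necklaces.card := by
  induction c using Quotient.ind with
  | _ A =>
    change A.1.size = A.1.necklaces.card
    rw [Decorated.necklaces, Multiset.card_map]
    exact (Finset.card_fin _).symm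

namespace Tree

/-- The total number of letters of the necklaces of a tree. -/
def letters (t : Tree) : ℕ := (t.necklaces.map List.length).sum

theorem letters_node (s : List Letter) (p : Option (Pos s)) (ch : Pos s → Tree) :
    (node s p ch).letters = (ch none).letters + ∑ i : Fin s.length, (1 + (ch (some i)).letters) := by
  have h := map_sum (Multiset.mapAddMonoidHom List.length) (fun q => (ch q).necklaces) Finset.univ
  simp only [Multiset.coe_mapAddMonoidHom] at h
  have h2 := map_sum Multiset.sumAddMonoidHom (fun q => (ch q).necklaces.map List.length) Finset.univ
  simp only [Multiset.coe_sumAddMonoidHom] at h2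
  rw [letters, necklaces, Multiset.map_cons, Multiset.sum_cons, h, h2, Fintype.sum_option,
    Finset.sum_add_distrib]
  simp only [Finset.sum_const, Finset.card_univ, Fintype.card_fin, smul_eq_mul, mul_one]
  simp only [letters]
  ring

theorem card_necklaces_node (s : List Letter) (p : Option (Pos s)) (ch : Pos s → Tree) :
    (node s p ch).necklaces.card = 1 + ((ch none).necklaces.card +
      ∑ i : Fin s.length, (ch (some i)).necklaces.card) := by
  rw [necklaces, Multiset.card_cons, Multiset.card_sum, Fintype.sum_option, add_comm]

@[simp] theorem letters_leaf : leaf.letters = 0 := rfl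
@[simp] theorem card_necklaces_leaf : leaf.necklaces.card = 0 := rfl

variable {Q : Set (List Letter)}

/-- Every letter except possibly the root is an end of one of the `n - 1` edges of a tree with `n`
necklaces, so there are at most `2 (n - 1) + 1` letters. -/
theorem IsCompanion.letters_lt : ∀ {t : Tree}, t.IsCompanion Q → t.letters + 1 ≤ 2 * t.necklaces.card
  | leaf, h => h.elim
  | node s p ch, h => by
    classical
    rw [letters_node, card_necklaces_node]
    have h0 : (ch none).letters ≤ 2 * (ch none).necklaces.card := by
      by_cases hp : p = some none
      · rw [(h.2 none).1 hp]; simp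
      · rcases (h.2 none).2 hp with h' | ⟨k, -, -, h'⟩
        · rw [h'.1]; simp
        · have := IsCompanion.letters_lt h'
          omega
    have h1 : ∑ i : Fin s.length, (1 + (ch (some i)).letters) ≤
        ∑ i : Fin s.length, (2 * (ch (some i)).necklaces.card + if p = some (some i) then 1 else 0) :=
      Finset.sum_le_sum fun i _ => by
        split_ifs with hp
        · rw [(h.2 (some i)).1 hp]; simp
        · rcases (h.2 (some i)).2 hp with h' | ⟨k, -, -, h'⟩
          · exact nomatch h'.2
          · have := IsCompanion.letters_lt h'
            omega
    -- At most one letter of the top necklace is the root, and it is the only letter without an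
    -- attached tree.
    have h2 : ∑ i : Fin s.length, (if p = some (some i) then 1 else 0) ≤ 1 := by
      rw [Finset.sum_boole, Nat.cast_id, Finset.card_le_one]
      intro a ha b hb
      have ha := (Finset.mem_filter.1 ha).2
      have hb := (Finset.mem_filter.1 hb).2
      exact Option.some.inj (Option.some.inj (ha.symm.trans hb))
    have h3 : ∑ i : Fin s.length, (2 * (ch (some i)).necklaces.card + if p = some (some i) then 1 else 0) =
        2 * ∑ i : Fin s.length, (ch (some i)).necklaces.card +
          ∑ i : Fin s.length, if p = some (some i) then 1 else 0 := by
      rw [Finset.sum_add_distrib, ← Finset.mul_sum]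
    omega

/-- The `●`- and `♦`-pearls correspond to the `n - 1` edges, and the number of `▲`-pearls is the
excess plus the number of `♦`-pearls, which is at most the excess plus `n - 1`. -/
theorem IsQTree.letters_le : ∀ {t : Tree}, t.IsQTree Q → (t.letters : ℤ) + 2 ≤ 2 * t.necklaces.card + t.exc
  | leaf, h => h.1.elim
  | node s p ch, h => by
    obtain ⟨h, hr⟩ := h
    obtain rfl : p = some none := by
      rcases p with _ | _ | p
      · cases hr
      · rfl
      · cases hr
    rw [letters_node, card_necklaces_node, (h.2 none).1 rfl]
    have h0 : (node s (some none) ch).exc =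
        ∑ i : Fin s.length, (Kind.exc (some (s.get i)) + (ch (some i)).exc) := by
      rw [exc, Fintype.sum_option, (h.2 none).1 rfl]
      exact zero_add _
    have h1 : ∑ i : Fin s.length, (1 + (ch (some i)).letters : ℤ) ≤
        ∑ i : Fin s.length, (2 * ((ch (some i)).necklaces.card : ℤ) +
          (Kind.exc (some (s.get i)) + (ch (some i)).exc)) :=
      Finset.sum_le_sum fun i _ => by
        rcases (h.2 (some i)).2 nofun with ⟨h', h2⟩ | ⟨k, h1, h2, h3⟩
        · have h2 : some (s.get i) = some Letter.triangle := h2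
          rw [h', h2]
          simp [Kind.exc, exc]
        · change treeRel (some (s.get i)) k at h2
          -- The `2` on the left of the induction hypothesis pays for the letter itself and for a
          -- possible `-1` from a `♦`.
          have h4 : k = none ∧ -1 ≤ Kind.exc (some (s.get i)) := by
            generalize s.get i = y at h2
            rcases y with _ | _ | _ <;> rcases k with _ | _ | _ | _ <;> simp [treeRel, EdgeRel, Kind.exc] at h2 ⊢
          obtain ⟨rfl, h4⟩ := h4
          have := IsQTree.letters_le ⟨h3, h1⟩
          omega
    have h2 : ∑ i : Fin s.length, (2 * ((ch (some i)).necklaces.card : ℤ) +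
          (Kind.exc (some (s.get i)) + (ch (some i)).exc)) =
        2 * ∑ i : Fin s.length, ((ch (some i)).necklaces.card : ℤ) + (node s (some none) ch).exc := by
      rw [Finset.sum_add_distrib, ← Finset.mul_sum, ← h0]
    rw [h2] at h1
    push_cast
    simp only [letters_leaf, card_necklaces_leaf]
    push_cast
    linarith

/-- A bound on the total number of letters bounds the length of each word, and the alphabet is
finite, so only finitely many words of a possibly infinite `Q` can occur. -/
theorem finite_of_letters_le (n : ℕ) : {t : Tree | t.necklaces.card = n ∧ t.letters ≤ 2 * n}.Finite := by
  refine (finite_card_le (List.finite_length_le Letter (2 * n)).toFinset n).subset ?_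
  rintro t ⟨h1, h2⟩
  refine ⟨h1.le, fun s hs => ?_⟩
  rw [Set.Finite.mem_toFinset]
  exact (Multiset.single_le_sum (fun _ _ => Nat.zero_le _) _ (Multiset.mem_map_of_mem _ hs)).trans h2

end Tree

theorem finite_tree_subtype {T : Tree → Prop} (hT : ∀ t, T t → t.letters ≤ 2 * t.necklaces.card) (n : ℕ) :
    Finite {t : {t // T t} // t.1.necklaces.card = n} := by
  have : Finite {t : Tree | t.necklaces.card = n ∧ t.letters ≤ 2 * n} := Tree.finite_of_letters_le n
  exact Finite.of_injective (β := {t : Tree | t.necklaces.card = n ∧ t.letters ≤ 2 * n})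
    (fun x => ⟨x.1.1, x.2, (hT _ x.1.2).trans_eq (congrArg _ x.2)⟩)
    fun x y h => Subtype.ext (Subtype.ext
      (congrArg (fun z : {t : Tree | t.necklaces.card = n ∧ t.letters ≤ 2 * n} => z.1) h :))

theorem finite_fiber_of_equiv {X Y : Type*} (e : X ≃ Y) {k : X → ℕ} {l : Y → ℕ} (h : ∀ x, l (e x) = k x)
    (n : ℕ) (hY : Finite {y // l y = n}) : Finite {x // k x = n} :=
  Finite.of_injective (fun x : {x // k x = n} => (⟨e x, (h _).trans x.2⟩ : {y // l y = n}))
    fun _ _ hxy => Subtype.ext (e.injective (congrArg Subtype.val hxy))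

variable (Q : Set (List Letter))

theorem finite_F0_tree (n : ℕ) :
    Finite {t : {t : Tree // t.IsQTree Q ∧ t.Nonneg ∧ t.exc = 0} // t.1.necklaces.card = n} :=
  finite_tree_subtype (fun t h => by
    have := Tree.IsQTree.letters_le h.1
    rw [h.2.2] at this
    omega) n

theorem finite_C (x : Kind) (n : ℕ) : Finite {c : C Q x // c.size = n} := by
  obtain ⟨e, he⟩ := exists_equiv_C Q x
  refine finite_fiber_of_equiv e (l := fun t => t.1.necklaces.card) (fun c => ?_) n
    (finite_tree_subtype (fun t h => by have := Tree.IsCompanion.letters_lt h.1; omega) n)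
  rw [(he c).1, c.size_eq_card]

theorem size_C_pos (x : Kind) (c : C Q x) : 0 < c.size := by
  obtain ⟨e, he⟩ := exists_equiv_C Q x
  have := Tree.IsCompanion.letters_lt (e c).2.1
  rw [c.size_eq_card, ← (he c).1]
  omega

theorem finite_F0 (n : ℕ) : Finite {c : IsoClass (IsF0 Q) // c.size = n} := by
  obtain ⟨e, he⟩ := exists_equiv_F0 Q
  refine finite_fiber_of_equiv e (l := fun t => t.1.necklaces.card) (fun c => ?_) n (finite_F0_tree Q n)
  rw [(he c).1, c.size_eq_card]

/-- Marked trees of a given size are pairs of a tree of this size and one of its necklaces. -/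
def markedFiberEquiv (n : ℕ) :
    {x : Σ t : {t : Tree // t.IsQTree Q ∧ t.Nonneg ∧ t.exc = 0}, t.1.Vtx // x.1.1.necklaces.card = n} ≃
    Σ t : {t : {t : Tree // t.IsQTree Q ∧ t.Nonneg ∧ t.exc = 0} // t.1.necklaces.card = n}, t.1.1.Vtx where
  toFun x := ⟨⟨x.1.1, x.2⟩, x.1.2⟩
  invFun x := ⟨⟨x.1.1, x.2⟩, x.1.2⟩
  left_inv _ := rfl
  right_inv _ := rfl

theorem finite_markedF0 (n : ℕ) : Finite {c : IsoClass (IsMarkedF0 Q) // c.size = n} := by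
  obtain ⟨e, he⟩ := exists_equiv_markedF0 Q
  have := finite_F0_tree Q n
  refine finite_fiber_of_equiv e (l := fun t => t.1.1.necklaces.card) (fun c => ?_) n
    (Finite.of_equiv _ (markedFiberEquiv Q n).symm)
  rw [(he c).1, c.size_eq_card]

theorem card_fiber_congr {X Y : Type*} (e : X ≃ Y) {k : X → ℕ} {l : Y → ℕ} (h : ∀ x, l (e x) = k x)
    (n : ℕ) : Nat.card {x // k x = n} = Nat.card {y // l y = n} :=
  Nat.card_congr (e.subtypeEquiv fun x => by rw [h])

theorem card_markedF0 (n : ℕ) : Nat.card {c : IsoClass (IsMarkedF0 Q) // c.size = n} =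
    n * Nat.card {c : IsoClass (IsF0 Q) // c.size = n} := by
  obtain ⟨e, he⟩ := exists_equiv_markedF0 Q
  obtain ⟨e', he'⟩ := exists_equiv_F0 Q
  rw [card_fiber_congr e (l := fun t => t.1.1.necklaces.card) (fun c => by rw [(he c).1, c.size_eq_card]),
    card_fiber_congr e' (l := fun t => t.1.necklaces.card) (fun c => by rw [(he' c).1, c.size_eq_card]),
    Nat.card_congr (markedFiberEquiv Q n)]
  have := finite_F0_tree Q n
  have := Fintype.ofFinite {t : {t : Tree // t.IsQTree Q ∧ t.Nonneg ∧ t.exc = 0} // t.1.necklaces.card = n}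
  rw [Nat.card_sigma, Finset.sum_congr rfl (g := fun _ => n), Finset.sum_const, smul_eq_mul, mul_comm,
    Finset.card_univ, Nat.card_eq_fintype_card]
  exact fun t _ => (Tree.card_vtx _).trans t.2

/-- A tree with `n` necklaces has `n` distinct markings, by rigidity (`card_markedF0`). -/
theorem X_mul_derivative_gf :
    PowerSeries.X * PowerSeries.derivative ℤ (IsoClass.gf (IsF0 Q)) = IsoClass.gf (IsMarkedF0 Q) := by
  ext n
  rw [IsoClass.gf, IsoClass.gf, PowerSeries.coeff_mk, card_markedF0]
  cases n with
  | zero => simp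
  | succ n =>
    rw [PowerSeries.coeff_succ_X_mul, PowerSeries.coeff_derivative, PowerSeries.coeff_mk]
    push_cast
    ring

end Necklace

/-! ### From bijections to identities of power series. -/

namespace Necklace

/-- The generating function of a class by a size. -/
noncomputable def classGF {X : Type*} (k : X → ℕ) : PowerSeries ℤ :=
  PowerSeries.mk fun n => (Nat.card {x // k x = n} : ℤ)

section classGF

variable {X Y : Type*} {k : X → ℕ} {l : Y → ℕ}

theorem coeff_classGF (k : X → ℕ) (n : ℕ) :
    PowerSeries.coeff n (classGF k) = (Nat.card {x // k x = n} : ℤ) := PowerSeries.coeff_mk _ _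

theorem classGF_congr (e : X ≃ Y) (h : ∀ x, l (e x) = k x) : classGF k = classGF l := by
  ext n
  rw [coeff_classGF, coeff_classGF, card_fiber_congr e h]

/-- The pairs of total size `n`. -/
def prodFiberEquiv (k : X → ℕ) (l : Y → ℕ) (n : ℕ) : {x : X × Y // k x.1 + l x.2 = n} ≃
    Σ p : Finset.HasAntidiagonal.antidiagonal n, {x // k x = p.1.1} × {y // l y = p.1.2} where
  toFun x := ⟨⟨(k x.1.1, l x.1.2), Finset.HasAntidiagonal.mem_antidiagonal.2 x.2⟩, ⟨x.1.1, rfl⟩, ⟨x.1.2, rfl⟩⟩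
  invFun x := ⟨(x.2.1.1, x.2.2.1), by
    rw [x.2.1.2, x.2.2.2]
    exact Finset.HasAntidiagonal.mem_antidiagonal.1 x.1.2⟩
  left_inv _ := rfl
  right_inv := by
    rintro ⟨⟨⟨i, j⟩, h⟩, ⟨a, ha⟩, ⟨b, hb⟩⟩
    change k a = i at ha
    change l b = j at hb
    subst ha
    subst hb
    rfl

theorem finite_prod_fiber (hk : ∀ n, Finite {x // k x = n}) (hl : ∀ n, Finite {y // l y = n}) (n : ℕ) :
    Finite {x : X × Y // k x.1 + l x.2 = n} :=
  Finite.of_equiv _ (prodFiberEquiv k l n).symm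

theorem classGF_prod (hk : ∀ n, Finite {x // k x = n}) (hl : ∀ n, Finite {y // l y = n}) :
    classGF (fun x : X × Y => k x.1 + l x.2) = classGF k * classGF l := by
  ext n
  rw [coeff_classGF, PowerSeries.coeff_mul, Nat.card_congr (prodFiberEquiv k l n), Nat.card_sigma,
    Nat.cast_sum, Finset.sum_coe_sort (Finset.HasAntidiagonal.antidiagonal n)
      fun p => ((Nat.card ({x // k x = p.1} × {y // l y = p.2}) : ℕ) : ℤ)]
  exact Finset.sum_congr rfl fun p _ => by rw [Nat.card_prod, Nat.cast_mul, coeff_classGF, coeff_classGF]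

theorem classGF_pi : ∀ {n : ℕ} {Z : Fin n → Type} (m : ∀ i, Z i → ℕ)
    (_ : ∀ i j, Finite {z // m i z = j}), (∀ j, Finite {z : ∀ i, Z i // ∑ i, m i (z i) = j}) ∧
    classGF (fun z : ∀ i, Z i => ∑ i, m i (z i)) = ∏ i, classGF (m i)
  | 0, Z, m, hm => by
    refine ⟨fun j => inferInstance, ?_⟩
    ext n
    rw [coeff_classGF, Finset.univ_eq_empty, Finset.prod_empty, PowerSeries.coeff_one]
    simp only [Finset.sum_empty]
    split_ifs with h
    · subst h
      simp
    · have : IsEmpty {z : ∀ i, Z i // 0 = n} := ⟨fun z => h z.2.symm⟩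
      simp
  | n + 1, Z, m, hm => by
    obtain ⟨h1, h2⟩ := classGF_pi (fun i => m i.succ) fun i => hm i.succ
    have e : ∀ x : (∀ i, Z i), m 0 ((Fin.consEquiv Z).symm x).1 +
        ∑ i : Fin n, m i.succ (((Fin.consEquiv Z).symm x).2 i) = ∑ i, m i (x i) := fun x => by
      rw [Fin.sum_univ_succ]
      rfl
    refine ⟨fun j => finite_fiber_of_equiv (Fin.consEquiv Z).symm (l := fun y =>
      m 0 y.1 + ∑ i : Fin n, m i.succ (y.2 i)) e j (finite_prod_fiber (hm 0) h1 j), ?_⟩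
    rw [classGF_congr (Fin.consEquiv Z).symm (l := fun y => m 0 y.1 + ∑ i : Fin n, m i.succ (y.2 i)) e,
      classGF_prod (hm 0) h1, h2, Fin.prod_univ_succ]

/-- An optional object of size `n`. -/
def optionFiberEquiv (k : X → ℕ) (n : ℕ) : {o : Option X // o.elim 0 k = n} ≃
    {_u : Unit // 0 = n} ⊕ {x // k x = n} where
  toFun
    | ⟨none, h⟩ => .inl ⟨(), h⟩
    | ⟨some x, h⟩ => .inr ⟨x, h⟩
  invFun
    | .inl u => ⟨none, u.2⟩
    | .inr x => ⟨some x.1, x.2⟩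
  left_inv := by rintro ⟨_ | x, h⟩ <;> rfl
  right_inv := by rintro (u | x) <;> rfl

theorem finite_option_fiber (hk : ∀ n, Finite {x // k x = n}) (n : ℕ) :
    Finite {o : Option X // o.elim 0 k = n} :=
  Finite.of_equiv _ (optionFiberEquiv k n).symm

theorem classGF_option (hk : ∀ n, Finite {x // k x = n}) :
    classGF (fun o : Option X => o.elim 0 k) = 1 + classGF k := by
  ext n
  rw [coeff_classGF, Nat.card_congr (optionFiberEquiv k n), Nat.card_sum, map_add, coeff_classGF,
    PowerSeries.coeff_one, Nat.cast_add]
  congr 1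
  split_ifs with h
  · subst h
    simp
  · have : IsEmpty {_u : Unit // 0 = n} := ⟨fun z => h z.2.symm⟩
    simp

theorem classGF_add_one (k : X → ℕ) : classGF (fun x => k x + 1) = PowerSeries.X * classGF k := by
  ext n
  cases n with
  | zero =>
    rw [coeff_classGF]
    simp
  | succ n =>
    rw [coeff_classGF, PowerSeries.coeff_succ_X_mul, coeff_classGF]
    simp only [Nat.add_right_cancel_iff]

end classGF

variable (Q : Set (List Letter))

/-- A companion tree has at least one necklace, so the series have no constant term; with finitely
many variables this suffices. -/
theorem hasSubst_companionSeries : MvPowerSeries.HasSubst (companionSeries Q) := by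
  refine MvPowerSeries.hasSubst_of_constantCoeff_zero fun x => ?_
  change PowerSeries.constantCoeff (IsoClass.gf (IsC Q x.partner)) = 0
  rw [← PowerSeries.coeff_zero_eq_constantCoeff_apply, IsoClass.gf, PowerSeries.coeff_mk]
  have : IsEmpty {c : C Q x.partner // c.size = 0} := ⟨fun c => (size_C_pos Q _ c.1).ne' c.2⟩
  simp

/-- The numbers of occurrences of the letters in a word. -/
noncomputable def letterCount (s : List Letter) : Letter →₀ ℕ := Finsupp.equivFunOnFinite.symm fun x => s.count x

theorem prod_get_eq_prod_letterCount {B : Type*} [CommMonoid B] (f : Letter → B) (s : List Letter) :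
    ∏ i : Fin s.length, f (s.get i) = (letterCount s).prod fun x e => f x ^ e := by
  rw [Finsupp.prod_fintype _ _ fun x => pow_zero _]
  change ∏ i : Fin s.length, f s[i.1] = _
  rw [Fin.prod_univ_fun_getElem, Finset.prod_list_map_count]
  refine Finset.prod_subset (Finset.subset_univ _) fun x _ hx => ?_
  rw [List.count_eq_zero_of_not_mem fun h => hx (List.mem_toFinset.2 h), pow_zero]

theorem length_eq_of_letterCount_eq {s s' : List Letter} (h : letterCount s = letterCount s') :
    s.length = s'.length :=
  (List.perm_iff_count.2 fun x => DFunLike.congr_fun h x).length_eq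

/-- The number of trees attached to a necklace is counted by total size. -/
theorem classGF_attached_word (s : List Letter) :
    classGF (fun c : ∀ i : Fin s.length, C Q (s.get i).partner => ∑ i, (c i).size) =
      (letterCount s).prod fun x e => companionSeries Q x ^ e := by
  rw [← prod_get_eq_prod_letterCount]
  exact (classGF_pi (fun i (c : C Q (s.get i).partner) => c.size) fun i => finite_C Q _).2

theorem length_le_sum_size (s : List Letter) (c : ∀ i : Fin s.length, C Q (s.get i).partner) :
    s.length ≤ ∑ i, (c i).size := by
  calc s.length = ∑ i : Fin s.length, 1 := by simp
    _ ≤ _ := Finset.sum_le_sum fun i _ => size_C_pos Q _ (c i)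

/-- The total size of the trees attached to a necklace. -/
def Attached.size {Q : Set (List Letter)} (x : Attached Q) : ℕ := ∑ i, (x.2 i).size

/-- Attached trees of total size `n`. -/
def attachedFiberEquiv (n : ℕ) : {x : Attached Q // x.size = n} ≃
    Σ s : {s : Q // s.1.length ≤ n}, {c : ∀ i : Fin s.1.1.length, C Q (s.1.1.get i).partner //
      ∑ i, (c i).size = n} where
  toFun x := ⟨⟨x.1.1, (length_le_sum_size Q _ x.1.2).trans_eq x.2⟩, x.1.2, x.2⟩
  invFun x := ⟨⟨x.1.1, x.2.1⟩, x.2.2⟩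
  left_inv _ := rfl
  right_inv _ := rfl

instance finite_length_le (n : ℕ) : Finite {s : Q // s.1.length ≤ n} :=
  have : Finite {s : List Letter | s.length ≤ n} := List.finite_length_le Letter n
  Finite.of_injective (fun x => (⟨x.1.1, x.2⟩ : {s : List Letter | s.length ≤ n})) fun _ _ h =>
    Subtype.ext (Subtype.ext (congrArg (fun z : {s : List Letter | s.length ≤ n} => z.1) h :))

theorem finite_attached_fiber (n : ℕ) : Finite {x : Attached Q // x.size = n} := by
  have : ∀ s : {s : Q // s.1.length ≤ n}, Finite {c : ∀ i : Fin s.1.1.length, C Q (s.1.1.get i).partner //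
      ∑ i, (c i).size = n} := fun s =>
    (classGF_pi (fun i (c : C Q (s.1.1.get i).partner) => c.size) fun i => finite_C Q _).1 n
  exact Finite.of_equiv _ (attachedFiberEquiv Q n).symm

/-- The trees attached to a word contribute a product of companion series that depends only on its
letter counts. Grouping the words by these counts turns the sum over `Q` into the substitution in
`vertexGF`. -/
theorem classGF_attached :
    classGF (Attached.size (Q := Q)) = MvPowerSeries.subst (companionSeries Q) (vertexGF Q) := by
  classical
  ext n
  have := Fintype.ofFinite {s : Q // s.1.length ≤ n}
  set P : (Letter →₀ ℕ) → ℤ := fun d => PowerSeries.coeff n (d.prod fun x e => companionSeries Q x ^ e)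
    with hP
  have hc : ∀ s : List Letter, (Nat.card {c : ∀ i : Fin s.length, C Q (s.get i).partner //
      ∑ i, (c i).size = n} : ℤ) = P (letterCount s) := fun s => by
    rw [hP]
    simp only
    rw [← classGF_attached_word, coeff_classGF]
  have hfin : ∀ s : {s : Q // s.1.length ≤ n}, Finite {c : ∀ i : Fin s.1.1.length, C Q (s.1.1.get i).partner //
      ∑ i, (c i).size = n} := fun s =>
    (classGF_pi (fun i (c : C Q (s.1.1.get i).partner) => c.size) fun i => finite_C Q _).1 n
  rw [coeff_classGF, Nat.card_congr (attachedFiberEquiv Q n), Nat.card_sigma, Nat.cast_sum]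
  simp only [hc]
  -- Only words of length at most `n` can carry attached trees of total size `n`; these are grouped
  -- by their letter counts.
  rw [Finset.sum_comp P fun s : {s : Q // s.1.length ≤ n} => letterCount s.1.1]
  have h := MvPowerSeries.coeff_subst (hasSubst_companionSeries Q) (vertexGF Q) (Finsupp.single () n)
  refine Eq.trans ?_ h.symm
  have hz : ∀ d : Letter →₀ ℕ, MvPowerSeries.coeff d (vertexGF Q) =
      (Nat.card {s : Q // letterCount s.1 = d} : ℤ) := fun d => by
    change (Nat.card _ : ℤ) = _
    rw [Nat.card_congr (Equiv.subtypeEquivRight fun s => ?_)]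
    exact (DFunLike.ext_iff (f := letterCount s.1) (g := d)).symm
  symm
  refine (finsum_eq_sum_of_support_subset (s := Finset.univ.image
    fun s : {s : Q // s.1.length ≤ n} => letterCount s.1.1) _ ?_).trans ?_
  -- A nonzero term needs a word with counts `d` and attached trees of total size `n`. Each attached
  -- tree is nonempty, so the length of that word is at most `n`.
  · intro d hd
    rw [Function.mem_support, hz] at hd
    have h1 := left_ne_zero_of_smul hd
    have h2 : P d ≠ 0 := right_ne_zero_of_smul hd
    obtain ⟨⟨s, rfl⟩⟩ : Nonempty {s : Q // letterCount s.1 = d} := by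
      by_contra h
      rw [not_nonempty_iff] at h
      simp at h1
    rw [← hc] at h2
    obtain ⟨⟨c, hc⟩⟩ : Nonempty {c : ∀ i : Fin s.1.length, C Q (s.1.get i).partner //
        ∑ i, (c i).size = n} := by
      by_contra h
      rw [not_nonempty_iff] at h
      simp at h2
    simp only [Finset.coe_image, Set.mem_image, Finset.coe_univ, Set.mem_univ, true_and]
    exact ⟨⟨s, (length_le_sum_size Q _ c).trans_eq hc⟩, rfl⟩
  · refine Finset.sum_congr rfl fun d hd => ?_
    rw [hz]
    obtain ⟨s₀, -, rfl⟩ := Finset.mem_image.1 hd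
    rw [smul_eq_mul, nsmul_eq_mul]
    refine congrArg₂ (· * ·) (congrArg _ ?_) rfl
    rw [← Fintype.card_subtype, ← Nat.card_eq_fintype_card]
    -- Equal letter counts force equal lengths, so the restriction to length at most `n` loses no
    -- word with these counts.
    exact Nat.card_congr
      { toFun := fun s => ⟨⟨s.1, (length_eq_of_letterCount_eq s.2).trans_le s₀.2⟩, s.2⟩
        invFun := fun s => ⟨s.1.1, s.2⟩
        left_inv := fun _ => rfl
        right_inv := fun _ => rfl }

theorem Pairs.card_necklaces (x : Pairs Q) : x.necklaces.card =
    x.1.elim 0 IsoClass.size + (x.2.size + 1) := by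
  rw [Pairs.necklaces, Multiset.card_add, Multiset.card_cons, Multiset.card_sum]
  congr 1
  · rcases x with ⟨_ | c, s⟩
    · rfl
    · exact c.size_eq_card.symm
  · exact congrArg (· + 1) (Finset.sum_congr rfl fun i _ => (x.2.2 i).size_eq_card.symm)

/-- Both bijections preserve the number of necklaces. In `Pairs` the marked necklace contributes the
factor `X`, the optional tree at the `□` contributes `1 + C_●`, and the attached trees contribute
the substituted `Q`. -/
theorem gf_markedF0 : IsoClass.gf (IsMarkedF0 Q) = PowerSeries.X *
    ((1 + IsoClass.gf (IsC Q (some .bullet))) *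
      MvPowerSeries.subst (companionSeries Q) (vertexGF Q)) := by
  obtain ⟨e1, h1⟩ := exists_equiv_markedF0_markedC Q
  obtain ⟨e2, h2⟩ := exists_equiv_markedC_pairs Q
  have h3 : ∀ n, Finite {x : Attached Q // x.size + 1 = n} := fun n => by
    cases n with
    | zero => exact Finite.of_injective (β := Empty) (fun x => nomatch x.2) fun x => nomatch x.2
    | succ n =>
      simp only [Nat.add_right_cancel_iff]
      exact finite_attached_fiber Q n
  refine (classGF_congr (e1.trans e2) (k := IsoClass.size)
    (l := fun x : Pairs Q => x.1.elim 0 IsoClass.size + (x.2.size + 1)) fun c => ?_).trans ?_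
  · rw [← Pairs.card_necklaces, Equiv.trans_apply, (h2 _).1, (h1 _).1, c.size_eq_card]
  · rw [classGF_prod (X := Option (C Q (some .bullet))) (k := fun o => o.elim 0 IsoClass.size)
      (l := fun x : Attached Q => x.size + 1) (finite_option_fiber (finite_C Q _)) h3,
      classGF_option (finite_C Q _), classGF_add_one, classGF_attached, mul_left_comm]
    rfl

theorem derivative_gf : PowerSeries.derivative ℤ (IsoClass.gf (IsF0 Q)) =
    (1 + IsoClass.gf (IsC Q (some .bullet))) *
      MvPowerSeries.subst (companionSeries Q) (vertexGF Q) :=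
  mul_left_cancel₀ PowerSeries.X_ne_zero ((X_mul_derivative_gf Q).trans (gf_markedF0 Q))

end Necklace

theorem mainTheorem5 (Q : Set (List Necklace.Letter)) :
    -- necklace-preserving bijections
    (∃ e : Necklace.IsoClass (Necklace.IsMarkedF0 Q) ≃ Necklace.IsoClass (Necklace.IsMarkedC Q),
      ∀ τ, (e τ).necklaces = τ.necklaces ∧ (e τ).markedNecklace = τ.markedNecklace) ∧
    (∃ e : Necklace.IsoClass (Necklace.IsMarkedC Q) ≃ Necklace.Pairs Q,
      ∀ τ, (e τ).necklaces = τ.necklaces ∧ some (e τ).2.1.1 = τ.markedNecklace) ∧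
    -- the generating functions are well defined
    (∀ n, Finite {c : Necklace.IsoClass (Necklace.IsF0 Q) // c.size = n}) ∧
    (∀ n, Finite {c : Necklace.IsoClass (Necklace.IsMarkedF0 Q) // c.size = n}) ∧
    (∀ x n, Finite {c : Necklace.C Q x // c.size = n}) ∧
    MvPowerSeries.HasSubst (Necklace.companionSeries Q) ∧
    -- `df/dt` counts the non-negative trees of excess `0` with a marked necklace
    PowerSeries.X * PowerSeries.derivative ℤ (Necklace.IsoClass.gf (Necklace.IsF0 Q)) =
      Necklace.IsoClass.gf (Necklace.IsMarkedF0 Q) ∧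
    -- `df/dt = (1 + C_●) · Q(C_□, C_▲, C_♦)`
    PowerSeries.derivative ℤ (Necklace.IsoClass.gf (Necklace.IsF0 Q)) =
      (1 + Necklace.IsoClass.gf (Necklace.IsC Q (some .bullet))) *
        MvPowerSeries.subst (Necklace.companionSeries Q) (Necklace.vertexGF Q) := by
  exact ⟨Necklace.exists_equiv_markedF0_markedC Q, Necklace.exists_equiv_markedC_pairs Q,
    Necklace.finite_F0 Q, Necklace.finite_markedF0 Q, Necklace.finite_C Q,
    Necklace.hasSubst_companionSeries Q, Necklace.X_mul_derivative_gf Q, Necklace.derivative_gf Q⟩
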